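/- Let $M>0$ and consider a timelike geodesic (orbit) in the equatorial hyperplane of Schwarzschild spacetime of mass $M$, in coordinates $(t,r,\phi)$ with $\phi$ lifted continuously to $\mathbb R$, parametrized by proper time $\tau$ and maximally extended in $r>0$ (through the horizon $r=2M$ if it is reached, with the energy continuous there). Assume that it is non-circular ($r$ is not constant), that it enters the region $r>2M$, and that its angular momentum $L=r^2\dot\phi$ is non-zero; let $E=(1-2M/r)\dot t$ be its energy (both evaluated at an instant with $r>2M$). Put $v=\dot r$, $u=2M/r$, $\bar L=L/(2M)$, $\bar t=t/(2M)$, $\bar\tau=\tau/(2M)$, $$Q(u)=u^3-u^2+\bar L^{-2}u+(E^2-1)\bar L^{-2},$$ $$I^\Phi(a,b)=\int_a^b\frac{du}{\sqrt{Q}},\quad I^T(a,b)=\int_a^b\frac{du}{(1-u)u^2\sqrt{Q}},\quad I^{\mathcal T}(a,b)=\int_a^b\frac{du}{u^2\sqrt{Q}},$$ and, for a zero point $u_0=2M/r_0$, consider the integrals of motion $$\Phi=\phi+\operatorname{sgn}(v\bar L)\,I^\Phi(u_0,u),\quad \bar T=\bar t+\frac{\operatorname{sgn}(v)E}{|\bar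 L|}I^T(u_0,u),\quad \bar{\mathcal T}=\bar\tau+\frac{\operatorname{sgn}(v)}{|\bar L|}I^{\mathcal T}(u_0,u).$$ Here $r_0$ is a radius reached by the orbit which is either a turning point (TP: $v=0$ there), an inertial point (IP: $\ddot r=0$ there), or the horizon (HP: $r_0=2M$, $u_0=1$). The quantity $\bar T$ is considered where $r>2M$. In the HP case $I^T(1,u)=-\infty$ for $u<1$, so $\bar T$ takes values in $\{+\infty,-\infty\}$ there; the other quadratures converge. The orbit is bounded if $\sup r<\infty$; horizon-crossing if it reaches $r=2M$; asymptotically circular if $r$ tends to a constant greater than $2M$ as $\tau\to+\infty$ or as $\tau\to-\infty$; elliptic-like if $r$ ranges exactly over an interval $[r_*^-,r_*^+]$ with $2M<r_*^-<r_*^+$. (The unbounded orbits of none of these types are the hyperbolic-like and parabolic-like ones.) An apoapsis or periapsis is a point of local maximum or local minimum of $r$. Write $$\Delta\phi(a,b)=2\operatorname{sgn}(L)I^\Phi(a,b),\quad \Delta\bar t(a,b)=\frac{2E}{|\bar L|}I^T(a,b),\quad \Delta\bar\tau(a,b)=\frac{2}{|\bar L|}I^{\mathcal T}(a,b).$$ (i)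 $\Phi,\bar T,\bar{\mathcal T}$ are all constant on the entire orbit if and only if one of the following holds: TP case, and the orbit is unbounded, or is bounded but not elliptic-like; IP case, and the orbit is unbounded and either asymptotically circular or horizon-crossing; HP case, and the (horizon-crossing) orbit is unbounded, or is bounded and asymptotically circular. The constant value of $\bar T$ is infinite exactly in the HP case. (ii) In all other cases with an orbit that is not elliptic-like, the three quantities are double-valued: $v$ vanishes at exactly one instant, at which the orbit has, with $u=u_*$ there, an apoapsis if it is bounded and a periapsis if it is unbounded; each quantity is constant before and after this instant, with two different values; and there $\Phi$ and $\bar{\mathcal T}$ (and $\bar T$, when $u_0\neq1$) jump by $\Delta\phi(a,b)$, $\Delta\bar\tau(a,b)$ (and $\Delta\bar t(a,b)$), where $(a,b)=(u_*,u_0)$ at an apoapsis and $(a,b)=(u_0,u_*)$ at a periapsis. When $u_0=1$, $\bar T$ jumps from $E\cdot(-\infty)$ to $E\cdot(+\infty)$. Taken modulo $2\pi$ (away from $v=0$), $\Phi$ is single-valued if and only if $\Delta\phi(a,b)\in2\pi\mathbb Z$. (iii) If the orbit is elliptic-like, let $u_*^\pm=2M/r_*^\pm$. The three quantities are multi-valued: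 the instants with $v=0$ form a doubly infinite increasing sequence that partitions the orbit, consisting of alternating apoapsides with $u=u_*^+$ and periapsides with $u=u_*^-$; each quantity is constant between successive apsides (including an apsis at which $u=u_0$); $\Phi,\bar T,\bar{\mathcal T}$ jump by $\Delta\phi,\Delta\bar t,\Delta\bar\tau$ evaluated at $(u_*^+,u_0)$ at every apoapsis and at $(u_0,u_*^-)$ at every periapsis. In particular, if $u_0=u_*^-$ they jump exactly at every apoapsis, and if $u_0=u_*^+$ exactly at every periapsis, by the values at $(u_*^+,u_*^-)$, for which $\Delta\phi$ is the precession angle. For every $u_0$ the change over one radial period is the value at $(u_*^+,u_*^-)$, and each of the three quantities takes infinitely many values. Taken modulo $2\pi$ (away from $v=0$), $\Phi$ is single-valued if and only if both $\Delta\phi(u_*^+,u_0)$ and $\Delta\phi(u_0,u_*^-)$ lie in $2\pi\mathbb Z$. -/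

import Mathlib

open MeasureTheory

namespace Schwarzschild

/-- A timelike geodesic, parametrized by proper time, in the equatorial hyperplane of Schwarzschild
spacetime of mass `M`.  It is described by the coordinate functions `t`, `r`, `φ` on an open
interval `J` of proper times (`φ` is a continuous real lift of the angle).  The orbit may cross
the horizon `r = 2M`; there the coordinate `t` is singular, so `t` and the equations are only
used where `r ≠ 2M`, while `r`, `φ` and the energy `(1 - 2M/r) dt/dτ` continue regularly. -/
structure TimelikeGeodesic (M : ℝ) where
  J : Set ℝ
  t : ℝ → ℝ
  r : ℝ → ℝ
  φ : ℝ → ℝ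
  isOpen_J : IsOpen J
  ordConnected_J : J.OrdConnected
  nonempty_J : J.Nonempty
  r_pos : ∀ τ ∈ J, 0 < r τ
  contDiffOn_r : ContDiffOn ℝ 2 r J
  contDiffOn_φ : ContDiffOn ℝ 2 φ J
  contDiffOn_t : ContDiffOn ℝ 2 t {τ ∈ J | r τ ≠ 2 * M}
  t_eq : ∀ τ ∈ J, r τ ≠ 2 * M →
    deriv (deriv t) τ = -(2 * M * deriv t τ * deriv r τ) / (r τ * (r τ - 2 * M))
  r_eq : ∀ τ ∈ J, r τ ≠ 2 * M →
    deriv (deriv r) τ = M * deriv r τ ^ 2 / (r τ * (r τ - 2 * M))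
      - M * (r τ - 2 * M) * deriv t τ ^ 2 / r τ ^ 3 + (r τ - 2 * M) * deriv φ τ ^ 2
  φ_eq : ∀ τ ∈ J, r τ ≠ 2 * M →
    deriv (deriv φ) τ = -(2 * deriv φ τ * deriv r τ) / r τ
  proper_time : ∀ τ ∈ J, r τ ≠ 2 * M →
    (r τ - 2 * M) / r τ * deriv t τ ^ 2 - r τ / (r τ - 2 * M) * deriv r τ ^ 2
      - r τ ^ 2 * deriv φ τ ^ 2 = 1
  energy_regular : ∃ e : ℝ → ℝ, ContinuousOn e J ∧
    ∀ τ ∈ J, r τ ≠ 2 * M → e τ = (r τ - 2 * M) / r τ * deriv t τ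

/-- The cubic `Q(u)`, equal to `(v / L̄)²` along an orbit with energy `E` and reduced angular
momentum `Lb = L / (2M)`, where `u = 2M / r`. -/
noncomputable def cubicQ (Lb E u : ℝ) : ℝ :=
  u ^ 3 - u ^ 2 + u / Lb ^ 2 + (E ^ 2 - 1) / Lb ^ 2

/-- Integrand of the angular quadrature. -/
noncomputable def angIntegrand (Lb E u : ℝ) : ℝ := 1 / √(cubicQ Lb E u)

/-- Integrand of the coordinate-time quadrature. -/
noncomputable def timeIntegrand (Lb E u : ℝ) : ℝ :=
  1 / ((1 - u) * u ^ 2 * √(cubicQ Lb E u))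

/-- Integrand of the proper-time quadrature. -/
noncomputable def properIntegrand (Lb E u : ℝ) : ℝ := 1 / (u ^ 2 * √(cubicQ Lb E u))

/-- The oriented integral of a non-negative function from `a` to `b`, as an extended real number
(so that a divergent integral has the value `+∞` or `-∞`). -/
noncomputable def extIntegral (f : ℝ → ℝ) (a b : ℝ) : EReal :=
  if a ≤ b then ((∫⁻ x in Set.Ioc a b, ENNReal.ofReal (f x) : ENNReal) : EReal)
  else -((∫⁻ x in Set.Ioc b a, ENNReal.ofReal (f x) : ENNReal) : EReal)

/-- Angular increment `2 sgn(L) ∫_a^b du / √Q`. -/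
noncomputable def deltaAng (Lb E a b : ℝ) : ℝ :=
  2 * Real.sign Lb * ∫ u in a..b, angIntegrand Lb E u

/-- Increment of coordinate time divided by `2M`. -/
noncomputable def deltaTime (Lb E a b : ℝ) : ℝ :=
  2 * E / |Lb| * ∫ u in a..b, timeIntegrand Lb E u

/-- Increment of proper time divided by `2M`. -/
noncomputable def deltaProper (Lb E a b : ℝ) : ℝ :=
  2 / |Lb| * ∫ u in a..b, properIntegrand Lb E u

namespace TimelikeGeodesic

variable {M : ℝ}

/-- The geodesic cannot be continued to a larger interval of proper time. -/
def IsMaximal (γ : TimelikeGeodesic M) : Prop :=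
  ∀ γ' : TimelikeGeodesic M, γ.J ⊆ γ'.J → Set.EqOn γ'.r γ.r γ.J → Set.EqOn γ'.φ γ.φ γ.J →
    Set.EqOn γ'.t γ.t {τ ∈ γ.J | γ.r τ ≠ 2 * M} → γ'.J = γ.J

/-- The reciprocal radial variable `u = 2M / r`. -/
noncomputable def u (γ : TimelikeGeodesic M) (τ : ℝ) : ℝ := 2 * M / γ.r τ

/-! ### Qualitative types of orbits -/

def IsCircular (γ : TimelikeGeodesic M) : Prop := ∀ τ ∈ γ.J, deriv γ.r τ = 0

def IsBounded (γ : TimelikeGeodesic M) : Prop := BddAbove (γ.r '' γ.J)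

def IsHorizonCrossing (γ : TimelikeGeodesic M) : Prop := ∃ τ ∈ γ.J, γ.r τ = 2 * M

/-- The orbit approaches a circle (outside the horizon) as proper time goes to `+∞` or to `-∞`. -/
def IsAsymptoticallyCircular (γ : TimelikeGeodesic M) : Prop :=
  ∃ c, 2 * M < c ∧
    ((¬ BddAbove γ.J ∧ Filter.Tendsto γ.r Filter.atTop (nhds c)) ∨
     (¬ BddBelow γ.J ∧ Filter.Tendsto γ.r Filter.atBot (nhds c)))

/-- Elliptic-like orbits: outside the horizon, the radius ranges exactly over a closed interval
whose end points, both of them reached, are the periapsis and the apoapsis radius. -/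
def IsEllipticLikeBetween (γ : TimelikeGeodesic M) (rmin rmax : ℝ) : Prop :=
  2 * M < rmin ∧ rmin < rmax ∧ γ.r '' γ.J = Set.Icc rmin rmax

def IsEllipticLike (γ : TimelikeGeodesic M) : Prop :=
  ∃ rmin rmax, γ.IsEllipticLikeBetween rmin rmax

/-! ### Apsides and the choices of the zero point `u₀ = 2M / r₀` -/

def IsApoapsis (γ : TimelikeGeodesic M) (τ : ℝ) : Prop := τ ∈ γ.J ∧ IsLocalMax γ.r τ

def IsPeriapsis (γ : TimelikeGeodesic M) (τ : ℝ) : Prop := τ ∈ γ.J ∧ IsLocalMin γ.r τ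

/-- `r₀ = 2M / u₀` is a turning point of the orbit: the radial velocity vanishes there. -/
def IsTP (γ : TimelikeGeodesic M) (u₀ : ℝ) : Prop :=
  ∃ τ ∈ γ.J, γ.u τ = u₀ ∧ deriv γ.r τ = 0

/-- `r₀ = 2M / u₀` is an inertial point of the orbit: the radial acceleration vanishes there. -/
def IsIP (γ : TimelikeGeodesic M) (u₀ : ℝ) : Prop :=
  ∃ τ ∈ γ.J, γ.u τ = u₀ ∧ deriv (deriv γ.r) τ = 0

/-- `r₀ = 2M / u₀` is the horizon, and the orbit crosses it. -/
def IsHP (γ : TimelikeGeodesic M) (u₀ : ℝ) : Prop := u₀ = 1 ∧ γ.IsHorizonCrossing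

/-! ### The integrals of motion -/

/-- The angular integral of motion, before reduction modulo `2π`. -/
noncomputable def angQuantity (γ : TimelikeGeodesic M) (L E u₀ τ : ℝ) : ℝ :=
  γ.φ τ + Real.sign (deriv γ.r τ * (L / (2 * M))) *
    ∫ x in u₀..γ.u τ, angIntegrand (L / (2 * M)) E x

/-- The coordinate-time integral of motion (divided by `2M`), with values in the extended reals
since its quadrature diverges at the horizon.  It is used only where `r > 2M`. -/
noncomputable def timeQuantity (γ : TimelikeGeodesic M) (L E u₀ τ : ℝ) : EReal :=
  ((γ.t τ / (2 * M) : ℝ) : EReal) +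
    ((Real.sign (deriv γ.r τ) * E / |L / (2 * M)| : ℝ) : EReal) *
      extIntegral (timeIntegrand (L / (2 * M)) E) u₀ (γ.u τ)

/-- The proper-time integral of motion (divided by `2M`). -/
noncomputable def properQuantity (γ : TimelikeGeodesic M) (L E u₀ τ : ℝ) : ℝ :=
  τ / (2 * M) + Real.sign (deriv γ.r τ) / |L / (2 * M)| *
    ∫ x in u₀..γ.u τ, properIntegrand (L / (2 * M)) E x

/-- On the set `S` of proper times the three integrals of motion have the values
`cΦ`, `cT`, `cP`. -/
def HasValuesOn (γ : TimelikeGeodesic M) (L E u₀ : ℝ) (S : Set ℝ)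
    (cΦ : ℝ) (cT : EReal) (cP : ℝ) : Prop :=
  ∀ τ ∈ S, γ.angQuantity L E u₀ τ = cΦ ∧ γ.properQuantity L E u₀ τ = cP ∧
    (2 * M < γ.r τ → γ.timeQuantity L E u₀ τ = cT)

/-- The quadratures of the angular and proper-time integrals converge along the whole orbit. -/
def QuadraturesConverge (γ : TimelikeGeodesic M) (L E u₀ : ℝ) : Prop :=
  ∀ τ ∈ γ.J, IntervalIntegrable (angIntegrand (L / (2 * M)) E) volume u₀ (γ.u τ) ∧
    IntervalIntegrable (properIntegrand (L / (2 * M)) E) volume u₀ (γ.u τ)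

/-- The angular integral of motion taken modulo `2π` has a single value on the orbit
(away from the instants at which `sgn v` is undetermined). -/
def AngleSingleValued (γ : TimelikeGeodesic M) (L E u₀ : ℝ) : Prop :=
  ∃ θ : Real.Angle, ∀ τ ∈ γ.J, deriv γ.r τ ≠ 0 → (γ.angQuantity L E u₀ τ : Real.Angle) = θ

/-- The three integrals of motion are constant on the entire orbit.  The constant value of the
coordinate-time integral is infinite exactly for the horizon zero point `u₀ = 1`. -/
def IsGlobal (γ : TimelikeGeodesic M) (L E u₀ : ℝ) : Prop :=
  ∃ (cΦ : ℝ) (cT : EReal) (cP : ℝ), γ.HasValuesOn L E u₀ γ.J cΦ cT cP ∧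
    ((cT = ⊤ ∨ cT = ⊥) ↔ u₀ = 1)

/-- The three integrals of motion are double-valued: the orbit has a single instant `s` at which
`v = 0`, the integrals are constant before it and after it, and they jump at `s`. -/
def IsDoubleValued (γ : TimelikeGeodesic M) (L E u₀ : ℝ) : Prop :=
  ∃ s ∈ γ.J, (∀ τ ∈ γ.J, deriv γ.r τ = 0 ↔ τ = s) ∧
    ∃ a b : ℝ,
      ((γ.IsBounded ∧ γ.IsApoapsis s ∧ a = γ.u s ∧ b = u₀) ∨
        (¬ γ.IsBounded ∧ γ.IsPeriapsis s ∧ a = u₀ ∧ b = γ.u s)) ∧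
      ∃ (cΦ cΦ' : ℝ) (cT cT' : EReal) (cP cP' : ℝ),
        γ.HasValuesOn L E u₀ {τ ∈ γ.J | τ < s} cΦ cT cP ∧
        γ.HasValuesOn L E u₀ {τ ∈ γ.J | s < τ} cΦ' cT' cP' ∧
        cΦ ≠ cΦ' ∧ cT ≠ cT' ∧ cP ≠ cP' ∧
        cΦ' - cΦ = deltaAng (L / (2 * M)) E a b ∧
        cP' - cP = deltaProper (L / (2 * M)) E a b ∧
        (u₀ ≠ 1 → ∃ x x' : ℝ, cT = x ∧ cT' = x' ∧ x' - x = deltaTime (L / (2 * M)) E a b) ∧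
        (u₀ = 1 → cT = (E : EReal) * ⊥ ∧ cT' = (E : EReal) * ⊤) ∧
        (γ.AngleSingleValued L E u₀ ↔
          ∃ n : ℤ, deltaAng (L / (2 * M)) E a b = 2 * Real.pi * n)

/-- The three integrals of motion are multi-valued on an orbit whose apoapsides, with `u = u₁`,
and periapsides, with `u = u₂`, alternate along a doubly infinite sequence `s`: they are constant
between successive apsides, jump at each apsis by the stated (possibly zero) amounts, increase
over each radial period by the increments between the two apsis radii, and take infinitely many
values. -/
def IsMultiValued (γ : TimelikeGeodesic M) (L E u₀ u₁ u₂ : ℝ) : Prop :=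
  ∃ (s : ℤ → ℝ) (cΦ cT cP : ℤ → ℝ),
    StrictMono s ∧ Set.range s = {τ ∈ γ.J | deriv γ.r τ = 0} ∧
    (∀ τ ∈ γ.J, ∃ k, τ ∈ Set.Ico (s k) (s (k + 1))) ∧
    (∀ k, γ.IsApoapsis (s (2 * k)) ∧ γ.u (s (2 * k)) = u₁) ∧
    (∀ k, γ.IsPeriapsis (s (2 * k + 1)) ∧ γ.u (s (2 * k + 1)) = u₂) ∧
    (∀ k, γ.HasValuesOn L E u₀
      {τ ∈ Set.Icc (s k) (s (k + 1)) | deriv γ.r τ ≠ 0 ∨ γ.u τ = u₀} (cΦ k) (cT k) (cP k)) ∧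
    (∀ k, cΦ (2 * k) - cΦ (2 * k - 1) = deltaAng (L / (2 * M)) E u₁ u₀ ∧
      cT (2 * k) - cT (2 * k - 1) = deltaTime (L / (2 * M)) E u₁ u₀ ∧
      cP (2 * k) - cP (2 * k - 1) = deltaProper (L / (2 * M)) E u₁ u₀) ∧
    (∀ k, cΦ (2 * k + 1) - cΦ (2 * k) = deltaAng (L / (2 * M)) E u₀ u₂ ∧
      cT (2 * k + 1) - cT (2 * k) = deltaTime (L / (2 * M)) E u₀ u₂ ∧
      cP (2 * k + 1) - cP (2 * k) = deltaProper (L / (2 * M)) E u₀ u₂) ∧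
    (∀ k, cΦ (k + 2) - cΦ k = deltaAng (L / (2 * M)) E u₁ u₂ ∧
      cT (k + 2) - cT k = deltaTime (L / (2 * M)) E u₁ u₂ ∧
      cP (k + 2) - cP k = deltaProper (L / (2 * M)) E u₁ u₂) ∧
    (Set.range cΦ).Infinite ∧ (Set.range cT).Infinite ∧ (Set.range cP).Infinite ∧
    (γ.AngleSingleValued L E u₀ ↔
      (∃ n : ℤ, deltaAng (L / (2 * M)) E u₁ u₀ = 2 * Real.pi * n) ∧
      (∃ n : ℤ, deltaAng (L / (2 * M)) E u₀ u₂ = 2 * Real.pi * n))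

/-- The list of orbit types and zero points for which the integrals of motion are global. -/
def GlobalCase (γ : TimelikeGeodesic M) (u₀ : ℝ) : Prop :=
  (γ.IsTP u₀ ∧ (¬ γ.IsBounded ∨ (γ.IsBounded ∧ ¬ γ.IsEllipticLike))) ∨
  (γ.IsIP u₀ ∧ ¬ γ.IsBounded ∧ (γ.IsAsymptoticallyCircular ∨ γ.IsHorizonCrossing)) ∨
  (γ.IsHP u₀ ∧ (¬ γ.IsBounded ∨ (γ.IsBounded ∧ γ.IsAsymptoticallyCircular)))

end TimelikeGeodesic

end Schwarzschild

/-!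
Angular momentum and energy are conserved along the whole orbit, the horizon included, so the
radial motion is that of a particle on a line: `(dr/dτ)² = P(r)` and `d²r/dτ² = P'(r)/2`, where
`P(r) = E² - (1 - 2M/r)(1 + L²/r²)` is `(L/2M)² Q(2M/r)` (`hasConstants`).  The only delicate
point in the conservation laws is the horizon, where the equations are not available; since
`P(2M) = E² ≠ 0` it is crossed transversally at isolated instants, and the constants extend by
continuity.

*Types of orbits.*  By uniqueness for the radial equation a non-circular orbit never meets a double
root of `P`.  Hence a turning point is a simple root, `P` is negative on one side of it, and its
radius is the largest or the smallest one of the orbit (`le_of_turning`, `ge_of_turning`).  Two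
turning instants make the orbit elliptic-like (`turning_unique`).  Maximality forces an end of the
orbit along which `r` stays in a compact part of `(0, ∞)` to last for infinite proper time
(`not_isLUB`); a monotone `r` then converges to a double root of `P`, that is, the orbit is
asymptotically circular.  As the roots of `Q` add up to `1`, a double root determines the third
root, and the remaining configurations that have to be excluded contradict the sign of the cubic
(`force_neg_of_bounded`, `isAsymptoticallyCircular_of_bounded`).  Together these facts show that
the cases listed as global are exactly the non-elliptic-like ones in which there is no turning
point besides the zero point (`globalCase_cases`, `exists_turning`).

*Values.*  On an arc on which `dr/dτ` has constant sign, the substitution `u = 2M/r(τ)` turns each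
of the three quadratures into the increment of `φ`, `t` or `τ` (`IsClock.integral_eq`).  This gives
both the convergence of the quadratures, with no analysis of the roots of `Q`, and the constancy of
the integrals of motion on each arc.  At a turning instant `s` the sign of `dr/dτ` changes, so
their values jump by twice the quadrature between `u₀` and `u(s)`.  With the zero point on the
horizon the coordinate-time quadrature diverges like `∫ du/(1 - u)`
(`extIntegral_timeIntegrand_one`).

*Elliptic-like orbits* exist for all proper times and are symmetric about each apsis, again by
uniqueness.  Two successive reflections compose to a translation, which generates the doubly
infinite sequence of apsides (`exists_apsisSequence`); the increments over all radial periods are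
equal and non-zero, so infinitely many values occur (`exists_values`).
-/

namespace Schwarzschild

open Filter Set Topology

/-! ### Conserved quantities and the radial equation -/

/-- The radial potential: `(dr/dτ)²` as a function of `r`, for given constants of motion. -/
noncomputable def radialSq (M L E r : ℝ) : ℝ := E ^ 2 - (1 - 2 * M / r) * (1 + L ^ 2 / r ^ 2)

/-- The radial acceleration as a function of `r`; it is half the derivative of `radialSq`. -/
noncomputable def radialForce (M L r : ℝ) : ℝ :=
  -M / r ^ 2 + L ^ 2 / r ^ 3 - 3 * M * L ^ 2 / r ^ 4

theorem hasDerivAt_radialSq (M L E : ℝ) {r : ℝ} (hr : r ≠ 0) :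
    HasDerivAt (radialSq M L E) (2 * radialForce M L r) r := by
  have h1 : HasDerivAt (fun r : ℝ => 2 * M / r) (-(2 * M) / r ^ 2) r := by
    simpa [div_eq_mul_inv] using (hasDerivAt_inv hr).const_mul (2 * M)
  have h2 : HasDerivAt (fun r : ℝ => L ^ 2 / r ^ 2) (-(2 * L ^ 2) / r ^ 3) r := by
    have := (hasDerivAt_const r (L ^ 2)).div (hasDerivAt_pow 2 r) (pow_ne_zero 2 hr)
    refine this.congr_deriv ?_
    field_simp
    ring
  have := ((h1.const_sub 1).mul (h2.const_add 1)).const_sub (E ^ 2)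
  refine this.congr_deriv ?_
  simp only [radialForce]
  field_simp
  ring

theorem continuousOn_radialSq (M L E : ℝ) : ContinuousOn (radialSq M L E) (Set.Ioi 0) :=
  fun _ hr => (hasDerivAt_radialSq M L E (ne_of_gt hr)).continuousAt.continuousWithinAt

theorem contDiffAt_radialForce (M L : ℝ) {r : ℝ} (hr : r ≠ 0) :
    ContDiffAt ℝ 1 (radialForce M L) r := by
  unfold radialForce
  have hid : ContDiffAt ℝ 1 (fun x : ℝ => x) r := contDiffAt_id
  exact ((contDiffAt_const.div (hid.pow 2) (by positivity)).add
    (contDiffAt_const.div (hid.pow 3) (by positivity))).sub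
    (contDiffAt_const.div (hid.pow 4) (by positivity))

theorem continuousOn_radialForce (M L : ℝ) : ContinuousOn (radialForce M L) (Set.Ioi 0) :=
  fun _ hr => (contDiffAt_radialForce M L (ne_of_gt hr)).continuousAt.continuousWithinAt

theorem radialSq_two_mul {M : ℝ} (hM : 0 < M) (L E : ℝ) : radialSq M L E (2 * M) = E ^ 2 := by
  have : 2 * M ≠ 0 := by positivity
  simp [radialSq, div_self this]

/-- The radial velocity cannot vanish on or inside the horizon. -/
theorem radialSq_pos_of_le {M : ℝ} (L : ℝ) {E r : ℝ} (hE : E ≠ 0) (hr : 0 < r)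
    (h : r ≤ 2 * M) : 0 < radialSq M L E r := by
  have h1 : 1 - 2 * M / r ≤ 0 := by
    rw [sub_nonpos, le_div_iff₀ hr]
    linarith
  have h2 : 0 < 1 + L ^ 2 / r ^ 2 := by positivity
  have h3 : 0 < E ^ 2 := by positivity
  unfold radialSq
  nlinarith [mul_nonneg (neg_nonneg.2 h1) h2.le]

theorem hasDerivAt_of_contDiffOn_two {f : ℝ → ℝ} {s : Set ℝ} (hs : IsOpen s)
    (hf : ContDiffOn ℝ 2 f s) :
    (∀ x ∈ s, HasDerivAt f (deriv f x) x) ∧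
      (∀ x ∈ s, HasDerivAt (deriv f) (deriv (deriv f) x) x) := by
  rw [← one_add_one_eq_two, contDiffOn_succ_iff_deriv_of_isOpen hs] at hf
  exact ⟨fun x hx => (hf.1.differentiableAt (hs.mem_nhds hx)).hasDerivAt,
    fun x hx => ((hf.2.2.differentiableOn (by simp)).differentiableAt
      (hs.mem_nhds hx)).hasDerivAt⟩

/-- A function that is continuous near `τ` and has zero derivative at the nearby points different
from `τ` is constant near `τ`. -/
theorem eventually_eq_of_hasDerivAt_zero_punctured {f : ℝ → ℝ} {τ : ℝ}
    (hc : ∀ᶠ x in nhds τ, ContinuousAt f x)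
    (hd : ∀ᶠ x in nhds τ, x ≠ τ → HasDerivAt f 0 x) : ∀ᶠ x in nhds τ, f x = f τ := by
  obtain ⟨ε, hε, h⟩ := Metric.eventually_nhds_iff_ball.1 (hc.and hd)
  filter_upwards [Metric.ball_mem_nhds τ hε] with x hx
  rw [Real.ball_eq_Ioo] at h hx
  rcases lt_trichotomy x τ with hlt | rfl | hlt
  · obtain ⟨c, -, hc⟩ := exists_hasDerivAt_eq_slope f (fun _ => 0) hlt
      (fun y hy => (h y ⟨hx.1.trans_le hy.1, by linarith [hy.2]⟩).1.continuousWithinAt)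
      (fun y hy => (h y ⟨hx.1.trans hy.1, by linarith [hy.2]⟩).2 hy.2.ne)
    have := sub_pos.2 hlt
    field_simp at hc
    linarith
  · rfl
  · obtain ⟨c, -, hc⟩ := exists_hasDerivAt_eq_slope f (fun _ => 0) hlt
      (fun y hy => (h y ⟨by linarith [hy.1], hy.2.trans_lt hx.2⟩).1.continuousWithinAt)
      (fun y hy => (h y ⟨by linarith [hy.1], hy.2.trans hx.2⟩).2 hy.1.ne')
    have := sub_pos.2 hlt
    field_simp at hc
    linarith

theorem eq_of_mem_closure {g : ℝ → ℝ} {J A : Set ℝ} {c x : ℝ} (hg : ContinuousOn g J)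
    (hA : A ⊆ J) (h : ∀ y ∈ A, g y = c) (hx : x ∈ closure A) (hxJ : x ∈ J) : g x = c := by
  have h1 : g x ∈ closure (g '' A) := ((hg x hxJ).mono hA).mem_closure_image hx
  have h2 : g '' A ⊆ {c} := by
    rintro _ ⟨y, hy, rfl⟩
    exact h y hy
  simpa using closure_mono h2 h1

namespace TimelikeGeodesic

variable {M : ℝ}

/-- The first-order form of the geodesic equations: along the whole orbit, through the horizon if
it is reached, angular momentum and energy have the constant values `L` and `E`. -/
structure HasConstants (γ : TimelikeGeodesic M) (L E : ℝ) : Prop where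
  radius : ∀ τ ∈ γ.J, HasDerivAt γ.r (deriv γ.r τ) τ
  velocity : ∀ τ ∈ γ.J, HasDerivAt (deriv γ.r) (radialForce M L (γ.r τ)) τ
  sq_velocity : ∀ τ ∈ γ.J, deriv γ.r τ ^ 2 = radialSq M L E (γ.r τ)
  angle : ∀ τ ∈ γ.J, HasDerivAt γ.φ (L / γ.r τ ^ 2) τ
  time : ∀ τ ∈ γ.J, γ.r τ ≠ 2 * M →
    HasDerivAt γ.t (E * γ.r τ / (γ.r τ - 2 * M)) τ

theorem isOpen_ne_horizon (γ : TimelikeGeodesic M) : IsOpen {τ ∈ γ.J | γ.r τ ≠ 2 * M} :=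
  γ.contDiffOn_r.continuousOn.isOpen_inter_preimage γ.isOpen_J isOpen_ne

theorem sq_velocity_of_constants {M r v t φ L E : ℝ} (hr : 0 < r) (hr2 : r ≠ 2 * M)
    (hL : r ^ 2 * φ = L) (hE : (r - 2 * M) / r * t = E)
    (h : (r - 2 * M) / r * t ^ 2 - r / (r - 2 * M) * v ^ 2 - r ^ 2 * φ ^ 2 = 1) :
    v ^ 2 = radialSq M L E r := by
  have h2 : r - 2 * M ≠ 0 := sub_ne_zero.2 hr2
  subst hL hE
  unfold radialSq
  have hv : v ^ 2 = (r - 2 * M) / r * ((r - 2 * M) / r * t ^ 2 - r ^ 2 * φ ^ 2 - 1) := by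
    rw [← h]
    field_simp
    ring
  rw [hv]
  field_simp
  ring

theorem radialForce_eq_of_constants {M r L E : ℝ} (hr : r ≠ 0) (h : r - 2 * M ≠ 0) :
    M * radialSq M L E r / (r * (r - 2 * M))
      - M * (r - 2 * M) * (E * r / (r - 2 * M)) ^ 2 / r ^ 3
      + (r - 2 * M) * (L / r ^ 2) ^ 2 = radialForce M L r := by
  obtain ⟨d, hd⟩ : ∃ d, d = r - 2 * M := ⟨_, rfl⟩
  obtain rfl : M = (r - d) / 2 := by linarith
  rw [← hd] at h ⊢
  unfold radialSq radialForce
  field_simp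
  ring

theorem hasConstants (hM : 0 < M) (γ : TimelikeGeodesic M) {L E : ℝ}
    (hLE : ∃ τ ∈ γ.J, 2 * M < γ.r τ ∧ L = γ.r τ ^ 2 * deriv γ.φ τ ∧
      E = (γ.r τ - 2 * M) / γ.r τ * deriv γ.t τ) : γ.HasConstants L E ∧ E ≠ 0 := by
  obtain ⟨e, he, heq⟩ := γ.energy_regular
  obtain ⟨hr1, hr2⟩ := hasDerivAt_of_contDiffOn_two γ.isOpen_J γ.contDiffOn_r
  obtain ⟨hφ1, hφ2⟩ := hasDerivAt_of_contDiffOn_two γ.isOpen_J γ.contDiffOn_φ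
  obtain ⟨ht1, ht2⟩ := hasDerivAt_of_contDiffOn_two γ.isOpen_ne_horizon γ.contDiffOn_t
  set W := {τ ∈ γ.J | γ.r τ ≠ 2 * M} with hW
  set ℓ : ℝ → ℝ := fun τ => γ.r τ ^ 2 * deriv γ.φ τ with hℓ
  have hrc : ContinuousOn γ.r γ.J := fun x hx => (hr1 x hx).continuousAt.continuousWithinAt
  have hvc : ContinuousOn (deriv γ.r) γ.J :=
    fun x hx => (hr2 x hx).continuousAt.continuousWithinAt
  have hℓc : ContinuousOn ℓ γ.J :=
    (hrc.pow 2).mul fun x hx => (hφ2 x hx).continuousAt.continuousWithinAt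
  have hPc : ContinuousOn (fun τ => deriv γ.r τ ^ 2 - radialSq M L E (γ.r τ)) γ.J :=
    (hvc.pow 2).sub ((continuousOn_radialSq M L E).comp hrc fun x hx => γ.r_pos x hx)
  have heW : ∀ τ ∈ W, HasDerivAt e 0 τ := by
    intro τ hτ
    have hr := γ.r_pos τ hτ.1
    have hne : γ.r τ - 2 * M ≠ 0 := sub_ne_zero.2 hτ.2
    have h1 : HasDerivAt (fun τ => (γ.r τ - 2 * M) / γ.r τ * deriv γ.t τ) 0 τ := by
      have := (((hr1 τ hτ.1).sub_const (2 * M)).div (hr1 τ hτ.1) hr.ne').mul (ht2 τ hτ)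
      refine this.congr_deriv ?_
      rw [γ.t_eq τ hτ.1 hτ.2]
      simp only [Pi.div_apply]
      field_simp
      ring
    refine h1.congr_of_eventuallyEq ?_
    filter_upwards [γ.isOpen_ne_horizon.mem_nhds hτ] with x hx using heq x hx.1 hx.2
  have hℓW : ∀ τ ∈ W, HasDerivAt ℓ 0 τ := by
    intro τ hτ
    have hr := γ.r_pos τ hτ.1
    have := ((hr1 τ hτ.1).pow 2).mul (hφ2 τ hτ.1)
    refine this.congr_deriv ?_
    rw [γ.φ_eq τ hτ.1 hτ.2]
    simp only [Pi.pow_apply]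
    field_simp
    ring
  have hsq : ∀ τ ∈ W, e τ = E → ℓ τ = L → deriv γ.r τ ^ 2 = radialSq M L E (γ.r τ) := by
    intro τ hτ h1 h2
    rw [heq τ hτ.1 hτ.2] at h1
    exact sq_velocity_of_constants (γ.r_pos τ hτ.1) hτ.2 h2 h1 (γ.proper_time τ hτ.1 hτ.2)
  obtain ⟨τ₀, hτ₀, hr₀, hL₀, hE₀⟩ := hLE
  have hτ₀W : τ₀ ∈ W := ⟨hτ₀, hr₀.ne'⟩
  have hE0 : E ≠ 0 := by
    rintro rfl
    have h1 := hsq τ₀ hτ₀W (by rw [heq τ₀ hτ₀ hr₀.ne', ← hE₀]) hL₀.symm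
    have h2 : 0 < 1 - 2 * M / γ.r τ₀ := by
      rw [sub_pos, div_lt_one (γ.r_pos _ hτ₀)]
      exact hr₀
    have h3 : 0 < 1 + L ^ 2 / γ.r τ₀ ^ 2 := by positivity
    have := mul_pos h2 h3
    unfold radialSq at h1
    nlinarith [sq_nonneg (deriv γ.r τ₀)]
  set A := {τ ∈ γ.J | e τ = E ∧ ℓ τ = L ∧ deriv γ.r τ ^ 2 - radialSq M L E (γ.r τ) = 0} with hA
  -- On the horizon the velocity is `± E ≠ 0`, so that the horizon is met at isolated instants.
  have hisol : ∀ τ ∈ A, ∀ᶠ x in nhds τ, x ≠ τ → x ∈ W := by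
    rintro τ ⟨hτ, -, -, h3⟩
    by_cases h : γ.r τ = 2 * M
    · have hv : deriv γ.r τ ≠ 0 := by
        intro hv
        rw [h, radialSq_two_mul hM, hv] at h3
        simp [hE0] at h3
      have := eventually_nhdsWithin_iff.1 ((hr1 τ hτ).eventually_ne (c := 2 * M) hv)
      filter_upwards [this, γ.isOpen_J.mem_nhds hτ] with x hx hxJ hne using ⟨hxJ, hx hne⟩
    · filter_upwards [γ.isOpen_ne_horizon.mem_nhds ⟨hτ, h⟩] with x hx _ using hx
  have hAopen : IsOpen A := by
    rw [isOpen_iff_mem_nhds]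
    intro τ hτ
    have h1 : ∀ᶠ x in nhds τ, x ∈ γ.J := γ.isOpen_J.mem_nhds hτ.1
    have h2 := eventually_eq_of_hasDerivAt_zero_punctured (f := e)
      (h1.mono fun x hx => he.continuousAt (γ.isOpen_J.mem_nhds hx))
      ((hisol τ hτ).mono fun x hx hne => heW x (hx hne))
    have h3 := eventually_eq_of_hasDerivAt_zero_punctured (f := ℓ)
      (h1.mono fun x hx => hℓc.continuousAt (γ.isOpen_J.mem_nhds hx))
      ((hisol τ hτ).mono fun x hx hne => hℓW x (hx hne))
    filter_upwards [h1, h2, h3, hisol τ hτ] with x hxJ hxe hxℓ hxW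
    rw [hτ.2.1] at hxe
    rw [hτ.2.2.1] at hxℓ
    by_cases hx : x = τ
    · rw [hx]
      exact hτ
    · exact ⟨hxJ, hxe, hxℓ, sub_eq_zero.2 (hsq x (hxW hx) hxe hxℓ)⟩
  have hAJ : γ.J ⊆ A := by
    refine γ.ordConnected_J.isPreconnected.subset_of_closure_inter_subset hAopen
      ⟨τ₀, hτ₀, hτ₀, ?_, hL₀.symm, ?_⟩ ?_
    · rw [heq τ₀ hτ₀ hr₀.ne', ← hE₀]
    · exact sub_eq_zero.2 (hsq τ₀ hτ₀W (by rw [heq τ₀ hτ₀ hr₀.ne', ← hE₀]) hL₀.symm)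
    · rintro x ⟨hx, hxJ⟩
      exact ⟨hxJ, eq_of_mem_closure he (fun y hy => hy.1) (fun y hy => hy.2.1) hx hxJ,
        eq_of_mem_closure hℓc (fun y hy => hy.1) (fun y hy => hy.2.2.1) hx hxJ,
        eq_of_mem_closure (A := A)
          (g := fun τ => deriv γ.r τ ^ 2 - radialSq M L E (γ.r τ)) hPc (fun y hy => hy.1) (fun y hy => hy.2.2.2) hx hxJ⟩
  have hsqJ : ∀ τ ∈ γ.J, deriv γ.r τ ^ 2 = radialSq M L E (γ.r τ) :=
    fun τ hτ => sub_eq_zero.1 (hAJ hτ).2.2.2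
  have hφJ : ∀ τ ∈ γ.J, deriv γ.φ τ = L / γ.r τ ^ 2 := by
    intro τ hτ
    have := γ.r_pos τ hτ
    rw [eq_div_iff (by positivity), mul_comm]
    exact (hAJ hτ).2.2.1
  have htJ : ∀ τ ∈ γ.J, γ.r τ ≠ 2 * M → deriv γ.t τ = E * γ.r τ / (γ.r τ - 2 * M) := by
    intro τ hτ hne
    have h1 := γ.r_pos τ hτ
    have h2 : γ.r τ - 2 * M ≠ 0 := sub_ne_zero.2 hne
    rw [← (hAJ hτ).2.1, heq τ hτ hne]
    field_simp
  refine ⟨⟨hr1, ?_, hsqJ, ?_, ?_⟩, hE0⟩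
  · intro τ hτ
    refine (hr2 τ hτ).congr_deriv ?_
    have hpos := γ.r_pos τ hτ
    by_cases h : γ.r τ = 2 * M
    · -- On the horizon the radial equation is the derivative of the energy equation.
      have hv : deriv γ.r τ ≠ 0 := by
        intro hv
        have := hsqJ τ hτ
        rw [h, radialSq_two_mul hM, hv] at this
        exact pow_ne_zero 2 hE0 (by linarith)
      have h1 := (hr2 τ hτ).pow 2
      have h2 := (hasDerivAt_radialSq M L E hpos.ne').comp τ (hr1 τ hτ)
      have h3 := h1.unique (h2.congr_of_eventuallyEq (by
        filter_upwards [γ.isOpen_J.mem_nhds hτ] with x hx using hsqJ x hx))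
      have h4 : deriv γ.r τ * (deriv (deriv γ.r) τ - radialForce M L (γ.r τ)) = 0 := by
        simp at h3
        linarith
      exact sub_eq_zero.1 ((mul_eq_zero.1 h4).resolve_left hv)
    · have h2 : γ.r τ - 2 * M ≠ 0 := sub_ne_zero.2 h
      rw [γ.r_eq τ hτ h, hsqJ τ hτ, hφJ τ hτ, htJ τ hτ h]
      exact radialForce_eq_of_constants hpos.ne' h2
  · intro τ hτ
    rw [← hφJ τ hτ]
    exact hφ1 τ hτ
  · intro τ hτ h
    rw [← htJ τ hτ h]
    exact ht1 τ ⟨hτ, h⟩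

end TimelikeGeodesic

/-! ### One-sided limits and joining of functions -/

theorem exists_tendsto_of_hasDerivAt_of_bound {f g : ℝ → ℝ} {a b C : ℝ}
    (hf : ∀ x ∈ Ioo a b, HasDerivAt f (g x) x) (hg : ∀ x ∈ Ioo a b, |g x| ≤ C) :
    ∃ l, Tendsto f (𝓝[Ioo a b] b) (𝓝 l) := by
  have h1 : LipschitzOnWith (Real.toNNReal C) f (Ioo a b) :=
    (convex_Ioo a b).lipschitzOnWith_of_nnnorm_hasDerivWithin_le
      (fun x hx => (hf x hx).hasDerivWithinAt) fun x hx => by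
        rw [← NNReal.coe_le_coe, coe_nnnorm, Real.norm_eq_abs]
        exact (hg x hx).trans (Real.le_coe_toNNReal C)
  obtain ⟨k, hk, hfk⟩ := h1.extend_real
  refine ⟨k b, (hk.continuous.tendsto b |>.mono_left nhdsWithin_le_nhds).congr' ?_⟩
  filter_upwards [self_mem_nhdsWithin] with x hx using (hfk hx).symm

theorem exists_tendsto_of_hasDerivAt_of_tendsto {f g : ℝ → ℝ} {b l : ℝ}
    (hf : ∀ᶠ x in 𝓝[<] b, HasDerivAt f (g x) x) (hg : Tendsto g (𝓝[<] b) (𝓝 l)) :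
    ∃ l, Tendsto f (𝓝[<] b) (𝓝 l) := by
  have h1 : ∀ᶠ x in 𝓝[<] b, |g x| ≤ |l| + 1 :=
    (hg.abs.eventually_lt_const (lt_add_one |l|)).mono fun x hx => hx.le
  obtain ⟨a, ha, hab⟩ := (mem_nhdsLT_iff_exists_Ioo_subset).1 (hf.and h1)
  obtain ⟨k, hk⟩ := exists_tendsto_of_hasDerivAt_of_bound (fun x hx => (hab hx).1)
    (fun x hx => (hab hx).2)
  rw [nhdsWithin_Ioo_eq_nhdsLT ha] at hk
  exact ⟨k, hk⟩

theorem exists_hasDerivAt_of_continuousOn {g : ℝ → ℝ} {a b c : ℝ} (hg : ContinuousOn g (Ioo a b))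
    (hc : c ∈ Ioo a b) (y : ℝ) : ∃ h : ℝ → ℝ, h c = y ∧ ∀ x ∈ Ioo a b, HasDerivAt h (g x) x := by
  refine ⟨fun x => y + ∫ z in c..x, g z, by simp, fun x hx => ?_⟩
  refine (intervalIntegral.integral_hasDerivAt_right ?_ ?_ ?_).const_add y
  · exact (hg.mono (ordConnected_Ioo.uIcc_subset hc hx)).intervalIntegrable
  · exact hg.stronglyMeasurableAtFilter isOpen_Ioo x hx
  · exact hg.continuousAt (isOpen_Ioo.mem_nhds hx)

/-- The function that is `f` before `b` and `h` from `b` on. -/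
noncomputable def joinAt (b : ℝ) (f h : ℝ → ℝ) (x : ℝ) : ℝ := if x < b then f x else h x

theorem joinAt_of_lt {b x : ℝ} (f h : ℝ → ℝ) (hx : x < b) : joinAt b f h x = f x := if_pos hx

theorem joinAt_of_le {b x : ℝ} (f h : ℝ → ℝ) (hx : b ≤ x) : joinAt b f h x = h x :=
  if_neg hx.not_gt

theorem hasDerivAt_joinAt_of_lt {b x y : ℝ} {f : ℝ → ℝ} (h : ℝ → ℝ) (hx : x < b)
    (hf : HasDerivAt f y x) : HasDerivAt (joinAt b f h) y x :=
  hf.congr_of_eventuallyEq (by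
    filter_upwards [eventually_lt_nhds hx] with z hz using joinAt_of_lt f h hz)

theorem hasDerivAt_joinAt_of_gt {b x y : ℝ} (f : ℝ → ℝ) {h : ℝ → ℝ} (hx : b < x)
    (hh : HasDerivAt h y x) : HasDerivAt (joinAt b f h) y x :=
  hh.congr_of_eventuallyEq (by
    filter_upwards [eventually_gt_nhds hx] with z hz using joinAt_of_le f h hz.le)

theorem hasDerivAt_joinAt {b y : ℝ} {f f' h : ℝ → ℝ}
    (hf : ∀ᶠ x in 𝓝[<] b, HasDerivAt f (f' x) x) (hlim : Tendsto f (𝓝[<] b) (𝓝 (h b)))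
    (hlim' : Tendsto f' (𝓝[<] b) (𝓝 y)) (hh : HasDerivAt h y b) :
    HasDerivAt (joinAt b f h) y b := by
  have hj : ∀ᶠ x in 𝓝[<] b, HasDerivAt (joinAt b f h) (f' x) x := by
    filter_upwards [hf, self_mem_nhdsWithin] with x hx hxb using
      hasDerivAt_joinAt_of_lt h hxb hx
  have hb : joinAt b f h b = h b := joinAt_of_le f h le_rfl
  have h1 : HasDerivWithinAt (joinAt b f h) y (Iic b) b := by
    refine hasDerivWithinAt_Iic_of_tendsto_deriv
      (s := {x | x < b ∧ HasDerivAt (joinAt b f h) (f' x) x})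
      (fun x hx => hx.2.differentiableAt.differentiableWithinAt) ?_
      (inter_mem self_mem_nhdsWithin hj) ?_
    · have : Tendsto (joinAt b f h) (𝓝[<] b) (𝓝 (joinAt b f h b)) := by
        rw [hb]
        refine hlim.congr' ?_
        filter_upwards [self_mem_nhdsWithin] with x hx using (joinAt_of_lt f h hx).symm
      exact this.mono_left (nhdsWithin_mono b fun x hx => hx.1)
    · exact hlim'.congr' (hj.mono fun x hx => hx.deriv.symm)
  have h2 : HasDerivWithinAt (joinAt b f h) y (Ici b) b :=
    hh.hasDerivWithinAt.congr (fun x hx => joinAt_of_le f h hx) hb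
  have := h1.union h2
  rwa [Iic_union_Ici, hasDerivWithinAt_univ] at this

theorem contDiffOn_two_of_hasDerivAt {s : Set ℝ} (hs : IsOpen s) {f g h : ℝ → ℝ}
    (hf : ∀ x ∈ s, HasDerivAt f (g x) x) (hg : ∀ x ∈ s, HasDerivAt g (h x) x)
    (hh : ContinuousOn h s) : ContDiffOn ℝ 2 f s := by
  have h1 : ContDiffOn ℝ 1 g s := by
    rw [← zero_add (1 : WithTop ℕ∞), contDiffOn_succ_iff_deriv_of_isOpen hs]
    refine ⟨fun x hx => (hg x hx).differentiableAt.differentiableWithinAt, by simp, ?_⟩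
    rw [contDiffOn_zero]
    exact hh.congr fun x hx => (hg x hx).deriv
  rw [← one_add_one_eq_two, contDiffOn_succ_iff_deriv_of_isOpen hs]
  exact ⟨fun x hx => (hf x hx).differentiableAt.differentiableWithinAt, by simp,
    h1.congr fun x hx => (hf x hx).deriv⟩

theorem deriv_deriv_of_hasDerivAt {s : Set ℝ} (hs : IsOpen s) {f g h : ℝ → ℝ}
    (hf : ∀ x ∈ s, HasDerivAt f (g x) x) (hg : ∀ x ∈ s, HasDerivAt g (h x) x) {x : ℝ}
    (hx : x ∈ s) : deriv (deriv f) x = h x :=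
  ((hg x hx).congr_of_eventuallyEq (by
    filter_upwards [hs.mem_nhds hx] with y hy using (hf y hy).deriv)).deriv

namespace TimelikeGeodesic

variable {M : ℝ}

/-! ### Time reversal and maximality -/

/-- The timelike geodesic given by a solution of the first-order equations with constants `L`, `E`.
-/
noncomputable def ofFirstOrder {L E : ℝ} {J : Set ℝ} {r v φ t : ℝ → ℝ} (hJo : IsOpen J)
    (hJc : J.OrdConnected) (hJn : J.Nonempty) (hpos : ∀ τ ∈ J, 0 < r τ)
    (hr : ∀ τ ∈ J, HasDerivAt r (v τ) τ)
    (hv : ∀ τ ∈ J, HasDerivAt v (radialForce M L (r τ)) τ)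
    (hsq : ∀ τ ∈ J, v τ ^ 2 = radialSq M L E (r τ))
    (hφ : ∀ τ ∈ J, HasDerivAt φ (L / r τ ^ 2) τ)
    (ht : ∀ τ ∈ J, r τ ≠ 2 * M → HasDerivAt t (E * r τ / (r τ - 2 * M)) τ) :
    TimelikeGeodesic M :=
  have hrc : ContinuousOn r J := fun x hx => (hr x hx).continuousAt.continuousWithinAt
  have hvc : ContinuousOn v J := fun x hx => (hv x hx).continuousAt.continuousWithinAt
  have hWo : IsOpen {τ ∈ J | r τ ≠ 2 * M} := hrc.isOpen_inter_preimage hJo isOpen_ne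
  have hφ2 : ∀ τ ∈ J, HasDerivAt (fun τ => L / r τ ^ 2) (-(2 * (L / r τ ^ 2) * v τ) / r τ) τ := by
    intro τ hτ
    have h0 := (hpos τ hτ).ne'
    refine ((hasDerivAt_const τ L).div ((hr τ hτ).pow 2) (pow_ne_zero 2 h0)).congr_deriv ?_
    simp only [Pi.pow_apply]
    field_simp
    ring
  have ht2 : ∀ τ ∈ {τ ∈ J | r τ ≠ 2 * M}, HasDerivAt (fun τ => E * r τ / (r τ - 2 * M))
      (-(2 * M * (E * r τ / (r τ - 2 * M)) * v τ) / (r τ * (r τ - 2 * M))) τ := by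
    intro τ hτ
    have h0 := (hpos τ hτ.1).ne'
    have h1 := sub_ne_zero.2 hτ.2
    refine (((hr τ hτ.1).const_mul E).div ((hr τ hτ.1).sub_const (2 * M)) h1).congr_deriv ?_
    field_simp
    ring
  { J := J
    t := t
    r := r
    φ := φ
    isOpen_J := hJo
    ordConnected_J := hJc
    nonempty_J := hJn
    r_pos := hpos
    contDiffOn_r := contDiffOn_two_of_hasDerivAt hJo hr hv
      ((continuousOn_radialForce M L).comp hrc hpos)
    contDiffOn_φ := contDiffOn_two_of_hasDerivAt hJo hφ hφ2 (by
      have : ∀ x ∈ J, r x ^ 2 ≠ 0 := fun x hx => pow_ne_zero 2 (hpos x hx).ne'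
      have : ∀ x ∈ J, r x ≠ 0 := fun x hx => (hpos x hx).ne'
      fun_prop (disch := assumption))
    contDiffOn_t := contDiffOn_two_of_hasDerivAt hWo (fun τ hτ => ht τ hτ.1 hτ.2) ht2 (by
      have hrc' : ContinuousOn r {τ ∈ J | r τ ≠ 2 * M} := hrc.mono fun x hx => hx.1
      have hvc' : ContinuousOn v {τ ∈ J | r τ ≠ 2 * M} := hvc.mono fun x hx => hx.1
      have h1 : ∀ x ∈ {τ ∈ J | r τ ≠ 2 * M}, r x - 2 * M ≠ 0 := fun x hx => sub_ne_zero.2 hx.2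
      have h2 : ∀ x ∈ {τ ∈ J | r τ ≠ 2 * M}, r x * (r x - 2 * M) ≠ 0 :=
        fun x hx => mul_ne_zero (hpos x hx.1).ne' (h1 x hx)
      fun_prop (disch := assumption))
    t_eq := by
      intro τ hτ hne
      rw [deriv_deriv_of_hasDerivAt hWo (fun τ hτ => ht τ hτ.1 hτ.2) ht2 ⟨hτ, hne⟩,
        (ht τ hτ hne).deriv, (hr τ hτ).deriv]
    r_eq := by
      intro τ hτ hne
      rw [deriv_deriv_of_hasDerivAt hJo hr hv hτ, (ht τ hτ hne).deriv, (hr τ hτ).deriv,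
        (hφ τ hτ).deriv, hsq τ hτ]
      exact (radialForce_eq_of_constants (hpos τ hτ).ne' (sub_ne_zero.2 hne)).symm
    φ_eq := by
      intro τ hτ _
      rw [deriv_deriv_of_hasDerivAt hJo hφ hφ2 hτ, (hφ τ hτ).deriv, (hr τ hτ).deriv]
    proper_time := by
      intro τ hτ hne
      have h0 := hpos τ hτ
      have h1 := sub_ne_zero.2 hne
      rw [(ht τ hτ hne).deriv, (hr τ hτ).deriv, (hφ τ hτ).deriv, hsq τ hτ]
      unfold radialSq
      field_simp
      ring
    energy_regular := ⟨fun _ => E, continuousOn_const, by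
      intro τ hτ hne
      have h0 := hpos τ hτ
      have h1 := sub_ne_zero.2 hne
      rw [(ht τ hτ hne).deriv]
      field_simp⟩ }

/-- The geodesic run backwards, with `φ` and `t` reflected so that the angular momentum and the
energy are unchanged. -/
noncomputable def reverse (γ : TimelikeGeodesic M) : TimelikeGeodesic M :=
  have hneg : ∀ f : ℝ → ℝ, deriv (fun τ => -f (-τ)) = fun τ => deriv f (-τ) := by
    intro f
    funext τ
    rw [deriv.fun_neg, deriv_comp_neg, neg_neg]
  have hpos : ∀ f : ℝ → ℝ, deriv (fun τ => f (-τ)) = fun τ => -deriv f (-τ) := by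
    intro f
    funext τ
    rw [deriv_comp_neg]
  { J := {τ | -τ ∈ γ.J}
    t := fun τ => -γ.t (-τ)
    r := fun τ => γ.r (-τ)
    φ := fun τ => -γ.φ (-τ)
    isOpen_J := γ.isOpen_J.preimage continuous_neg
    ordConnected_J := ⟨fun x hx y hy z hz =>
      γ.ordConnected_J.out hy hx ⟨neg_le_neg hz.2, neg_le_neg hz.1⟩⟩
    nonempty_J := by
      obtain ⟨x, hx⟩ := γ.nonempty_J
      exact ⟨-x, by simpa using hx⟩
    r_pos := fun τ hτ => γ.r_pos (-τ) hτ
    contDiffOn_r := γ.contDiffOn_r.comp contDiff_neg.contDiffOn fun _ h => h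
    contDiffOn_φ := (γ.contDiffOn_φ.comp contDiff_neg.contDiffOn fun _ h => h).neg
    contDiffOn_t := (γ.contDiffOn_t.comp contDiff_neg.contDiffOn fun _ h => h).neg
    t_eq := by
      intro τ hτ hne
      have := γ.t_eq (-τ) hτ hne
      simp only [hneg, hpos, this]
      ring
    r_eq := by
      intro τ hτ hne
      have := γ.r_eq (-τ) hτ hne
      simp only [hneg, hpos, this]
      ring
    φ_eq := by
      intro τ hτ hne
      have := γ.φ_eq (-τ) hτ hne
      simp only [hneg, hpos, this]
      ring
    proper_time := by
      intro τ hτ hne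
      have := γ.proper_time (-τ) hτ hne
      simp only [hneg, hpos]
      rw [← this]
      ring
    energy_regular := by
      obtain ⟨e, he, h⟩ := γ.energy_regular
      refine ⟨fun τ => e (-τ), he.comp continuous_neg.continuousOn fun _ h => h, ?_⟩
      intro τ hτ hne
      simp only [hneg]
      exact h (-τ) hτ hne }

theorem mem_reverse_J {γ : TimelikeGeodesic M} {τ : ℝ} : τ ∈ γ.reverse.J ↔ -τ ∈ γ.J := Iff.rfl

theorem reverse_r (γ : TimelikeGeodesic M) (τ : ℝ) : γ.reverse.r τ = γ.r (-τ) := rfl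

theorem deriv_reverse_r (γ : TimelikeGeodesic M) (τ : ℝ) :
    deriv γ.reverse.r τ = -deriv γ.r (-τ) := deriv_comp_neg γ.r τ

theorem reverse_reverse_J (γ : TimelikeGeodesic M) : γ.reverse.reverse.J = γ.J := by
  ext τ
  simp [mem_reverse_J]

theorem IsMaximal.reverse {γ : TimelikeGeodesic M} (h : γ.IsMaximal) : γ.reverse.IsMaximal := by
  intro γ' hJ hr hφ ht
  have := h γ'.reverse (fun τ hτ => hJ (mem_reverse_J.2 (by simpa using hτ)))
    (fun τ hτ => by
      simpa [reverse_r] using hr (x := -τ) (mem_reverse_J.2 (by simpa using hτ)))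
    (fun τ hτ => by
      have := hφ (x := -τ) (mem_reverse_J.2 (by simpa using hτ))
      simp [TimelikeGeodesic.reverse] at this ⊢
      linarith)
    (fun τ hτ => by
      have := ht (x := -τ) ⟨mem_reverse_J.2 (by simpa using hτ.1), by simpa [reverse_r] using hτ.2⟩
      simp [TimelikeGeodesic.reverse] at this ⊢
      linarith)
  ext τ
  have h2 := Set.ext_iff.1 this (-τ)
  simpa [mem_reverse_J] using h2

theorem HasConstants.reverse {γ : TimelikeGeodesic M} {L E : ℝ} (h : γ.HasConstants L E) :
    γ.reverse.HasConstants L E where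
  radius τ hτ := by
    rw [deriv_reverse_r]
    have := (h.radius (-τ) hτ).comp τ (hasDerivAt_neg τ)
    rw [mul_neg_one] at this
    exact this
  velocity τ hτ := by
    have h1 : deriv γ.reverse.r = fun τ => -deriv γ.r (-τ) := funext γ.deriv_reverse_r
    rw [h1]
    have := ((h.velocity (-τ) hτ).comp τ (hasDerivAt_neg τ)).neg
    rw [mul_neg_one, neg_neg] at this
    exact this
  sq_velocity τ hτ := by
    rw [deriv_reverse_r, neg_sq]
    exact h.sq_velocity (-τ) hτ
  angle τ hτ := by
    have := ((h.angle (-τ) hτ).comp τ (hasDerivAt_neg τ)).neg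
    rw [mul_neg_one, neg_neg] at this
    exact this
  time τ hτ hne := by
    have := ((h.time (-τ) hτ hne).comp τ (hasDerivAt_neg τ)).neg
    rw [mul_neg_one, neg_neg] at this
    exact this

theorem HasConstants.continuousOn_r {γ : TimelikeGeodesic M} {L E : ℝ} (h : γ.HasConstants L E) :
    ContinuousOn γ.r γ.J := fun x hx => (h.radius x hx).continuousAt.continuousWithinAt

theorem HasConstants.continuousOn_v {γ : TimelikeGeodesic M} {L E : ℝ} (h : γ.HasConstants L E) :
    ContinuousOn (deriv γ.r) γ.J := fun x hx => (h.velocity x hx).continuousAt.continuousWithinAt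

theorem lt_of_isLUB_J {γ : TimelikeGeodesic M} {b τ : ℝ} (hb : IsLUB γ.J b) (hτ : τ ∈ γ.J) :
    τ < b := by
  refine lt_of_le_of_ne (hb.1 hτ) ?_
  rintro rfl
  obtain ⟨ε, hε, h⟩ := Metric.isOpen_iff.1 γ.isOpen_J τ hτ
  have := hb.1 (h (by
    rw [Real.ball_eq_Ioo]
    constructor <;> linarith : τ + ε / 2 ∈ Metric.ball τ ε))
  linarith

/-- On a maximal geodesic the radius cannot stay in a compact subset of `(0, ∞)` as the end of a
bounded interval of proper times is approached: radius and velocity would converge, and the local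
solution starting from their limits would continue the geodesic. -/
theorem HasConstants.not_isLUB {γ : TimelikeGeodesic M} {L E : ℝ} (h : γ.HasConstants L E)
    (hM : 0 < M) (hE : E ≠ 0) (hmax : γ.IsMaximal) {a b ε K : ℝ} (ha : a ∈ γ.J) (hε : 0 < ε)
    (hr : ∀ τ ∈ γ.J, a ≤ τ → γ.r τ ∈ Icc ε K) : ¬ IsLUB γ.J b := by
  intro hb
  have hJb : ∀ τ ∈ γ.J, τ < b := fun τ => lt_of_isLUB_J hb
  have hab := hJb a ha
  have hsub : Ioo a b ⊆ γ.J := by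
    intro x hx
    obtain ⟨c, hc, hxc⟩ := (lt_isLUB_iff hb).1 hx.2
    exact γ.ordConnected_J.out ha hc ⟨hx.1.le, hxc.le⟩
  have hevJ : ∀ᶠ x in 𝓝[<] b, x ∈ Ioo a b := Ioo_mem_nhdsLT hab
  have hIcc : Icc ε K ⊆ Ioi 0 := fun x hx => hε.trans_le hx.1
  obtain ⟨r₁, hr₁⟩ : ∃ l, Tendsto γ.r (𝓝[<] b) (𝓝 l) := by
    obtain ⟨C, hC⟩ := isCompact_Icc.bddAbove_image ((continuousOn_radialSq M L E).mono hIcc)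
    rw [← nhdsWithin_Ioo_eq_nhdsLT hab]
    refine exists_tendsto_of_hasDerivAt_of_bound (C := √C) (fun x hx => h.radius x (hsub hx)) ?_
    intro x hx
    refine Real.abs_le_sqrt ?_
    rw [h.sq_velocity x (hsub hx)]
    exact hC ⟨_, hr x (hsub hx) hx.1.le, rfl⟩
  have hr₁pos : 0 < r₁ := hε.trans_le (ge_of_tendsto hr₁ (hevJ.mono fun x hx =>
    (hr x (hsub hx) hx.1.le).1))
  have hlim : ∀ {g : ℝ → ℝ}, ContinuousAt g r₁ → Tendsto (fun x => g (γ.r x)) (𝓝[<] b) (𝓝 (g r₁)) :=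
    fun hg => hg.tendsto.comp hr₁
  have hF := hlim (contDiffAt_radialForce M L hr₁pos.ne').continuousAt
  obtain ⟨v₁, hv₁⟩ : ∃ l, Tendsto (deriv γ.r) (𝓝[<] b) (𝓝 l) :=
    exists_tendsto_of_hasDerivAt_of_tendsto (hevJ.mono fun x hx => h.velocity x (hsub hx)) hF
  have hangc : ContinuousAt (fun r : ℝ => L / r ^ 2) r₁ :=
    ContinuousAt.div continuousAt_const (by fun_prop) (by positivity)
  have htimec : r₁ ≠ 2 * M → ContinuousAt (fun r : ℝ => E * r / (r - 2 * M)) r₁ := fun hne =>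
    ContinuousAt.div (by fun_prop) (by fun_prop) (sub_ne_zero.2 hne)
  obtain ⟨φ₁, hφ₁⟩ : ∃ l, Tendsto γ.φ (𝓝[<] b) (𝓝 l) :=
    exists_tendsto_of_hasDerivAt_of_tendsto (hevJ.mono fun x hx => h.angle x (hsub hx))
      (hlim hangc)
  have hsq₁ : v₁ ^ 2 = radialSq M L E r₁ := by
    refine tendsto_nhds_unique (hv₁.pow 2)
      ((hlim (hasDerivAt_radialSq M L E hr₁pos.ne').continuousAt).congr' ?_)
    exact hevJ.mono fun x hx => (h.sq_velocity x (hsub hx)).symm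
  -- The local solution of the radial equation starting at `(r₁, v₁)`.
  obtain ⟨α, hα₀, δ₀, hδ₀, hα⟩ :=
    ContDiffAt.exists_forall_mem_closedBall_exists_eq_forall_mem_Ioo_hasDerivAt₀
      (f := fun p : ℝ × ℝ => (p.2, radialForce M L p.1)) (x₀ := (r₁, v₁))
      (contDiffAt_snd.prodMk
        ((contDiffAt_radialForce M L hr₁pos.ne').comp (r₁, v₁) contDiffAt_fst)) b
  set r₂ : ℝ → ℝ := fun x => (α x).1 with hr₂
  set v₂ : ℝ → ℝ := fun x => (α x).2 with hv₂
  have hr₂b : r₂ b = r₁ := by simp [hr₂, hα₀]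
  have hv₂b : v₂ b = v₁ := by simp [hv₂, hα₀]
  have hev₀ : ∀ᶠ x in 𝓝 b, HasDerivAt r₂ (v₂ x) x ∧ HasDerivAt v₂ (radialForce M L (r₂ x)) x := by
    filter_upwards [Ioo_mem_nhds (by linarith : b - δ₀ < b) (by linarith : b < b + δ₀)] with x hx
    exact ⟨(hα x hx).fst, (hα x hx).snd⟩
  have hr₂' := hev₀.self_of_nhds.1
  have hevpos : ∀ᶠ x in 𝓝 b, 0 < r₂ x :=
    hr₂'.continuousAt.eventually_const_lt (by rw [hr₂b]; exact hr₁pos)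
  have hevne : ∀ᶠ x in 𝓝 b, x ≠ b → r₂ x ≠ 2 * M := by
    by_cases h2 : r₁ = 2 * M
    · refine eventually_nhdsWithin_iff.1 (hr₂'.eventually_ne (c := 2 * M) ?_)
      rw [hv₂b]
      intro h0
      rw [h0, h2, radialSq_two_mul hM] at hsq₁
      exact pow_ne_zero 2 hE (by linarith)
    · exact (hr₂'.continuousAt.eventually_ne (by rwa [hr₂b])).mono fun x hx _ => hx
  have hevsq : ∀ᶠ x in 𝓝 b, v₂ x ^ 2 = radialSq M L E (r₂ x) := by
    have h1 : ∀ᶠ x in 𝓝 b, HasDerivAt (fun x => v₂ x ^ 2 - radialSq M L E (r₂ x)) 0 x := by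
      filter_upwards [hev₀, hevpos] with x hx hx0
      refine ((hx.2.pow 2).sub ((hasDerivAt_radialSq M L E hx0.ne').comp x hx.1)).congr_deriv ?_
      simp
      ring
    filter_upwards [eventually_eq_of_hasDerivAt_zero_punctured (h1.mono fun x hx => hx.continuousAt)
      (h1.mono fun x hx _ => hx)] with x hx
    rw [hr₂b, hv₂b, hsq₁, sub_self] at hx
    exact sub_eq_zero.1 hx
  obtain ⟨δ, hδ, hball⟩ := Metric.eventually_nhds_iff_ball.1
    (hev₀.and (hevpos.and (hevne.and hevsq)))
  rw [Real.ball_eq_Ioo] at hball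
  have hbmem : b ∈ Ioo (b - δ) (b + δ) := ⟨by linarith, by linarith⟩
  have hIco : Ico b (b + δ) ⊆ Ioo (b - δ) (b + δ) := fun x hx => ⟨by linarith [hx.1], hx.2⟩
  have hr₂c : ContinuousOn r₂ (Ioo (b - δ) (b + δ)) :=
    fun x hx => (hball x hx).1.1.continuousAt.continuousWithinAt
  obtain ⟨φ₂, hφ₂b, hφ₂⟩ := exists_hasDerivAt_of_continuousOn (g := fun x => L / r₂ x ^ 2)
    (continuousOn_const.div (hr₂c.pow 2) fun x hx => pow_ne_zero 2 (hball x hx).2.1.ne') hbmem φ₁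
  obtain ⟨t₂, ht₂, ht₂b⟩ : ∃ t₂ : ℝ → ℝ,
      (∀ x ∈ Ioo b (b + δ), HasDerivAt t₂ (E * r₂ x / (r₂ x - 2 * M)) x) ∧
      (r₁ ≠ 2 * M → HasDerivAt t₂ (E * r₂ b / (r₂ b - 2 * M)) b ∧
        Tendsto γ.t (𝓝[<] b) (𝓝 (t₂ b))) := by
    by_cases h2 : r₁ = 2 * M
    · obtain ⟨t₂, -, ht₂⟩ := exists_hasDerivAt_of_continuousOn (a := b) (b := b + δ)
        (c := b + δ / 2)
        (g := fun x => E * r₂ x / (r₂ x - 2 * M))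
        ((continuousOn_const.mul (hr₂c.mono fun x hx => hIco ⟨hx.1.le, hx.2⟩)).div
          ((hr₂c.mono fun x hx => hIco ⟨hx.1.le, hx.2⟩).sub continuousOn_const) fun x hx =>
            sub_ne_zero.2 ((hball x (hIco ⟨hx.1.le, hx.2⟩)).2.2.1 hx.1.ne'))
        ⟨by linarith, by linarith⟩ 0
      exact ⟨t₂, ht₂, fun h => absurd h2 h⟩
    · obtain ⟨t₁, ht₁⟩ : ∃ l, Tendsto γ.t (𝓝[<] b) (𝓝 l) :=
        exists_tendsto_of_hasDerivAt_of_tendsto (by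
          filter_upwards [hevJ, hr₁.eventually_ne h2] with x hx hx2 using
            h.time x (hsub hx) hx2) (hlim (htimec h2))
      obtain ⟨t₂, ht₂b, ht₂⟩ := exists_hasDerivAt_of_continuousOn
        (g := fun x => E * r₂ x / (r₂ x - 2 * M))
        ((continuousOn_const.mul hr₂c).div (hr₂c.sub continuousOn_const) fun x hx => by
            rw [sub_ne_zero]
            by_cases hxb : x = b
            · rwa [hxb, hr₂b]
            · exact (hball x hx).2.2.1 hxb) hbmem t₁
      exact ⟨t₂, fun x hx => ht₂ x (hIco ⟨hx.1.le, hx.2⟩),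
        fun _ => ⟨ht₂ b hbmem, by rwa [ht₂b]⟩⟩
  have hcase : ∀ x ∈ Ioo a (b + δ) ∪ γ.J, (x ∈ γ.J ∧ x < b) ∨ x = b ∨ (x ∈ Ioo b (b + δ)) := by
    rintro x (hx | hx)
    · rcases lt_trichotomy x b with hlt | heq | hgt
      · exact Or.inl ⟨hsub ⟨hx.1, hlt⟩, hlt⟩
      · exact Or.inr (Or.inl heq)
      · exact Or.inr (Or.inr ⟨hgt, hx.2⟩)
    · exact Or.inl ⟨hx, hJb x hx⟩
  have hrb : joinAt b γ.r r₂ b = r₁ := by rw [joinAt_of_le _ _ le_rfl, hr₂b]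
  let γ' : TimelikeGeodesic M := ofFirstOrder (M := M) (L := L) (E := E)
    (J := Ioo a (b + δ) ∪ γ.J) (r := joinAt b γ.r r₂) (v := joinAt b (deriv γ.r) v₂)
    (φ := joinAt b γ.φ φ₂) (t := joinAt b γ.t t₂) (isOpen_Ioo.union γ.isOpen_J)
    (by
      refine (IsPreconnected.union' ?_ isPreconnected_Ioo
        γ.ordConnected_J.isPreconnected).ordConnected
      exact ⟨(a + b) / 2, ⟨by linarith, by linarith⟩, hsub ⟨by linarith, by linarith⟩⟩)
    ⟨a, Or.inr ha⟩
    (by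
      intro x hx
      rcases hcase x hx with hx | rfl | hx
      · rw [joinAt_of_lt _ _ hx.2]
        exact γ.r_pos x hx.1
      · rwa [hrb]
      · rw [joinAt_of_le _ _ hx.1.le]
        exact (hball x (hIco ⟨hx.1.le, hx.2⟩)).2.1)
    (by
      intro x hx
      rcases hcase x hx with hx | rfl | hx
      · rw [joinAt_of_lt _ _ hx.2]
        exact hasDerivAt_joinAt_of_lt _ hx.2 (h.radius x hx.1)
      · rw [joinAt_of_le _ _ le_rfl]
        exact hasDerivAt_joinAt (hevJ.mono fun x hx => h.radius x (hsub hx)) (by rwa [hr₂b])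
          (by rwa [hv₂b]) hr₂'
      · rw [joinAt_of_le _ _ hx.1.le]
        exact hasDerivAt_joinAt_of_gt _ hx.1 (hball x (hIco ⟨hx.1.le, hx.2⟩)).1.1)
    (by
      intro x hx
      rcases hcase x hx with hx | rfl | hx
      · rw [joinAt_of_lt _ _ hx.2]
        exact hasDerivAt_joinAt_of_lt _ hx.2 (h.velocity x hx.1)
      · rw [hrb]
        refine hasDerivAt_joinAt (hevJ.mono fun x hx => h.velocity x (hsub hx)) (by rwa [hv₂b])
          hF ?_
        have := (hball x hbmem).1.2
        rwa [hr₂b] at this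
      · rw [joinAt_of_le _ _ hx.1.le]
        exact hasDerivAt_joinAt_of_gt _ hx.1 (hball x (hIco ⟨hx.1.le, hx.2⟩)).1.2)
    (by
      intro x hx
      rcases hcase x hx with hx | rfl | hx
      · rw [joinAt_of_lt _ _ hx.2, joinAt_of_lt _ _ hx.2]
        exact h.sq_velocity x hx.1
      · rw [hrb, joinAt_of_le _ _ le_rfl, hv₂b]
        exact hsq₁
      · rw [joinAt_of_le _ _ hx.1.le, joinAt_of_le _ _ hx.1.le]
        exact (hball x (hIco ⟨hx.1.le, hx.2⟩)).2.2.2)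
    (by
      intro x hx
      rcases hcase x hx with hx | rfl | hx
      · rw [joinAt_of_lt _ _ hx.2]
        exact hasDerivAt_joinAt_of_lt _ hx.2 (h.angle x hx.1)
      · rw [hrb]
        refine hasDerivAt_joinAt (hevJ.mono fun x hx => h.angle x (hsub hx)) (by rwa [hφ₂b])
          (hlim hangc) ?_
        have := hφ₂ x hbmem
        rwa [hr₂b] at this
      · rw [joinAt_of_le _ _ hx.1.le]
        exact hasDerivAt_joinAt_of_gt _ hx.1 (hφ₂ x (hIco ⟨hx.1.le, hx.2⟩)))
    (by
      intro x hx hne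
      rcases hcase x hx with hx | rfl | hx
      · rw [joinAt_of_lt _ _ hx.2] at hne ⊢
        exact hasDerivAt_joinAt_of_lt _ hx.2 (h.time x hx.1 hne)
      · rw [hrb] at hne ⊢
        have h1 := ht₂b hne
        rw [hr₂b] at h1
        refine hasDerivAt_joinAt ?_ h1.2 (hlim (htimec hne)) h1.1
        filter_upwards [hevJ, hr₁.eventually_ne hne] with y hy hy2 using h.time y (hsub hy) hy2
      · rw [joinAt_of_le _ _ hx.1.le]
        exact hasDerivAt_joinAt_of_gt _ hx.1 (ht₂ x hx))
  have := hmax γ' (fun x hx => Or.inr hx)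
    (fun x hx => joinAt_of_lt γ.r r₂ (hJb x hx)) (fun x hx => joinAt_of_lt γ.φ φ₂ (hJb x hx))
    (fun x hx => joinAt_of_lt γ.t t₂ (hJb x hx.1))
  have hbJ : b ∈ γ.J := by
    rw [← this]
    exact Or.inl ⟨hab, by linarith⟩
  exact lt_irrefl b (hJb b hbJ)

end TimelikeGeodesic

/-! ### Uniqueness for the radial equation -/

theorem radial_solution_unique {M L a b t₀ : ℝ} {r₁ v₁ r₂ v₂ : ℝ → ℝ} {S : Set (ℝ × ℝ)}
    (hS : IsCompact S) (hpos : ∀ p ∈ S, 0 < p.1) (ht₀ : t₀ ∈ Ioo a b)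
    (h₁ : ∀ t ∈ Ioo a b, HasDerivAt r₁ (v₁ t) t ∧ HasDerivAt v₁ (radialForce M L (r₁ t)) t ∧
      (r₁ t, v₁ t) ∈ S)
    (h₂ : ∀ t ∈ Ioo a b, HasDerivAt r₂ (v₂ t) t ∧ HasDerivAt v₂ (radialForce M L (r₂ t)) t ∧
      (r₂ t, v₂ t) ∈ S)
    (hr : r₁ t₀ = r₂ t₀) (hv : v₁ t₀ = v₂ t₀) : ∀ t ∈ Ioo a b, r₁ t = r₂ t ∧ v₁ t = v₂ t := by
  set X : ℝ × ℝ → ℝ × ℝ := fun p => (p.2, radialForce M L p.1)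
  obtain ⟨K, hK⟩ : ∃ K, LipschitzOnWith K X S := by
    refine LocallyLipschitzOn.exists_lipschitzOnWith_of_compact hS fun p hp => ?_
    have : ContDiffAt ℝ 1 X p := contDiffAt_snd.prodMk
      ((contDiffAt_radialForce M L (hpos p hp).ne').comp p contDiffAt_fst)
    obtain ⟨K, t, ht, h⟩ := this.exists_lipschitzOnWith
    exact ⟨K, t, mem_nhdsWithin_of_mem_nhds ht, h⟩
  have := ODE_solution_unique_of_mem_Ioo (v := fun _ => X) (s := fun _ => S)
    (f := fun t => (r₁ t, v₁ t)) (g := fun t => (r₂ t, v₂ t)) (fun _ _ => hK) ht₀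
    (fun t ht => ⟨(h₁ t ht).1.prodMk (h₁ t ht).2.1, (h₁ t ht).2.2⟩)
    (fun t ht => ⟨(h₂ t ht).1.prodMk (h₂ t ht).2.1, (h₂ t ht).2.2⟩) (by simp [hr, hv])
  exact fun t ht => Prod.ext_iff.1 (this ht)

/-! ### The roots of the radial potential -/

/-- Radii of circular orbits with the given constants: double roots of the radial potential. -/
def IsDoubleRoot (M L E c : ℝ) : Prop := 0 < c ∧ radialSq M L E c = 0 ∧ radialForce M L c = 0

theorem radialForce_eq {M L r : ℝ} (hM : M ≠ 0) (hr : r ≠ 0) : radialForce M L r =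
    -((2 * M / r) ^ 2 / (4 * M)) *
      (3 * (L / (2 * M)) ^ 2 * (2 * M / r) ^ 2 - 2 * (L / (2 * M)) ^ 2 * (2 * M / r) + 1) := by
  unfold radialForce
  field_simp
  ring

theorem radialSq_eq_cubicQ {M L E r : ℝ} (hM : M ≠ 0) (hL : L ≠ 0) (hr : r ≠ 0) :
    radialSq M L E r = (L / (2 * M)) ^ 2 * cubicQ (L / (2 * M)) E (2 * M / r) := by
  unfold radialSq cubicQ
  field_simp
  ring

theorem radialForce_zero_iff {M L r : ℝ} (hM : 0 < M) (hr : 0 < r) : radialForce M L r = 0 ↔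
    3 * (L / (2 * M)) ^ 2 * (2 * M / r) ^ 2 - 2 * (L / (2 * M)) ^ 2 * (2 * M / r) + 1 = 0 := by
  rw [radialForce_eq hM.ne' hr.ne', mul_eq_zero, or_iff_right]
  have : 0 < (2 * M / r) ^ 2 / (4 * M) := by positivity
  linarith

/-- At a double root of the potential the cubic factors; its roots add up to `1`, which determines
the third one. -/
theorem IsDoubleRoot.radialSq_eq {M L E c : ℝ} (hM : 0 < M) (hc : IsDoubleRoot M L E c)
    {r : ℝ} (hr : 0 < r) : radialSq M L E r =
      (L / (2 * M)) ^ 2 * (2 * M / r - 2 * M / c) ^ 2 * (2 * M / r - (1 - 2 * (2 * M / c))) := by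
  obtain ⟨hc0, h1, h2⟩ := hc
  rw [radialForce_zero_iff hM hc0] at h2
  have key : ∀ x, 0 < x → radialSq M L E x = (L / (2 * M)) ^ 2 * (2 * M / x) ^ 3 -
      (L / (2 * M)) ^ 2 * (2 * M / x) ^ 2 + 2 * M / x + E ^ 2 - 1 := by
    intro x hx
    unfold radialSq
    field_simp
    ring
  rw [key c hc0] at h1
  rw [key r hr]
  generalize 2 * M / c = a at *
  generalize 2 * M / r = u at *
  generalize (L / (2 * M)) ^ 2 = l at *
  linear_combination h1 + (u - a) * h2

theorem three_mul_lt_of_radialForce_eq_zero {M L r : ℝ} (hM : 0 < M) (hL : L ≠ 0) (hr : 0 < r)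
    (h : radialForce M L r = 0) : 3 * M < r := by
  have h1 : M * r ^ 2 = L ^ 2 * (r - 3 * M) := by
    unfold radialForce at h
    field_simp at h
    linarith
  have h2 : 0 < L ^ 2 := by positivity
  have h3 : 0 < M * r ^ 2 := by positivity
  by_contra hle
  have : L ^ 2 * (r - 3 * M) ≤ 0 := mul_nonpos_of_nonneg_of_nonpos h2.le (by linarith)
  linarith

theorem two_mul_div_lt {M r s : ℝ} (hM : 0 < M) (hr : 0 < r) (h : r < s) :
    2 * M / s < 2 * M / r := div_lt_div_of_pos_left (by positivity) hr h

/-- If `2M/c` is a double root of the cubic then the allowed region lies on one side of the third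
root. -/
theorem IsDoubleRoot.lt_of_radialSq_pos {M L E c r : ℝ} (hM : 0 < M) (hc : IsDoubleRoot M L E c)
    (hr : 0 < r) (h : 0 < radialSq M L E r) : 1 - 2 * (2 * M / c) < 2 * M / r := by
  rw [hc.radialSq_eq hM hr] at h
  have h1 : 0 ≤ (L / (2 * M)) ^ 2 * (2 * M / r - 2 * M / c) ^ 2 := by positivity
  by_contra hle
  have := mul_nonpos_of_nonneg_of_nonpos h1 (by linarith : 2 * M / r - (1 - 2 * (2 * M / c)) ≤ 0)
  linarith

/-- Beyond a root `s` of the potential with allowed radii outside it there is no double root: the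
third root would be `s`, and the potential would be negative just outside `s`. -/
theorem IsDoubleRoot.not_lt_of_radialSq_eq_zero {M L E c r s : ℝ} (hM : 0 < M) (hL : L ≠ 0)
    (hc : IsDoubleRoot M L E c) (hs : 0 < s) (h0 : radialSq M L E s = 0) (hsr : s < r)
    (hsc : s < c) (h : 0 < radialSq M L E r) : False := by
  have h1 := hc.lt_of_radialSq_pos hM (hs.trans hsr) h
  have h2 := two_mul_div_lt hM hs hsr
  have h3 := two_mul_div_lt hM hs hsc
  rw [hc.radialSq_eq hM hs] at h0
  have hl : (L / (2 * M)) ^ 2 ≠ 0 := by positivity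
  have := (mul_eq_zero.1 h0).resolve_left
    (mul_ne_zero hl (pow_ne_zero 2 (by linarith)))
  linarith

/-- Inside a double root of the potential the force does not vanish at allowed radii. -/
theorem IsDoubleRoot.not_radialForce_eq_zero {M L E c r : ℝ} (hM : 0 < M) (hL : L ≠ 0)
    (hc : IsDoubleRoot M L E c) (hr : 0 < r) (hrc : r < c) (h : 0 < radialSq M L E r)
    (hF : radialForce M L r = 0) : False := by
  have h1 := hc.lt_of_radialSq_pos hM hr h
  have h2 := two_mul_div_lt hM hr hrc
  have h3 := (radialForce_zero_iff hM hc.1).1 hc.2.2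
  have h4 := (radialForce_zero_iff hM hr).1 hF
  have hl : (L / (2 * M)) ^ 2 ≠ 0 := by positivity
  -- The two roots of the derivative of the cubic add up to `2 / 3`.
  have h5 : (L / (2 * M)) ^ 2 * ((2 * M / r - 2 * M / c) *
      (3 * (2 * M / r + 2 * M / c) - 2)) = 0 := by linear_combination h4 - h3
  have h6 := (mul_eq_zero.1 ((mul_eq_zero.1 h5).resolve_left hl)).resolve_left (by linarith)
  have h7 : 2 * M / c < 1 / 3 := by linarith
  linarith

/-! ### Turning points -/

namespace TimelikeGeodesic

variable {M : ℝ}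

/-- The standing assumptions: a maximal non-circular geodesic with non-zero constants of motion. -/
structure IsOrbit (γ : TimelikeGeodesic M) (L E : ℝ) : Prop extends γ.HasConstants L E where
  M_pos : 0 < M
  L_ne : L ≠ 0
  E_ne : E ≠ 0
  maximal : γ.IsMaximal
  not_circular : ¬ γ.IsCircular
  outside : ∃ τ ∈ γ.J, 2 * M < γ.r τ

variable {γ : TimelikeGeodesic M} {L E : ℝ}

theorem IsOrbit.reverse (h : γ.IsOrbit L E) : γ.reverse.IsOrbit L E where
  toHasConstants := h.toHasConstants.reverse
  M_pos := h.M_pos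
  L_ne := h.L_ne
  E_ne := h.E_ne
  maximal := h.maximal.reverse
  not_circular hc := h.not_circular fun τ hτ => by
    have := hc (-τ) (mem_reverse_J.2 (by simpa using hτ))
    simpa [deriv_reverse_r] using this
  outside := by
    obtain ⟨τ, hτ, hr⟩ := h.outside
    exact ⟨-τ, mem_reverse_J.2 (by simpa using hτ), by simpa [reverse_r] using hr⟩

theorem image_reverse_r (γ : TimelikeGeodesic M) : γ.reverse.r '' γ.reverse.J = γ.r '' γ.J := by
  ext x
  constructor
  · rintro ⟨τ, hτ, rfl⟩
    exact ⟨-τ, hτ, rfl⟩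
  · rintro ⟨τ, hτ, rfl⟩
    exact ⟨-τ, mem_reverse_J.2 (by simpa using hτ), by simp [reverse_r]⟩

theorem IsOrbit.force_ne_zero (h : γ.IsOrbit L E) {s : ℝ} (hs : s ∈ γ.J) (hv : deriv γ.r s = 0) :
    radialForce M L (γ.r s) ≠ 0 := by
  intro hF
  refine h.not_circular fun τ hτ => ?_
  obtain ⟨x, hx, hxJ⟩ : ∃ x < min s τ, x ∈ γ.J := by
    have hm : min s τ ∈ γ.J := by rcases min_choice s τ with h | h <;> rwa [h]
    exact (((eventually_mem_nhdsWithin (s := Iio (min s τ)) (a := min s τ))).and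
      (mem_nhdsWithin_of_mem_nhds (γ.isOpen_J.mem_nhds hm))).exists
  obtain ⟨y, hy, hyJ⟩ : ∃ y > max s τ, y ∈ γ.J := by
    have hm : max s τ ∈ γ.J := by rcases max_choice s τ with h | h <;> rwa [h]
    exact (((eventually_mem_nhdsWithin (s := Ioi (max s τ)) (a := max s τ))).and
      (mem_nhdsWithin_of_mem_nhds (γ.isOpen_J.mem_nhds hm))).exists
  have hsub : Icc x y ⊆ γ.J := γ.ordConnected_J.out hxJ hyJ
  have hsI : s ∈ Ioo x y := ⟨hx.trans_le (min_le_left _ _), (le_max_left _ _).trans_lt hy⟩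
  have hτI : τ ∈ Ioo x y := ⟨hx.trans_le (min_le_right _ _), (le_max_right _ _).trans_lt hy⟩
  have hS : IsCompact ((fun t => (γ.r t, deriv γ.r t)) '' Icc x y) :=
    isCompact_Icc.image_of_continuousOn
      ((h.continuousOn_r.mono hsub).prodMk (h.continuousOn_v.mono hsub))
  exact (radial_solution_unique (M := M) (L := L) (r₂ := fun _ => γ.r s) (v₂ := fun _ => 0) hS
    (by
      rintro _ ⟨t, ht, rfl⟩
      exact γ.r_pos t (hsub ht)) hsI
    (fun t ht => ⟨h.radius t (hsub (Ioo_subset_Icc_self ht)),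
      h.velocity t (hsub (Ioo_subset_Icc_self ht)), t, Ioo_subset_Icc_self ht, rfl⟩)
    (fun t _ => ⟨hasDerivAt_const t _, by rw [hF]; exact hasDerivAt_const t _,
      s, Ioo_subset_Icc_self hsI, by simp [hv]⟩) rfl hv τ hτI).2

theorem IsOrbit.radialSq_nonneg (h : γ.IsOrbit L E) {τ : ℝ} (hτ : τ ∈ γ.J) :
    0 ≤ radialSq M L E (γ.r τ) := by
  rw [← h.sq_velocity τ hτ]
  positivity

theorem IsOrbit.radialSq_eq_zero (h : γ.IsOrbit L E) {τ : ℝ} (hτ : τ ∈ γ.J)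
    (hv : deriv γ.r τ = 0) : radialSq M L E (γ.r τ) = 0 := by
  rw [← h.sq_velocity τ hτ, hv]
  simp

theorem IsOrbit.radialSq_pos (h : γ.IsOrbit L E) {τ : ℝ} (hτ : τ ∈ γ.J)
    (hv : deriv γ.r τ ≠ 0) : 0 < radialSq M L E (γ.r τ) := by
  rw [← h.sq_velocity τ hτ]
  positivity

theorem IsOrbit.ordConnected_range (h : γ.IsOrbit L E) : (γ.r '' γ.J).OrdConnected :=
  (γ.ordConnected_J.isPreconnected.image γ.r h.continuousOn_r).ordConnected

theorem IsOrbit.lt_of_turning (h : γ.IsOrbit L E) {s : ℝ} (hs : s ∈ γ.J)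
    (hv : deriv γ.r s = 0) : 2 * M < γ.r s := by
  by_contra hle
  have := radialSq_pos_of_le L h.E_ne (γ.r_pos s hs) (not_lt.1 hle)
  rw [h.radialSq_eq_zero hs hv] at this
  exact lt_irrefl 0 this

/-- A turning point with inward acceleration is the largest radius of the orbit. -/
theorem IsOrbit.le_of_turning (h : γ.IsOrbit L E) {s : ℝ} (hs : s ∈ γ.J)
    (hv : deriv γ.r s = 0) (hF : radialForce M L (γ.r s) < 0) {τ : ℝ} (hτ : τ ∈ γ.J) :
    γ.r τ ≤ γ.r s := by
  by_contra hlt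
  rw [not_le] at hlt
  have hd := hasDerivAt_radialSq M L E (γ.r_pos s hs).ne'
  have h1 : ∀ᶠ x in 𝓝[>] γ.r s, radialSq M L E x < 0 := by
    have := eventually_nhdsWithin_sign_eq_of_deriv_neg (by rw [hd.deriv]; linarith)
      (h.radialSq_eq_zero hs hv)
    filter_upwards [this.filter_mono nhdsWithin_le_nhds, self_mem_nhdsWithin] with x hx hgt
    rw [sign_neg (sub_neg.2 hgt)] at hx
    exact sign_eq_neg_one_iff.1 hx
  obtain ⟨x, hx, hxI⟩ := (h1.and (Ioo_mem_nhdsGT hlt)).exists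
  obtain ⟨τ', hτ', rfl⟩ := h.ordConnected_range.out ⟨s, hs, rfl⟩ ⟨τ, hτ, rfl⟩
    (Ioo_subset_Icc_self hxI)
  exact absurd hx (not_lt.2 (h.radialSq_nonneg hτ'))

theorem IsOrbit.ge_of_turning (h : γ.IsOrbit L E) {s : ℝ} (hs : s ∈ γ.J)
    (hv : deriv γ.r s = 0) (hF : 0 < radialForce M L (γ.r s)) {τ : ℝ} (hτ : τ ∈ γ.J) :
    γ.r s ≤ γ.r τ := by
  by_contra hlt
  rw [not_le] at hlt
  have hd := hasDerivAt_radialSq M L E (γ.r_pos s hs).ne'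
  have h1 : ∀ᶠ x in 𝓝[<] γ.r s, radialSq M L E x < 0 := by
    have := eventually_nhdsWithin_sign_eq_of_deriv_pos (by rw [hd.deriv]; linarith)
      (h.radialSq_eq_zero hs hv)
    filter_upwards [this.filter_mono nhdsWithin_le_nhds, self_mem_nhdsWithin] with x hx hlt
    rw [sign_neg (sub_neg.2 hlt)] at hx
    exact sign_eq_neg_one_iff.1 hx
  obtain ⟨x, hx, hxI⟩ := (h1.and (Ioo_mem_nhdsLT hlt)).exists
  obtain ⟨τ', hτ', rfl⟩ := h.ordConnected_range.out ⟨τ, hτ, rfl⟩ ⟨s, hs, rfl⟩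
    (Ioo_subset_Icc_self hxI)
  exact absurd hx (not_lt.2 (h.radialSq_nonneg hτ'))

theorem IsOrbit.not_const_Ioo (h : γ.IsOrbit L E) {a b c : ℝ} (hab : a < b)
    (hsub : Ioo a b ⊆ γ.J) : ¬ ∀ τ ∈ Ioo a b, γ.r τ = c := by
  intro hc
  have hd : ∀ τ ∈ Ioo a b, deriv γ.r τ = 0 := by
    intro τ hτ
    refine ((hasDerivAt_const τ c).congr_of_eventuallyEq ?_).deriv
    filter_upwards [isOpen_Ioo.mem_nhds hτ] with x hx using hc x hx
  have hm : (a + b) / 2 ∈ Ioo a b := ⟨by linarith, by linarith⟩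
  refine h.force_ne_zero (hsub hm) (hd _ hm)
    ((h.velocity _ (hsub hm)).unique ((hasDerivAt_const _ (0 : ℝ)).congr_of_eventuallyEq ?_))
  filter_upwards [isOpen_Ioo.mem_nhds hm] with x hx using hd x hx

theorem IsOrbit.isEllipticLike_of_turning (h : γ.IsOrbit L E) {s s' : ℝ} (hs : s ∈ γ.J)
    (hs' : s' ∈ γ.J) (hv : deriv γ.r s = 0) (hv' : deriv γ.r s' = 0)
    (hF : radialForce M L (γ.r s) < 0) (hF' : 0 < radialForce M L (γ.r s')) :
    γ.IsEllipticLike := by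
  refine ⟨γ.r s', γ.r s, h.lt_of_turning hs' hv', lt_of_le_of_ne (h.le_of_turning hs hv hF hs') ?_,
    ?_⟩
  · intro heq
    rw [heq] at hF'
    exact lt_asymm hF hF'
  · refine Subset.antisymm ?_ (h.ordConnected_range.out ⟨s', hs', rfl⟩ ⟨s, hs, rfl⟩)
    rintro _ ⟨τ, hτ, rfl⟩
    exact ⟨h.ge_of_turning hs' hv' hF' hτ, h.le_of_turning hs hv hF hτ⟩

/-- Between two instants of largest radius there is one of smallest radius, and conversely. -/
theorem IsOrbit.isEllipticLike_of_lt (h : γ.IsOrbit L E) {s s' : ℝ} (hs : s ∈ γ.J)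
    (hs' : s' ∈ γ.J) (hv : deriv γ.r s = 0) (hv' : deriv γ.r s' = 0) (hlt : s < s') :
    γ.IsEllipticLike := by
  have hsub : Icc s s' ⊆ γ.J := γ.ordConnected_J.out hs hs'
  have hcont := h.continuousOn_r.mono hsub
  have hI : IsCompact (Icc s s') := isCompact_Icc
  rcases lt_or_gt_of_ne (h.force_ne_zero hs hv) with hF | hF <;>
    rcases lt_or_gt_of_ne (h.force_ne_zero hs' hv') with hF' | hF'
  · have heq : γ.r s = γ.r s' :=
      le_antisymm (h.le_of_turning hs' hv' hF' hs) (h.le_of_turning hs hv hF hs')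
    obtain ⟨c, hc, hcmin⟩ := hI.exists_isMinOn ⟨s, left_mem_Icc.2 hlt.le⟩ hcont
    have hcJ := hsub hc
    have hcne : γ.r c < γ.r s := by
      refine lt_of_le_of_ne (h.le_of_turning hs hv hF hcJ) fun hne => ?_
      refine h.not_const_Ioo hlt (Ioo_subset_Icc_self.trans hsub) (c := γ.r s) fun τ hτ => ?_
      have h1 := hcmin (Ioo_subset_Icc_self hτ)
      exact le_antisymm (h.le_of_turning hs hv hF (hsub (Ioo_subset_Icc_self hτ)))
        (hne ▸ h1)
    have hcI : c ∈ Ioo s s' := by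
      refine ⟨lt_of_le_of_ne hc.1 ?_, lt_of_le_of_ne hc.2 ?_⟩ <;> rintro rfl <;> linarith
    have hvc := (hcmin.isLocalMin (Icc_mem_nhds hcI.1 hcI.2)).deriv_eq_zero
    rcases lt_or_gt_of_ne (h.force_ne_zero hcJ hvc) with hFc | hFc
    · exact absurd (h.le_of_turning hcJ hvc hFc hs) (not_le.2 hcne)
    · exact h.isEllipticLike_of_turning hs hcJ hv hvc hF hFc
  · exact h.isEllipticLike_of_turning hs hs' hv hv' hF hF'
  · exact h.isEllipticLike_of_turning hs' hs hv' hv hF' hF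
  · have heq : γ.r s = γ.r s' :=
      le_antisymm (h.ge_of_turning hs hv hF hs') (h.ge_of_turning hs' hv' hF' hs)
    obtain ⟨c, hc, hcmax⟩ := hI.exists_isMaxOn ⟨s, left_mem_Icc.2 hlt.le⟩ hcont
    have hcJ := hsub hc
    have hcne : γ.r s < γ.r c := by
      refine lt_of_le_of_ne (h.ge_of_turning hs hv hF hcJ) fun hne => ?_
      refine h.not_const_Ioo hlt (Ioo_subset_Icc_self.trans hsub) (c := γ.r s) fun τ hτ => ?_
      have h1 := hcmax (Ioo_subset_Icc_self hτ)
      exact le_antisymm (hne ▸ h1)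
        (h.ge_of_turning hs hv hF (hsub (Ioo_subset_Icc_self hτ)))
    have hcI : c ∈ Ioo s s' := by
      refine ⟨lt_of_le_of_ne hc.1 ?_, lt_of_le_of_ne hc.2 ?_⟩ <;> rintro rfl <;> linarith
    have hvc := (hcmax.isLocalMax (Icc_mem_nhds hcI.1 hcI.2)).deriv_eq_zero
    rcases lt_or_gt_of_ne (h.force_ne_zero hcJ hvc) with hFc | hFc
    · exact h.isEllipticLike_of_turning hcJ hs hvc hv hFc hF
    · exact absurd (h.ge_of_turning hcJ hvc hFc hs) (not_le.2 hcne)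

/-- An orbit that is not elliptic-like has at most one turning instant. -/
theorem IsOrbit.turning_unique (h : γ.IsOrbit L E) (hell : ¬ γ.IsEllipticLike) {s s' : ℝ}
    (hs : s ∈ γ.J) (hs' : s' ∈ γ.J) (hv : deriv γ.r s = 0) (hv' : deriv γ.r s' = 0) : s = s' := by
  by_contra hne
  rcases lt_or_gt_of_ne hne with hlt | hlt
  · exact hell (h.isEllipticLike_of_lt hs hs' hv hv' hlt)
  · exact hell (h.isEllipticLike_of_lt hs' hs hv' hv hlt)

end TimelikeGeodesic

/-! ### Ends of the orbit -/

theorem exists_seq_tendsto_zero_of_tendsto {f g : ℝ → ℝ} {a c : ℝ}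
    (hf : ∀ x, a ≤ x → HasDerivAt f (g x) x) (hc : Tendsto f atTop (𝓝 c)) :
    ∃ ξ : ℕ → ℝ, Tendsto ξ atTop atTop ∧ Tendsto (fun n => g (ξ n)) atTop (𝓝 0) := by
  have hex : ∀ n : ℕ, ∃ ξ ∈ Ioo (a + n) (a + n + 1), g ξ = f (a + n + 1) - f (a + n) := by
    intro n
    have hn : (0 : ℝ) ≤ n := n.cast_nonneg
    obtain ⟨ξ, hξ, h⟩ := exists_hasDerivAt_eq_slope f g (lt_add_one (a + n))
      (fun y hy => (hf y (by linarith [hy.1])).continuousAt.continuousWithinAt)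
      (fun y hy => hf y (by linarith [hy.1]))
    exact ⟨ξ, hξ, by rw [h]; simp⟩
  choose ξ hξ hg using hex
  have h1 : Tendsto (fun n : ℕ => a + (n : ℝ)) atTop atTop :=
    tendsto_atTop_add_const_left _ _ tendsto_natCast_atTop_atTop
  have h2 : Tendsto (fun n : ℕ => a + (n : ℝ) + 1) atTop atTop :=
    tendsto_atTop_add_const_right _ _ h1
  refine ⟨ξ, tendsto_atTop_mono (fun n => (hξ n).1.le) h1, ?_⟩
  simp only [hg]
  simpa using (hc.comp h2).sub (hc.comp h1)

/-- A continuous function without zeros on an interval has constant sign. -/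
theorem pos_or_neg_of_ne_zero {f : ℝ → ℝ} {s : Set ℝ} (hs : s.OrdConnected)
    (hf : ContinuousOn f s) (h : ∀ x ∈ s, f x ≠ 0) :
    (∀ x ∈ s, 0 < f x) ∨ ∀ x ∈ s, f x < 0 := by
  by_contra hcon
  push Not at hcon
  obtain ⟨⟨x, hx, hfx⟩, y, hy, hfy⟩ := hcon
  obtain ⟨z, hz, hfz⟩ := hs.isPreconnected.intermediate_value hx hy hf ⟨hfx, hfy⟩
  exact h z hz hfz

namespace TimelikeGeodesic

variable {M : ℝ} {γ : TimelikeGeodesic M} {L E : ℝ}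

theorem Ici_subset_J (hb : ¬ BddAbove γ.J) {a : ℝ} (ha : a ∈ γ.J) : Ici a ⊆ γ.J := by
  intro x hx
  obtain ⟨y, hy, hxy⟩ := not_bddAbove_iff.1 hb x
  exact γ.ordConnected_J.out ha hy ⟨hx, hxy.le⟩

theorem IsOrbit.isDoubleRoot_of_tendsto (h : γ.IsOrbit L E) (hb : ¬ BddAbove γ.J) {c : ℝ}
    (hc0 : 0 < c) (hc : Tendsto γ.r atTop (𝓝 c)) : IsDoubleRoot M L E c := by
  obtain ⟨a, ha⟩ := γ.nonempty_J
  have hsub := Ici_subset_J hb ha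
  have hP : Tendsto (fun x => radialSq M L E (γ.r x)) atTop (𝓝 (radialSq M L E c)) :=
    (hasDerivAt_radialSq M L E hc0.ne').continuousAt.tendsto.comp hc
  have hF : Tendsto (fun x => radialForce M L (γ.r x)) atTop (𝓝 (radialForce M L c)) :=
    (contDiffAt_radialForce M L hc0.ne').continuousAt.tendsto.comp hc
  have hev : (fun x => deriv γ.r x ^ 2) =ᶠ[atTop] fun x => radialSq M L E (γ.r x) := by
    filter_upwards [eventually_ge_atTop a] with x hx using h.sq_velocity x (hsub hx)
  have hv2 : Tendsto (fun x => deriv γ.r x ^ 2) atTop (𝓝 (radialSq M L E c)) :=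
    hP.congr' hev.symm
  have h1 : radialSq M L E c = 0 := by
    obtain ⟨ξ, hξ, hg⟩ := exists_seq_tendsto_zero_of_tendsto (fun x hx => h.radius x (hsub hx)) hc
    exact tendsto_nhds_unique (hv2.comp hξ) (by simpa [Function.comp_def] using hg.pow 2)
  refine ⟨hc0, h1, ?_⟩
  have hv : Tendsto (deriv γ.r) atTop (𝓝 0) := by
    rw [h1] at hv2
    have := hv2.sqrt
    simp only [Real.sqrt_sq_eq_abs, Real.sqrt_zero] at this
    exact (tendsto_zero_iff_abs_tendsto_zero _).2 this
  obtain ⟨ξ, hξ, hg⟩ := exists_seq_tendsto_zero_of_tendsto (fun x hx => h.velocity x (hsub hx)) hv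
  exact tendsto_nhds_unique (hF.comp hξ) hg

theorem IsOrbit.notMem_range (h : γ.IsOrbit L E) {c : ℝ} (hc : IsDoubleRoot M L E c) :
    c ∉ γ.r '' γ.J := by
  rintro ⟨τ, hτ, rfl⟩
  refine h.force_ne_zero hτ ?_ hc.2.2
  have := h.sq_velocity τ hτ
  rw [hc.2.1] at this
  exact pow_eq_zero_iff two_ne_zero |>.1 this

theorem IsOrbit.lt_of_isDoubleRoot (h : γ.IsOrbit L E) {c : ℝ} (hc : IsDoubleRoot M L E c) :
    2 * M < c := by
  by_contra hle
  have := radialSq_pos_of_le L h.E_ne hc.1 (not_lt.1 hle)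
  rw [hc.2.1] at this
  exact lt_irrefl 0 this

theorem mem_closure_range_of_tendsto (hb : ¬ BddAbove γ.J) {c : ℝ}
    (hc : Tendsto γ.r atTop (𝓝 c)) : c ∈ closure (γ.r '' γ.J) := by
  obtain ⟨a, ha⟩ := γ.nonempty_J
  refine mem_closure_of_tendsto hc ?_
  filter_upwards [eventually_ge_atTop a] with x hx using ⟨x, Ici_subset_J hb ha hx, rfl⟩

theorem bddBelow_J_iff_reverse : BddAbove γ.reverse.J ↔ BddBelow γ.J := by
  constructor
  · rintro ⟨b, hb⟩
    exact ⟨-b, fun x hx => neg_le.1 (hb (mem_reverse_J.2 (by simpa using hx)))⟩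
  · rintro ⟨b, hb⟩
    exact ⟨-b, fun x hx => le_neg.1 (hb hx)⟩

theorem tendsto_reverse_r {c : ℝ} :
    Tendsto γ.reverse.r atTop (𝓝 c) ↔ Tendsto γ.r atBot (𝓝 c) := by
  constructor
  · intro h
    have := h.comp tendsto_neg_atBot_atTop
    refine this.congr fun x => ?_
    simp [reverse_r]
  · exact fun h => h.comp tendsto_neg_atTop_atBot

theorem isAsymptoticallyCircular_of_reverse (h : γ.reverse.IsAsymptoticallyCircular) :
    γ.IsAsymptoticallyCircular := by
  obtain ⟨c, hc, ⟨hb, ht⟩ | ⟨hb, ht⟩⟩ := h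
  · exact ⟨c, hc, Or.inr ⟨by rwa [← bddBelow_J_iff_reverse], tendsto_reverse_r.1 ht⟩⟩
  · refine ⟨c, hc, Or.inl ⟨?_, ?_⟩⟩
    · rwa [← bddBelow_J_iff_reverse, reverse_reverse_J] at hb
    · refine (tendsto_reverse_r.2 ht).congr fun x => ?_
      simp [reverse_r]

/-- The limiting radius of an asymptotically circular orbit is a double root of the potential, so
it is not reached. -/
theorem IsOrbit.exists_of_isAsymptoticallyCircular (h : γ.IsOrbit L E)
    (hac : γ.IsAsymptoticallyCircular) :
    ∃ c, 2 * M < c ∧ c ∉ γ.r '' γ.J ∧ c ∈ closure (γ.r '' γ.J) := by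
  obtain ⟨c, hc, ⟨hb, ht⟩ | ⟨hb, ht⟩⟩ := hac
  · have hc0 : 0 < c := by linarith [h.M_pos]
    exact ⟨c, hc, h.notMem_range (h.isDoubleRoot_of_tendsto hb hc0 ht),
      mem_closure_range_of_tendsto hb ht⟩
  · have hc0 : 0 < c := by linarith [h.M_pos]
    rw [← bddBelow_J_iff_reverse] at hb
    rw [← tendsto_reverse_r] at ht
    rw [← image_reverse_r]
    exact ⟨c, hc, h.reverse.notMem_range (h.reverse.isDoubleRoot_of_tendsto hb hc0 ht),
      mem_closure_range_of_tendsto hb ht⟩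

theorem IsOrbit.v_ne_zero_of_unbounded (h : γ.IsOrbit L E) (hub : ¬ γ.IsBounded)
    (hend : γ.IsAsymptoticallyCircular ∨ γ.IsHorizonCrossing) {s : ℝ} (hs : s ∈ γ.J) :
    deriv γ.r s ≠ 0 := by
  intro hv
  rcases lt_or_gt_of_ne (h.force_ne_zero hs hv) with hF | hF
  · refine hub ⟨γ.r s, ?_⟩
    rintro _ ⟨τ, hτ, rfl⟩
    exact h.le_of_turning hs hv hF hτ
  · rcases hend with hac | ⟨τ, hτ, hr⟩
    · obtain ⟨c, -, hc1, hc2⟩ := h.exists_of_isAsymptoticallyCircular hac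
      have hsc : γ.r s ≤ c := by
        refine closure_minimal ?_ isClosed_Ici hc2
        rintro _ ⟨τ, hτ, rfl⟩
        exact h.ge_of_turning hs hv hF hτ
      obtain ⟨_, ⟨τ, hτ, rfl⟩, hcτ⟩ := not_bddAbove_iff.1 hub c
      exact hc1 (h.ordConnected_range.out ⟨s, hs, rfl⟩ ⟨τ, hτ, rfl⟩ ⟨hsc, hcτ.le⟩)
    · have h1 := h.lt_of_turning hs hv
      have h2 := h.ge_of_turning hs hv hF hτ
      linarith

theorem IsOrbit.v_ne_zero_of_horizonCrossing (h : γ.IsOrbit L E) (hhc : γ.IsHorizonCrossing)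
    (hac : γ.IsAsymptoticallyCircular) {s : ℝ} (hs : s ∈ γ.J) : deriv γ.r s ≠ 0 := by
  intro hv
  obtain ⟨τ, hτ, hr⟩ := hhc
  rcases lt_or_gt_of_ne (h.force_ne_zero hs hv) with hF | hF
  · obtain ⟨c, hc0, hc1, hc2⟩ := h.exists_of_isAsymptoticallyCircular hac
    have hsc : c ≤ γ.r s := by
      refine closure_minimal ?_ isClosed_Iic hc2
      rintro _ ⟨τ, hτ, rfl⟩
      exact h.le_of_turning hs hv hF hτ
    exact hc1 (h.ordConnected_range.out ⟨τ, hτ, rfl⟩ ⟨s, hs, rfl⟩ ⟨by rw [hr]; exact hc0.le, hsc⟩)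
  · have h1 := h.lt_of_turning hs hv
    have h2 := h.ge_of_turning hs hv hF hτ
    linarith

theorem IsOrbit.not_bddAbove_of_mem_Icc (h : γ.IsOrbit L E) {a ε K : ℝ} (ha : a ∈ γ.J)
    (hε : 0 < ε) (hr : ∀ τ ∈ γ.J, a ≤ τ → γ.r τ ∈ Icc ε K) : ¬ BddAbove γ.J := fun hb =>
  h.not_isLUB h.M_pos h.E_ne h.maximal ha hε hr (isLUB_csSup γ.nonempty_J hb)

theorem ordConnected_after (γ : TimelikeGeodesic M) (s : ℝ) : (γ.J ∩ Ici s).OrdConnected :=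
  γ.ordConnected_J.inter ordConnected_Ici

theorem IsOrbit.strictMonoOn_after (h : γ.IsOrbit L E) {s : ℝ}
    (hv : ∀ τ ∈ γ.J, s < τ → 0 < deriv γ.r τ) : StrictMonoOn γ.r (γ.J ∩ Ici s) :=
  strictMonoOn_of_deriv_pos (γ.ordConnected_after s).convex
    (h.continuousOn_r.mono inter_subset_left) fun x hx => by
      rw [interior_inter, interior_Ici] at hx
      exact hv x (interior_subset hx.1) hx.2

theorem IsOrbit.strictAntiOn_after (h : γ.IsOrbit L E) {s : ℝ}
    (hv : ∀ τ ∈ γ.J, s < τ → deriv γ.r τ < 0) : StrictAntiOn γ.r (γ.J ∩ Ici s) :=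
  strictAntiOn_of_deriv_neg (γ.ordConnected_after s).convex
    (h.continuousOn_r.mono inter_subset_left) fun x hx => by
      rw [interior_inter, interior_Ici] at hx
      exact hv x (interior_subset hx.1) hx.2

/-- A bounded outgoing end of an orbit is asymptotically circular. -/
theorem IsOrbit.exists_doubleRoot_of_outgoing (h : γ.IsOrbit L E) (hb : γ.IsBounded) {s : ℝ}
    (hs : s ∈ γ.J) (hv : ∀ τ ∈ γ.J, s < τ → 0 < deriv γ.r τ) :
    ∃ c, IsDoubleRoot M L E c ∧ γ.r s < c ∧ γ.IsAsymptoticallyCircular := by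
  have hmono := h.strictMonoOn_after hv
  obtain ⟨K, hK⟩ := hb
  have hub : ¬ BddAbove γ.J := h.not_bddAbove_of_mem_Icc hs (γ.r_pos s hs) fun τ hτ hsτ =>
    ⟨hmono.monotoneOn ⟨hs, self_mem_Ici⟩ ⟨hτ, hsτ⟩ hsτ, hK ⟨τ, hτ, rfl⟩⟩
  have hsub := Ici_subset_J hub hs
  have hm : Monotone fun x => γ.r (max s x) := fun x y hxy =>
    hmono.monotoneOn ⟨hsub (le_max_left s x), le_max_left s x⟩
      ⟨hsub (le_max_left s y), le_max_left s y⟩ (max_le_max_left s hxy)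
  have hbd : BddAbove (range fun x => γ.r (max s x)) := by
    refine ⟨K, ?_⟩
    rintro _ ⟨x, rfl⟩
    exact hK ⟨_, hsub (le_max_left s x), rfl⟩
  have ht := tendsto_atTop_ciSup hm hbd
  set c := ⨆ x, γ.r (max s x) with hc
  have ht' : Tendsto γ.r atTop (𝓝 c) := by
    refine ht.congr' ?_
    filter_upwards [eventually_ge_atTop s] with x hx
    rw [max_eq_right hx]
  have hsc : γ.r s < c := by
    have h1 : γ.r s < γ.r (s + 1) := hmono ⟨hs, self_mem_Ici⟩
      ⟨hsub (by simp : s ≤ s + 1), (by simp : s ≤ s + 1)⟩ (by linarith)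
    have h2 := le_ciSup hbd (s + 1)
    simp only [max_eq_right (by linarith : s ≤ s + 1)] at h2
    exact h1.trans_le h2
  have hd := h.isDoubleRoot_of_tendsto hub ((γ.r_pos s hs).trans hsc) ht'
  exact ⟨c, hd, hsc, c, h.lt_of_isDoubleRoot hd, Or.inl ⟨hub, ht'⟩⟩

/-- An ingoing end of an orbit that does not reach the horizon is asymptotically circular. -/
theorem IsOrbit.isAsymptoticallyCircular_of_ingoing (h : γ.IsOrbit L E)
    (hhc : ¬ γ.IsHorizonCrossing) {s : ℝ}
    (hs : s ∈ γ.J) (hv : ∀ τ ∈ γ.J, s < τ → deriv γ.r τ < 0) : γ.IsAsymptoticallyCircular := by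
  have hanti := h.strictAntiOn_after hv
  have hM := h.M_pos
  have hout : ∀ τ ∈ γ.J, 2 * M ≤ γ.r τ := by
    intro τ hτ
    by_contra hlt
    obtain ⟨τ₀, hτ₀, hr₀⟩ := h.outside
    obtain ⟨τ', hτ', hr'⟩ := h.ordConnected_range.out ⟨τ, hτ, rfl⟩ ⟨τ₀, hτ₀, rfl⟩
      ⟨(not_le.1 hlt).le, hr₀.le⟩
    exact hhc ⟨τ', hτ', hr'⟩
  have hub : ¬ BddAbove γ.J := h.not_bddAbove_of_mem_Icc hs (by positivity : 0 < 2 * M)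
    fun τ hτ hsτ => ⟨hout τ hτ, hanti.antitoneOn ⟨hs, self_mem_Ici⟩ ⟨hτ, hsτ⟩ hsτ⟩
  have hsub := Ici_subset_J hub hs
  have hm : Antitone fun x => γ.r (max s x) := fun x y hxy =>
    hanti.antitoneOn ⟨hsub (le_max_left s x), le_max_left s x⟩
      ⟨hsub (le_max_left s y), le_max_left s y⟩ (max_le_max_left s hxy)
  have hbd : BddBelow (range fun x => γ.r (max s x)) := by
    refine ⟨2 * M, ?_⟩
    rintro _ ⟨x, rfl⟩
    exact hout _ (hsub (le_max_left s x))
  have ht := tendsto_atTop_ciInf hm hbd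
  set c := ⨅ x, γ.r (max s x) with hc
  have ht' : Tendsto γ.r atTop (𝓝 c) := by
    refine ht.congr' ?_
    filter_upwards [eventually_ge_atTop s] with x hx
    rw [max_eq_right hx]
  have hc0 : 2 * M ≤ c := le_ciInf fun x => hout _ (hsub (le_max_left s x))
  have hd := h.isDoubleRoot_of_tendsto hub (by linarith) ht'
  exact ⟨c, h.lt_of_isDoubleRoot hd, Or.inl ⟨hub, ht'⟩⟩

theorem isBounded_reverse : γ.reverse.IsBounded ↔ γ.IsBounded := by
  unfold IsBounded
  rw [image_reverse_r]

theorem isHorizonCrossing_reverse : γ.reverse.IsHorizonCrossing ↔ γ.IsHorizonCrossing := by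
  have h1 : ∀ γ : TimelikeGeodesic M, γ.IsHorizonCrossing ↔ 2 * M ∈ γ.r '' γ.J := fun _ => Iff.rfl
  rw [h1, h1, image_reverse_r]

theorem IsOrbit.v_pos_or_neg (h : γ.IsOrbit L E) (hv : ∀ τ ∈ γ.J, deriv γ.r τ ≠ 0) :
    (∀ τ ∈ γ.J, 0 < deriv γ.r τ) ∨ ∀ τ ∈ γ.J, deriv γ.r τ < 0 :=
  pos_or_neg_of_ne_zero γ.ordConnected_J h.continuousOn_v hv

theorem IsOrbit.bounded_aux (h : γ.IsOrbit L E) (hb : γ.IsBounded)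
    (hv : ∀ τ ∈ γ.J, 0 < deriv γ.r τ) :
    γ.IsAsymptoticallyCircular ∧ ∀ τ ∈ γ.J, radialForce M L (γ.r τ) ≠ 0 := by
  have key := fun τ hτ => h.exists_doubleRoot_of_outgoing hb (s := τ) hτ fun x hx _ => hv x hx
  refine ⟨?_, fun τ hτ hF => ?_⟩
  · obtain ⟨τ, hτ⟩ := γ.nonempty_J
    exact (key τ hτ).choose_spec.2.2
  · obtain ⟨c, hc, hlt, -⟩ := key τ hτ
    exact hc.not_radialForce_eq_zero h.M_pos h.L_ne (γ.r_pos τ hτ) hlt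
      (h.radialSq_pos hτ (hv τ hτ).ne') hF

/-- A bounded orbit without turning point is asymptotically circular and has no inertial point. -/
theorem IsOrbit.isAsymptoticallyCircular_of_bounded (h : γ.IsOrbit L E) (hb : γ.IsBounded)
    (hv : ∀ τ ∈ γ.J, deriv γ.r τ ≠ 0) :
    γ.IsAsymptoticallyCircular ∧ ∀ τ ∈ γ.J, radialForce M L (γ.r τ) ≠ 0 := by
  rcases h.v_pos_or_neg hv with hv | hv
  · exact h.bounded_aux hb hv
  · obtain ⟨h1, h2⟩ := h.reverse.bounded_aux (isBounded_reverse.2 hb) fun τ hτ => by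
      rw [deriv_reverse_r]
      exact neg_pos.2 (hv _ hτ)
    refine ⟨isAsymptoticallyCircular_of_reverse h1, fun τ hτ => ?_⟩
    have := h2 (-τ) (mem_reverse_J.2 (by simpa using hτ))
    simpa [reverse_r] using this

/-- An unbounded orbit without turning point is asymptotically circular or crosses the horizon. -/
theorem IsOrbit.isAsymptoticallyCircular_of_not_horizonCrossing (h : γ.IsOrbit L E)
    (hhc : ¬ γ.IsHorizonCrossing) (hv : ∀ τ ∈ γ.J, deriv γ.r τ ≠ 0) :
    γ.IsAsymptoticallyCircular := by
  obtain ⟨s, hs⟩ := γ.nonempty_J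
  rcases h.v_pos_or_neg hv with hv | hv
  · refine isAsymptoticallyCircular_of_reverse
      (h.reverse.isAsymptoticallyCircular_of_ingoing (s := -s)
        (fun hc => hhc (isHorizonCrossing_reverse.1 hc))
        (mem_reverse_J.2 (by simpa using hs)) fun τ hτ _ => ?_)
    rw [deriv_reverse_r]
    exact neg_neg_of_pos (hv _ hτ)
  · exact h.isAsymptoticallyCircular_of_ingoing hhc hs fun τ hτ _ => hv τ hτ

/-! ### Orbits with a single turning instant -/

theorem exists_gt_mem_J {s : ℝ} (hs : s ∈ γ.J) : ∃ τ ∈ γ.J, s < τ := by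
  have h1 : ∀ᶠ τ in 𝓝[>] s, τ ∈ γ.J := mem_nhdsWithin_of_mem_nhds (γ.isOpen_J.mem_nhds hs)
  exact (h1.and self_mem_nhdsWithin).exists

theorem exists_lt_mem_J {s : ℝ} (hs : s ∈ γ.J) : ∃ τ ∈ γ.J, τ < s := by
  have h1 : ∀ᶠ τ in 𝓝[<] s, τ ∈ γ.J := mem_nhdsWithin_of_mem_nhds (γ.isOpen_J.mem_nhds hs)
  exact (h1.and self_mem_nhdsWithin).exists

theorem IsOrbit.v_neg_after (h : γ.IsOrbit L E) {s : ℝ} (hs : s ∈ γ.J)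
    (hv : deriv γ.r s = 0) (hF : radialForce M L (γ.r s) < 0)
    (hne : ∀ τ ∈ γ.J, s < τ → deriv γ.r τ ≠ 0) : ∀ τ ∈ γ.J, s < τ → deriv γ.r τ < 0 := by
  rcases pos_or_neg_of_ne_zero (γ.ordConnected_J.inter (ordConnected_Ioi (a := s)))
    (h.continuousOn_v.mono inter_subset_left) (fun x hx => hne x hx.1 hx.2) with h1 | h1
  · obtain ⟨τ, hτ, hsτ⟩ := exists_gt_mem_J hs
    have := h.strictMonoOn_after (s := s) (fun x hx hsx => h1 x ⟨hx, hsx⟩) ⟨hs, self_mem_Ici⟩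
      ⟨hτ, hsτ.le⟩ hsτ
    exact absurd (h.le_of_turning hs hv hF hτ) (not_le.2 this)
  · exact fun τ hτ hsτ => h1 τ ⟨hτ, hsτ⟩

theorem IsOrbit.v_pos_after (h : γ.IsOrbit L E) {s : ℝ} (hs : s ∈ γ.J)
    (hv : deriv γ.r s = 0) (hF : 0 < radialForce M L (γ.r s))
    (hne : ∀ τ ∈ γ.J, s < τ → deriv γ.r τ ≠ 0) : ∀ τ ∈ γ.J, s < τ → 0 < deriv γ.r τ := by
  rcases pos_or_neg_of_ne_zero (γ.ordConnected_J.inter (ordConnected_Ioi (a := s)))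
    (h.continuousOn_v.mono inter_subset_left) (fun x hx => hne x hx.1 hx.2) with h1 | h1
  · exact fun τ hτ hsτ => h1 τ ⟨hτ, hsτ⟩
  · obtain ⟨τ, hτ, hsτ⟩ := exists_gt_mem_J hs
    have := h.strictAntiOn_after (s := s) (fun x hx hsx => h1 x ⟨hx, hsx⟩) ⟨hs, self_mem_Ici⟩
      ⟨hτ, hsτ.le⟩ hsτ
    exact absurd (h.ge_of_turning hs hv hF hτ) (not_le.2 this)

theorem IsOrbit.v_pos_before (h : γ.IsOrbit L E) {s : ℝ} (hs : s ∈ γ.J)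
    (hv : deriv γ.r s = 0) (hF : radialForce M L (γ.r s) < 0)
    (hne : ∀ τ ∈ γ.J, τ < s → deriv γ.r τ ≠ 0) : ∀ τ ∈ γ.J, τ < s → 0 < deriv γ.r τ := by
  intro τ hτ hlt
  have := h.reverse.v_neg_after (s := -s) (mem_reverse_J.2 (by simpa using hs))
    (by simpa [deriv_reverse_r] using hv) (by simpa [reverse_r] using hF)
    (fun x hx hlt => by
      rw [deriv_reverse_r]
      exact neg_ne_zero.2 (hne (-x) hx (by linarith))) (-τ)
    (mem_reverse_J.2 (by simpa using hτ)) (by linarith)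
  simpa [deriv_reverse_r] using this

theorem IsOrbit.v_neg_before (h : γ.IsOrbit L E) {s : ℝ} (hs : s ∈ γ.J)
    (hv : deriv γ.r s = 0) (hF : 0 < radialForce M L (γ.r s))
    (hne : ∀ τ ∈ γ.J, τ < s → deriv γ.r τ ≠ 0) : ∀ τ ∈ γ.J, τ < s → deriv γ.r τ < 0 := by
  intro τ hτ hlt
  have := h.reverse.v_pos_after (s := -s) (mem_reverse_J.2 (by simpa using hs))
    (by simpa [deriv_reverse_r] using hv) (by simpa [reverse_r] using hF)
    (fun x hx hlt => by
      rw [deriv_reverse_r]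
      exact neg_ne_zero.2 (hne (-x) hx (by linarith))) (-τ)
    (mem_reverse_J.2 (by simpa using hτ)) (by linarith)
  simpa [deriv_reverse_r] using this

/-- A bounded orbit that is not elliptic-like has no periapsis: beyond it the orbit would have to
approach a double root of the potential. -/
theorem IsOrbit.force_neg_of_bounded (h : γ.IsOrbit L E) (hell : ¬ γ.IsEllipticLike)
    (hb : γ.IsBounded) {s : ℝ} (hs : s ∈ γ.J) (hv : deriv γ.r s = 0) :
    radialForce M L (γ.r s) < 0 := by
  rcases lt_or_gt_of_ne (h.force_ne_zero hs hv) with hF | hF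
  · exact hF
  · have hne : ∀ τ ∈ γ.J, s < τ → deriv γ.r τ ≠ 0 := fun τ hτ hsτ hv' =>
      hsτ.ne (h.turning_unique hell hs hτ hv hv')
    have hpos := h.v_pos_after hs hv hF hne
    obtain ⟨c, hc, hsc, -⟩ := h.exists_doubleRoot_of_outgoing hb hs hpos
    obtain ⟨τ, hτ, hsτ⟩ := exists_gt_mem_J hs
    exact (hc.not_lt_of_radialSq_eq_zero h.M_pos h.L_ne (γ.r_pos s hs) (h.radialSq_eq_zero hs hv)
      (h.strictMonoOn_after hpos ⟨hs, self_mem_Ici⟩ ⟨hτ, hsτ.le⟩ hsτ) hsc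
      (h.radialSq_pos hτ (hne τ hτ hsτ))).elim

theorem IsOrbit.force_pos_of_unbounded (h : γ.IsOrbit L E) (hb : ¬ γ.IsBounded) {s : ℝ}
    (hs : s ∈ γ.J) (hv : deriv γ.r s = 0) : 0 < radialForce M L (γ.r s) := by
  rcases lt_or_gt_of_ne (h.force_ne_zero hs hv) with hF | hF
  · refine (hb ⟨γ.r s, ?_⟩).elim
    rintro _ ⟨τ, hτ, rfl⟩
    exact h.le_of_turning hs hv hF hτ
  · exact hF

theorem IsEllipticLike.isBounded (hell : γ.IsEllipticLike) : γ.IsBounded := by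
  obtain ⟨a, b, -, -, h⟩ := hell
  unfold IsBounded
  rw [h]
  exact bddAbove_Icc

theorem IsEllipticLike.not_isHorizonCrossing (hell : γ.IsEllipticLike) :
    ¬ γ.IsHorizonCrossing := by
  obtain ⟨a, b, ha, -, h⟩ := hell
  rintro ⟨τ, hτ, hr⟩
  have : γ.r τ ∈ Icc a b := h ▸ ⟨τ, hτ, rfl⟩
  linarith [this.1]

theorem IsEllipticLike.not_globalCase (hell : γ.IsEllipticLike) (u₀ : ℝ) : ¬ γ.GlobalCase u₀ := by
  rintro (⟨-, h | h⟩ | ⟨-, h, -⟩ | ⟨h, -⟩)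
  · exact h hell.isBounded
  · exact h.2 hell
  · exact h hell.isBounded
  · exact hell.not_isHorizonCrossing h.2

theorem IsOrbit.deriv_deriv_r (h : γ.IsOrbit L E) {τ : ℝ} (hτ : τ ∈ γ.J) :
    deriv (deriv γ.r) τ = radialForce M L (γ.r τ) := (h.velocity τ hτ).deriv

/-- In the global cases the orbit has no turning point, or a single one which is the zero point. -/
theorem IsOrbit.globalCase_cases (h : γ.IsOrbit L E) {u₀ : ℝ} (hg : γ.GlobalCase u₀) :
    ¬ γ.IsEllipticLike ∧ (γ.IsTP u₀ ∨ ∀ τ ∈ γ.J, deriv γ.r τ ≠ 0) := by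
  refine ⟨fun hell => hell.not_globalCase u₀ hg, ?_⟩
  rcases hg with ⟨hTP, -⟩ | ⟨-, hub, hend⟩ | ⟨hHP, hub | ⟨-, hac⟩⟩
  · exact Or.inl hTP
  · exact Or.inr fun τ hτ => h.v_ne_zero_of_unbounded hub hend hτ
  · exact Or.inr fun τ hτ => h.v_ne_zero_of_unbounded hub (Or.inr hHP.2) hτ
  · exact Or.inr fun τ hτ => h.v_ne_zero_of_horizonCrossing hHP.2 hac hτ

/-- In the remaining cases there is a turning point different from the zero point. -/
theorem IsOrbit.exists_turning (h : γ.IsOrbit L E) (hell : ¬ γ.IsEllipticLike) {u₀ : ℝ}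
    (hu₀ : γ.IsTP u₀ ∨ γ.IsIP u₀ ∨ γ.IsHP u₀) (hg : ¬ γ.GlobalCase u₀) :
    ¬ γ.IsTP u₀ ∧ ∃ s ∈ γ.J, deriv γ.r s = 0 := by
  have hTP : ¬ γ.IsTP u₀ := by
    intro hTP
    refine hg (Or.inl ⟨hTP, ?_⟩)
    by_cases hb : γ.IsBounded
    · exact Or.inr ⟨hb, hell⟩
    · exact Or.inl hb
  refine ⟨hTP, ?_⟩
  by_contra hno
  push Not at hno
  rcases hu₀ with hTP' | hIP | hHP
  · exact hTP hTP'
  · by_cases hb : γ.IsBounded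
    · obtain ⟨τ, hτ, -, hF⟩ := hIP
      rw [h.deriv_deriv_r hτ] at hF
      exact (h.isAsymptoticallyCircular_of_bounded hb hno).2 τ hτ hF
    · refine hg (Or.inr (Or.inl ⟨hIP, hb, ?_⟩))
      by_cases hhc : γ.IsHorizonCrossing
      · exact Or.inr hhc
      · exact Or.inl (h.isAsymptoticallyCircular_of_not_horizonCrossing hhc hno)
  · refine hg (Or.inr (Or.inr ⟨hHP, ?_⟩))
    by_cases hb : γ.IsBounded
    · exact Or.inr ⟨hb, (h.isAsymptoticallyCircular_of_bounded hb hno).1⟩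
    · exact Or.inl hb

end TimelikeGeodesic

/-! ### Quadratures along a monotone arc -/

theorem integral_comp_of_deriv_pos {G u u' θ θ' : ℝ → ℝ} {a b c : ℝ} (hab : a ≤ b)
    (hu : ∀ x ∈ Icc a b, HasDerivAt u (u' x) x) (hθ : ∀ x ∈ Icc a b, HasDerivAt θ (θ' x) x)
    (hθc : ContinuousOn θ' (Icc a b)) (hpos : ∀ x ∈ Ioo a b, 0 < u' x)
    (hG : ∀ x ∈ Ioo a b, G (u x) * u' x = c * θ' x) :
    IntervalIntegrable G volume (u a) (u b) ∧ ∫ x in u a..u b, G x = c * (θ b - θ a) := by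
  have huc : ContinuousOn u (Icc a b) := fun x hx => (hu x hx).continuousAt.continuousWithinAt
  have hmono : StrictMonoOn u (Icc a b) :=
    strictMonoOn_of_deriv_pos (convex_Icc a b) huc fun x hx => by
      rw [interior_Icc] at hx
      rw [(hu x (Ioo_subset_Icc_self hx)).deriv]
      exact hpos x hx
  have hle : u a ≤ u b := hmono.monotoneOn (left_mem_Icc.2 hab) (right_mem_Icc.2 hab) hab
  have himg : u '' Ioo a b = Ioo (u a) (u b) := by
    refine Subset.antisymm ?_ (intermediate_value_Ioo hab huc)
    rintro _ ⟨x, hx, rfl⟩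
    exact ⟨hmono (left_mem_Icc.2 hab) (Ioo_subset_Icc_self hx) hx.1,
      hmono (Ioo_subset_Icc_self hx) (right_mem_Icc.2 hab) hx.2⟩
  have hder : ∀ x ∈ Ioo a b, HasDerivWithinAt u (u' x) (Ioo a b) x :=
    fun x hx => (hu x (Ioo_subset_Icc_self hx)).hasDerivWithinAt
  have hinj : InjOn u (Ioo a b) := hmono.injOn.mono Ioo_subset_Icc_self
  have heq : EqOn (fun x => |u' x| • G (u x)) (fun x => c * θ' x) (Ioo a b) := by
    intro x hx
    simp only [abs_of_pos (hpos x hx), smul_eq_mul, ← hG x hx, mul_comm]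
  have hint : IntervalIntegrable (fun x => c * θ' x) volume a b :=
    (continuousOn_const.mul (by rwa [uIcc_of_le hab])).intervalIntegrable
  constructor
  · rw [intervalIntegrable_iff_integrableOn_Ioo_of_le hle, ← himg,
      integrableOn_image_iff_integrableOn_abs_deriv_smul measurableSet_Ioo hder hinj,
      integrableOn_congr_fun heq measurableSet_Ioo,
      ← intervalIntegrable_iff_integrableOn_Ioo_of_le hab]
    exact hint
  · rw [intervalIntegral.integral_of_le hle, integral_Ioc_eq_integral_Ioo, ← himg,
      integral_image_eq_integral_abs_deriv_smul measurableSet_Ioo hder hinj,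
      setIntegral_congr_fun measurableSet_Ioo heq, ← integral_Ioc_eq_integral_Ioo,
      ← intervalIntegral.integral_of_le hab, mul_sub]
    exact intervalIntegral.integral_eq_sub_of_hasDerivAt (f := fun x => c * θ x)
      (fun x hx => (hθ x (by rwa [uIcc_of_le hab] at hx)).const_mul c) hint

/-- Change of variables in a quadrature: integrability is not assumed but obtained. -/
theorem integral_comp_of_deriv_ne_zero {G u u' θ θ' : ℝ → ℝ} {a b c : ℝ} (hab : a ≤ b)
    (hu : ∀ x ∈ Icc a b, HasDerivAt u (u' x) x) (hθ : ∀ x ∈ Icc a b, HasDerivAt θ (θ' x) x)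
    (hθc : ContinuousOn θ' (Icc a b))
    (hsign : (∀ x ∈ Ioo a b, 0 < u' x) ∨ ∀ x ∈ Ioo a b, u' x < 0)
    (hG : ∀ x ∈ Ioo a b, G (u x) * u' x = c * θ' x) :
    IntervalIntegrable G volume (u a) (u b) ∧ ∫ x in u a..u b, G x = c * (θ b - θ a) := by
  rcases hsign with hpos | hneg
  · exact integral_comp_of_deriv_pos hab hu hθ hθc hpos hG
  · obtain ⟨h1, h2⟩ := integral_comp_of_deriv_pos (G := fun x => -G (-x)) (u := fun x => -u x)
      (u' := fun x => -u' x) (c := c) hab (fun x hx => (hu x hx).neg) hθ hθc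
      (fun x hx => neg_pos.2 (hneg x hx)) (fun x hx => by simp [hG x hx])
    constructor
    · have := h1.neg.comp_mul_left (c := -1)
      simpa using this
    · rw [← h2, intervalIntegral.integral_neg, intervalIntegral.integral_comp_neg, neg_neg,
        neg_neg, intervalIntegral.integral_symm]

theorem sign_mul_abs_self (x : ℝ) : Real.sign x * |x| = x := by
  rcases lt_trichotomy x 0 with h | rfl | h
  · rw [Real.sign_of_neg h, abs_of_neg h]
    ring
  · simp
  · rw [Real.sign_of_pos h, abs_of_pos h]
    ring

theorem sign_mul_eq (x y : ℝ) : Real.sign (x * y) = Real.sign x * Real.sign y := by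
  rcases lt_trichotomy x 0 with hx | rfl | hx <;> rcases lt_trichotomy y 0 with hy | rfl | hy
  · rw [Real.sign_of_neg hx, Real.sign_of_neg hy, Real.sign_of_pos (mul_pos_of_neg_of_neg hx hy)]
    ring
  · simp
  · rw [Real.sign_of_neg hx, Real.sign_of_pos hy, Real.sign_of_neg (mul_neg_of_neg_of_pos hx hy)]
    ring
  · simp
  · simp
  · simp
  · rw [Real.sign_of_pos hx, Real.sign_of_neg hy, Real.sign_of_neg (mul_neg_of_pos_of_neg hx hy)]
    ring
  · simp
  · rw [Real.sign_of_pos hx, Real.sign_of_pos hy, Real.sign_of_pos (mul_pos hx hy)]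
    ring

theorem extIntegral_eq {f : ℝ → ℝ} {a b : ℝ} (hf : IntervalIntegrable f volume a b)
    (h0 : ∀ x ∈ uIoc a b, 0 ≤ f x) :
    extIntegral f a b = ((∫ x in a..b, f x : ℝ) : EReal) := by
  have key : ∀ {a b : ℝ}, a ≤ b → IntervalIntegrable f volume a b → (∀ x ∈ Ioc a b, 0 ≤ f x) →
      ((∫⁻ x in Ioc a b, ENNReal.ofReal (f x) : ENNReal) : EReal)
        = ((∫ x in a..b, f x : ℝ) : EReal) := by
    intro a b hab hf h0
    rw [intervalIntegral.integral_of_le hab, ← ofReal_integral_eq_lintegral_ofReal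
      ((intervalIntegrable_iff_integrableOn_Ioc_of_le hab).1 hf)
      (ae_restrict_of_forall_mem measurableSet_Ioc h0), EReal.coe_ennreal_ofReal,
      max_eq_left (setIntegral_nonneg measurableSet_Ioc h0)]
  unfold extIntegral
  split_ifs with hab
  · exact key hab hf (by rwa [uIoc_of_le hab] at h0)
  · have hba := (not_le.1 hab).le
    rw [key hba hf.symm (by rwa [uIoc_of_ge hba] at h0), intervalIntegral.integral_symm b a]
    simp

theorem timeIntegrand_nonneg {Lb E u : ℝ} (hu : u ≤ 1) : 0 ≤ timeIntegrand Lb E u := by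
  have : 0 ≤ 1 - u := by linarith
  unfold timeIntegrand
  positivity

/-- The coordinate-time quadrature diverges like `∫ du / (1 - u)` at the horizon. -/
theorem extIntegral_timeIntegrand_one {Lb E u : ℝ} (hL : Lb ≠ 0) (hE : E ≠ 0) (hu1 : u < 1) :
    extIntegral (timeIntegrand Lb E) 1 u = ⊥ := by
  have hmeas : Measurable (timeIntegrand Lb E) := by
    unfold timeIntegrand cubicQ
    fun_prop
  have hQ : Continuous (cubicQ Lb E) := by
    unfold cubicQ
    fun_prop
  have hQ1 : 0 < cubicQ Lb E 1 := by
    have : cubicQ Lb E 1 = E ^ 2 / Lb ^ 2 := by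
      unfold cubicQ
      ring
    rw [this]
    positivity
  have hO : (fun x => (x - 1)⁻¹) =O[𝓝[≠] 1] timeIntegrand Lb E := by
    have h1 : ∀ᶠ x in 𝓝 (1 : ℝ), |x ^ 2 * √(cubicQ Lb E x)| ≤ |1 ^ 2 * √(cubicQ Lb E 1)| + 1 := by
      have hc : Continuous fun x => |x ^ 2 * √(cubicQ Lb E x)| := by fun_prop
      exact (hc.continuousAt.eventually_lt_const (lt_add_one _)).mono fun x hx => hx.le
    have h2 : ∀ᶠ x in 𝓝 (1 : ℝ), 0 < cubicQ Lb E x := hQ.continuousAt.eventually_const_lt hQ1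
    have h3 : ∀ᶠ x in 𝓝 (1 : ℝ), 0 < x := eventually_gt_nhds one_pos
    refine Asymptotics.IsBigO.of_bound (|1 ^ 2 * √(cubicQ Lb E 1)| + 1) ?_
    filter_upwards [h1.filter_mono nhdsWithin_le_nhds, h2.filter_mono nhdsWithin_le_nhds,
      h3.filter_mono nhdsWithin_le_nhds, self_mem_nhdsWithin] with x hx1 hx2 hx3 hx4
    have hx5 : x - 1 ≠ 0 := sub_ne_zero.2 hx4
    have hx6 : 1 - x ≠ 0 := sub_ne_zero.2 (Ne.symm hx4)
    have hs := Real.sqrt_pos.2 hx2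
    have heq : (x - 1)⁻¹ = -(x ^ 2 * √(cubicQ Lb E x)) * timeIntegrand Lb E x := by
      have h7 : x - 1 = -(1 - x) := by ring
      unfold timeIntegrand
      rw [h7, inv_neg]
      field_simp
    rw [heq, norm_mul, norm_neg]
    exact mul_le_mul_of_nonneg_right hx1 (norm_nonneg _)
  have hnot := not_intervalIntegrable_of_sub_inv_isBigO_punctured hO hu1.ne right_mem_uIcc
  have htop : ∫⁻ x in Ioc u 1, ENNReal.ofReal (timeIntegrand Lb E x) = ⊤ := by
    by_contra hne
    refine hnot ((intervalIntegrable_iff_integrableOn_Ioc_of_le hu1.le).2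
      ⟨hmeas.aestronglyMeasurable, ?_⟩)
    rw [hasFiniteIntegral_iff_ofReal (ae_restrict_of_forall_mem measurableSet_Ioc
      fun x hx => timeIntegrand_nonneg hx.2)]
    exact lt_top_iff_ne_top.2 hne
  unfold extIntegral
  rw [if_neg (not_le.2 hu1), htop]
  simp

namespace TimelikeGeodesic

variable {M : ℝ} {γ : TimelikeGeodesic M} {L E : ℝ}

/-- The instants outside the horizon. -/
def outerTimes (γ : TimelikeGeodesic M) : Set ℝ := {τ ∈ γ.J | 2 * M < γ.r τ}

theorem hasDerivAt_u (h : γ.IsOrbit L E) {τ : ℝ} (hτ : τ ∈ γ.J) :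
    HasDerivAt γ.u (-(2 * M * deriv γ.r τ / γ.r τ ^ 2)) τ := by
  have h0 := (γ.r_pos τ hτ).ne'
  refine ((hasDerivAt_const τ (2 * M)).div (h.radius τ hτ) h0).congr_deriv ?_
  ring

theorem u_lt_one_iff {τ : ℝ} (hτ : τ ∈ γ.J) : γ.u τ < 1 ↔ 2 * M < γ.r τ :=
  div_lt_one (γ.r_pos τ hτ)

theorem sqrt_cubicQ (h : γ.IsOrbit L E) {τ : ℝ} (hτ : τ ∈ γ.J) :
    √(cubicQ (L / (2 * M)) E (γ.u τ)) = |deriv γ.r τ| / |L / (2 * M)| := by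
  have h1 : L / (2 * M) ≠ 0 := div_ne_zero h.L_ne (by linarith [h.M_pos])
  have h2 : cubicQ (L / (2 * M)) E (γ.u τ) = (deriv γ.r τ / (L / (2 * M))) ^ 2 := by
    rw [div_pow, h.sq_velocity τ hτ, radialSq_eq_cubicQ h.M_pos.ne' h.L_ne (γ.r_pos τ hτ).ne',
      mul_div_cancel_left₀ _ (pow_ne_zero 2 h1)]
    rfl
  rw [h2, Real.sqrt_sq_eq_abs, abs_div]

/-- A function `θ` on the set `S` of proper times which grows along monotone arcs of the orbit like
a multiple of the quadrature with integrand `G`; the factor is `1 / κ` up to the sign of the radial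
velocity.  The angle, the coordinate time outside the horizon, and the proper time are such
functions. -/
structure IsClock (γ : TimelikeGeodesic M) (S : Set ℝ) (G θ θ' : ℝ → ℝ) (κ : ℝ) : Prop where
  subset : S ⊆ γ.J
  hasDerivAt : ∀ τ ∈ S, HasDerivAt θ (θ' τ) τ
  continuousOn : ContinuousOn θ' S
  ne_zero : ∀ τ ∈ S, θ' τ ≠ 0
  factor_ne : κ ≠ 0
  eq : ∀ τ ∈ S, deriv γ.r τ ≠ 0 →
    κ * (G (γ.u τ) * -(2 * M * deriv γ.r τ / γ.r τ ^ 2)) = -Real.sign (deriv γ.r τ) * θ' τ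

theorem IsOrbit.isClock_angle (h : γ.IsOrbit L E) :
    γ.IsClock γ.J (angIntegrand (L / (2 * M)) E) γ.φ (fun τ => L / γ.r τ ^ 2)
      (Real.sign (L / (2 * M))) where
  subset := Subset.rfl
  hasDerivAt := h.angle
  continuousOn := continuousOn_const.div (h.continuousOn_r.pow 2) fun τ hτ =>
    pow_ne_zero 2 (γ.r_pos τ hτ).ne'
  ne_zero τ hτ := div_ne_zero h.L_ne (pow_ne_zero 2 (γ.r_pos τ hτ).ne')
  factor_ne := by
    rw [Ne, Real.sign_eq_zero_iff]
    exact div_ne_zero h.L_ne (by linarith [h.M_pos])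
  eq τ hτ hv := by
    have h1 := h.M_pos.ne'
    have h2 := (γ.r_pos τ hτ).ne'
    have h3 := abs_ne_zero.2 hv
    have h4 : |L / (2 * M)| ≠ 0 := abs_ne_zero.2 (div_ne_zero h.L_ne (by linarith [h.M_pos]))
    have h5 : L = 2 * M * (Real.sign (L / (2 * M)) * |L / (2 * M)|) := by
      rw [sign_mul_abs_self]
      field_simp
    have h6 := sign_mul_abs_self (deriv γ.r τ)
    unfold angIntegrand
    rw [sqrt_cubicQ h hτ]
    generalize Real.sign (L / (2 * M)) = sl at *
    generalize |L / (2 * M)| = al at *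
    generalize Real.sign (deriv γ.r τ) = sv at *
    generalize |deriv γ.r τ| = av at *
    rw [h5, ← h6]
    field_simp

theorem IsOrbit.isClock_proper (h : γ.IsOrbit L E) :
    γ.IsClock γ.J (properIntegrand (L / (2 * M)) E) (fun τ => τ / (2 * M)) (fun _ => 1 / (2 * M))
      (1 / |L / (2 * M)|) where
  subset := Subset.rfl
  hasDerivAt τ _ := (hasDerivAt_id τ).div_const (2 * M)
  continuousOn := continuousOn_const
  ne_zero τ _ := by
    have := h.M_pos
    positivity
  factor_ne := one_div_ne_zero (abs_ne_zero.2 (div_ne_zero h.L_ne (by linarith [h.M_pos])))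
  eq τ hτ hv := by
    have h1 := h.M_pos.ne'
    have h2 := (γ.r_pos τ hτ).ne'
    have h3 := abs_ne_zero.2 hv
    have h4 : |L / (2 * M)| ≠ 0 := abs_ne_zero.2 (div_ne_zero h.L_ne (by linarith [h.M_pos]))
    have h6 := sign_mul_abs_self (deriv γ.r τ)
    unfold properIntegrand
    rw [sqrt_cubicQ h hτ]
    unfold u
    generalize |L / (2 * M)| = al at *
    generalize Real.sign (deriv γ.r τ) = sv at *
    generalize |deriv γ.r τ| = av at *
    rw [← h6]
    field_simp

theorem IsOrbit.isClock_time (h : γ.IsOrbit L E) :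
    γ.IsClock γ.outerTimes (timeIntegrand (L / (2 * M)) E) (fun τ => γ.t τ / (2 * M))
      (fun τ => E * γ.r τ / (γ.r τ - 2 * M) / (2 * M)) (E / |L / (2 * M)|) where
  subset _ hτ := hτ.1
  hasDerivAt τ hτ := (h.time τ hτ.1 hτ.2.ne').div_const (2 * M)
  continuousOn := by
    have hr : ContinuousOn γ.r γ.outerTimes := h.continuousOn_r.mono fun τ hτ => hτ.1
    exact ((continuousOn_const.mul hr).div (hr.sub continuousOn_const) fun τ hτ =>
      (sub_pos.2 hτ.2).ne').div_const _
  ne_zero τ hτ := by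
    have h1 := γ.r_pos τ hτ.1
    have h2 := sub_pos.2 hτ.2
    have h3 := h.M_pos
    have h4 := h.E_ne
    positivity
  factor_ne := div_ne_zero h.E_ne
    (abs_ne_zero.2 (div_ne_zero h.L_ne (by linarith [h.M_pos])))
  eq τ hτ hv := by
    have h1 := h.M_pos.ne'
    have h2 := (γ.r_pos τ hτ.1).ne'
    have h3 := abs_ne_zero.2 hv
    have h4 : |L / (2 * M)| ≠ 0 := abs_ne_zero.2 (div_ne_zero h.L_ne (by linarith [h.M_pos]))
    have h6 := sign_mul_abs_self (deriv γ.r τ)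
    have h7 : γ.r τ - 2 * M ≠ 0 := (sub_pos.2 hτ.2).ne'
    have h8 : 1 - 2 * M / γ.r τ = (γ.r τ - 2 * M) / γ.r τ := by field_simp
    unfold timeIntegrand
    rw [sqrt_cubicQ h hτ.1]
    unfold u
    rw [h8]
    generalize |L / (2 * M)| = al at *
    generalize Real.sign (deriv γ.r τ) = sv at *
    generalize |deriv γ.r τ| = av at *
    generalize γ.r τ - 2 * M = d at *
    rw [← h6]
    field_simp

variable {S : Set ℝ} {G θ θ' : ℝ → ℝ} {κ : ℝ}

/-- Along an arc on which the radial velocity has the sign `σ`, the quadrature measures `θ`. -/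
theorem IsClock.integral_eq (hc : γ.IsClock S G θ θ' κ) (h : γ.IsOrbit L E) {s τ σ : ℝ}
    (hS : uIcc s τ ⊆ S) (hσ0 : σ ≠ 0) (hσ : ∀ x ∈ uIoo s τ, Real.sign (deriv γ.r x) = σ) :
    IntervalIntegrable G volume (γ.u s) (γ.u τ) ∧
      κ * ∫ x in γ.u s..γ.u τ, G x = -σ * (θ τ - θ s) := by
  have key : ∀ {s τ : ℝ}, s ≤ τ → uIcc s τ ⊆ S →
      (∀ x ∈ uIoo s τ, Real.sign (deriv γ.r x) = σ) →
      IntervalIntegrable G volume (γ.u s) (γ.u τ) ∧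
        ∫ x in γ.u s..γ.u τ, G x = -σ / κ * (θ τ - θ s) := by
    intro s τ hle hS hσ
    rw [uIcc_of_le hle] at hS
    rw [uIoo_of_le hle] at hσ
    have hne : ∀ x ∈ Ioo s τ, deriv γ.r x ≠ 0 := by
      intro x hx h0
      have := hσ x hx
      rw [h0, Real.sign_zero] at this
      exact hσ0 this.symm
    refine integral_comp_of_deriv_ne_zero (u' := fun x => -(2 * M * deriv γ.r x / γ.r x ^ 2)) hle
      (fun x hx => hasDerivAt_u h (hc.subset (hS hx))) (fun x hx => hc.hasDerivAt x (hS hx))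
      (hc.continuousOn.mono hS) ?_ ?_
    · have hsub : Ioo s τ ⊆ γ.J := fun x hx => hc.subset (hS (Ioo_subset_Icc_self hx))
      have hfac : ∀ x ∈ Ioo s τ, 0 < 2 * M / γ.r x ^ 2 := fun x hx =>
        div_pos (by linarith [h.M_pos]) (pow_pos (γ.r_pos x (hsub hx)) 2)
      rcases pos_or_neg_of_ne_zero ordConnected_Ioo (h.continuousOn_v.mono hsub) hne with h1 | h1
      · refine Or.inr fun x hx => ?_
        have := mul_pos (hfac x hx) (h1 x hx)
        rw [neg_lt_zero, mul_div_right_comm]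
        exact this
      · refine Or.inl fun x hx => ?_
        have := mul_pos (hfac x hx) (neg_pos.2 (h1 x hx))
        rw [← mul_neg_one, mul_div_right_comm]
        linarith
    · intro x hx
      have := hc.eq x (hS (Ioo_subset_Icc_self hx)) (hne x hx)
      rw [hσ x hx] at this
      have hk := hc.factor_ne
      rw [div_mul_eq_mul_div, eq_div_iff hk]
      linarith
  have hk := hc.factor_ne
  rcases le_total s τ with hle | hle
  · obtain ⟨h1, h2⟩ := key hle hS hσ
    refine ⟨h1, ?_⟩
    rw [h2]
    field_simp
  · obtain ⟨h1, h2⟩ := key hle (by rwa [uIcc_comm]) (by rwa [uIoo_comm])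
    refine ⟨h1.symm, ?_⟩
    rw [intervalIntegral.integral_symm, h2]
    field_simp
    ring

theorem IsClock.apply_ne (hc : γ.IsClock S G θ θ' κ) {s τ : ℝ} (hS : uIcc s τ ⊆ S)
    (hne : s ≠ τ) : θ τ - θ s ≠ 0 := by
  have key : ∀ {s τ : ℝ}, s < τ → uIcc s τ ⊆ S → θ s ≠ θ τ := by
    intro s τ hlt hS heq
    rw [uIcc_of_le hlt.le] at hS
    obtain ⟨x, hx, hx0⟩ := exists_hasDerivAt_eq_zero hlt
      (fun y hy => (hc.hasDerivAt y (hS hy)).continuousAt.continuousWithinAt) heq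
      (fun y hy => hc.hasDerivAt y (hS (Ioo_subset_Icc_self hy)))
    exact hc.ne_zero x (hS (Ioo_subset_Icc_self hx)) hx0
  intro h0
  rcases lt_or_gt_of_ne hne with hlt | hlt
  · exact key hlt hS (by linarith)
  · exact key hlt (by rwa [uIcc_comm]) (by linarith)

/-- The integral of motion has the same value along a whole arc on which the radial velocity has
the sign `σ`; an end of the arc at which the velocity vanishes is included if it is at the zero
point. -/
theorem IsClock.quantity_eq (hc : γ.IsClock S G θ θ' κ) (h : γ.IsOrbit L E) {u₀ s τ σ : ℝ}
    (hS : uIcc s τ ⊆ S) (hσ0 : σ ≠ 0) (hσ : ∀ x ∈ uIoo s τ, Real.sign (deriv γ.r x) = σ)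
    (hσσ : σ * σ = 1) (hτ : Real.sign (deriv γ.r τ) = σ ∨ γ.u τ = u₀)
    (hint : IntervalIntegrable G volume u₀ (γ.u s)) :
    θ τ + Real.sign (deriv γ.r τ) * (κ * ∫ x in u₀..γ.u τ, G x) =
      θ s + σ * (κ * ∫ x in u₀..γ.u s, G x) := by
  obtain ⟨h1, h2⟩ := hc.integral_eq h hS hσ0 hσ
  have h3 := intervalIntegral.integral_add_adjacent_intervals hint h1
  have h4 : Real.sign (deriv γ.r τ) * (κ * ∫ x in u₀..γ.u τ, G x) =
      σ * (κ * ∫ x in u₀..γ.u τ, G x) := by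
    rcases hτ with hτ | hτ
    · rw [hτ]
    · simp [hτ]
  rw [h4, ← h3, mul_add, mul_add, h2]
  linear_combination (-(θ τ - θ s)) * hσσ

variable {M : ℝ} {γ : TimelikeGeodesic M} {L E : ℝ}

/-! ### Values of the integrals of motion -/

theorem angQuantity_eq (γ : TimelikeGeodesic M) (L E u₀ τ : ℝ) : γ.angQuantity L E u₀ τ =
    γ.φ τ + Real.sign (deriv γ.r τ) *
      (Real.sign (L / (2 * M)) * ∫ x in u₀..γ.u τ, angIntegrand (L / (2 * M)) E x) := by
  unfold angQuantity
  rw [sign_mul_eq, mul_assoc]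

theorem properQuantity_eq (γ : TimelikeGeodesic M) (L E u₀ τ : ℝ) : γ.properQuantity L E u₀ τ =
    τ / (2 * M) + Real.sign (deriv γ.r τ) *
      (1 / |L / (2 * M)| * ∫ x in u₀..γ.u τ, properIntegrand (L / (2 * M)) E x) := by
  unfold properQuantity
  ring

theorem timeQuantity_eq {u₀ τ : ℝ} (hu₀ : u₀ ≤ 1) (hτ : τ ∈ γ.outerTimes)
    (hint : IntervalIntegrable (timeIntegrand (L / (2 * M)) E) volume u₀ (γ.u τ)) :
    γ.timeQuantity L E u₀ τ = ((γ.t τ / (2 * M) + Real.sign (deriv γ.r τ) *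
      (E / |L / (2 * M)| * ∫ x in u₀..γ.u τ, timeIntegrand (L / (2 * M)) E x) : ℝ) : EReal) := by
  unfold timeQuantity
  rw [extIntegral_eq hint, ← EReal.coe_mul, ← EReal.coe_add]
  · congr 1
    ring
  · intro x hx
    exact timeIntegrand_nonneg (hx.2.trans (max_le hu₀ ((u_lt_one_iff hτ.1).2 hτ.2).le))

/-- With the zero point on the horizon the coordinate-time integral is infinite, with a sign
depending on the direction of the radial motion. -/
theorem timeQuantity_one (h : γ.IsOrbit L E) {τ : ℝ} (hτ : τ ∈ γ.outerTimes)
    (hv : deriv γ.r τ ≠ 0) : γ.timeQuantity L E 1 τ =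
      ((Real.sign (deriv γ.r τ) * E : ℝ) : EReal) * ⊥ := by
  have hL : L / (2 * M) ≠ 0 := div_ne_zero h.L_ne (by linarith [h.M_pos])
  have hL' : 0 < |L / (2 * M)| := abs_pos.2 hL
  unfold timeQuantity
  rw [extIntegral_timeIntegrand_one hL h.E_ne ((u_lt_one_iff hτ.1).2 hτ.2)]
  have hne : Real.sign (deriv γ.r τ) * E ≠ 0 :=
    mul_ne_zero (by rwa [Ne, Real.sign_eq_zero_iff]) h.E_ne
  rcases lt_or_gt_of_ne hne with h1 | h1
  · rw [EReal.coe_mul_bot_of_neg h1, EReal.coe_mul_bot_of_neg (div_neg_of_neg_of_pos h1 hL'),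
      EReal.coe_add_top]
  · rw [EReal.coe_mul_bot_of_pos h1, EReal.coe_mul_bot_of_pos (div_pos h1 hL'), EReal.add_bot]

/-- The radial velocity has the sign `σ ≠ 0` strictly between the instants `s` and `τ`. -/
structure IsArc (γ : TimelikeGeodesic M) (s τ σ : ℝ) : Prop where
  left_mem : s ∈ γ.J
  right_mem : τ ∈ γ.J
  sq_sign : σ * σ = 1
  sign_eq : ∀ x ∈ uIoo s τ, Real.sign (deriv γ.r x) = σ

variable {s τ σ u₀ : ℝ}

theorem IsArc.sign_ne_zero (ha : γ.IsArc s τ σ) : σ ≠ 0 := by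
  intro h0
  have := ha.sq_sign
  rw [h0] at this
  norm_num at this

theorem IsArc.symm (ha : γ.IsArc s τ σ) : γ.IsArc τ s σ :=
  ⟨ha.right_mem, ha.left_mem, ha.sq_sign, by
    rw [uIoo_comm]
    exact ha.sign_eq⟩

theorem IsArc.subset (ha : γ.IsArc s τ σ) : uIcc s τ ⊆ γ.J :=
  γ.ordConnected_J.uIcc_subset ha.left_mem ha.right_mem

theorem IsArc.subset_outerTimes (ha : γ.IsArc s τ σ) (h : γ.IsOrbit L E) (hs : 2 * M < γ.r s)
    (hτ : 2 * M < γ.r τ) : uIcc s τ ⊆ γ.outerTimes := by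
  intro x hx
  refine ⟨ha.subset hx, ?_⟩
  have hcont := h.continuousOn_r.mono ha.subset
  rw [← Icc_min_max] at hcont hx
  have hint : interior (Icc (min s τ) (max s τ)) = uIoo s τ := interior_Icc
  have hend : ∀ y, y = min s τ ∨ y = max s τ → 2 * M < γ.r y := by
    rintro y (rfl | rfl)
    · rcases min_choice s τ with h1 | h1 <;> rwa [h1]
    · rcases max_choice s τ with h1 | h1 <;> rwa [h1]
  have hsgn : (∀ x ∈ uIoo s τ, 0 < deriv γ.r x) ∨ ∀ x ∈ uIoo s τ, deriv γ.r x < 0 :=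
    pos_or_neg_of_ne_zero (ordConnected_Ioo (a := min s τ) (b := max s τ))
      (h.continuousOn_v.mono (uIoo_subset_uIcc_self.trans ha.subset)) fun y hy h0 => by
        have := ha.sign_eq y hy
        rw [h0, Real.sign_zero] at this
        exact ha.sign_ne_zero this.symm
  have hl := left_mem_Icc.2 (min_le_max (a := s) (b := τ))
  have hr := right_mem_Icc.2 (min_le_max (a := s) (b := τ))
  rcases hsgn with h1 | h1
  · have := strictMonoOn_of_deriv_pos (convex_Icc _ _) hcont (by rwa [hint])
    exact (hend _ (Or.inl rfl)).trans_le (this.monotoneOn hl hx hx.1)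
  · have := strictAntiOn_of_deriv_neg (convex_Icc _ _) hcont (by rwa [hint])
    exact (hend _ (Or.inr rfl)).trans_le (this.antitoneOn hx hr hx.2)

theorem IsArc.angQuantity_eq (ha : γ.IsArc s τ σ) (h : γ.IsOrbit L E)
    (hτ : Real.sign (deriv γ.r τ) = σ ∨ γ.u τ = u₀)
    (hint : IntervalIntegrable (angIntegrand (L / (2 * M)) E) volume u₀ (γ.u s)) :
    γ.angQuantity L E u₀ τ = γ.φ s + σ * (Real.sign (L / (2 * M)) *
      ∫ x in u₀..γ.u s, angIntegrand (L / (2 * M)) E x) := by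
  rw [TimelikeGeodesic.angQuantity_eq]
  exact h.isClock_angle.quantity_eq h ha.subset ha.sign_ne_zero ha.sign_eq ha.sq_sign hτ hint

theorem IsArc.properQuantity_eq (ha : γ.IsArc s τ σ) (h : γ.IsOrbit L E)
    (hτ : Real.sign (deriv γ.r τ) = σ ∨ γ.u τ = u₀)
    (hint : IntervalIntegrable (properIntegrand (L / (2 * M)) E) volume u₀ (γ.u s)) :
    γ.properQuantity L E u₀ τ = s / (2 * M) + σ * (1 / |L / (2 * M)| *
      ∫ x in u₀..γ.u s, properIntegrand (L / (2 * M)) E x) := by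
  rw [TimelikeGeodesic.properQuantity_eq]
  exact h.isClock_proper.quantity_eq h ha.subset ha.sign_ne_zero ha.sign_eq ha.sq_sign hτ hint

theorem IsArc.timeQuantity_eq (ha : γ.IsArc s τ σ) (h : γ.IsOrbit L E) (hs : 2 * M < γ.r s)
    (hr : 2 * M < γ.r τ) (hu₀ : u₀ ≤ 1) (hτ : Real.sign (deriv γ.r τ) = σ ∨ γ.u τ = u₀)
    (hint : IntervalIntegrable (timeIntegrand (L / (2 * M)) E) volume u₀ (γ.u s)) :
    γ.timeQuantity L E u₀ τ = ((γ.t s / (2 * M) + σ * (E / |L / (2 * M)| *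
      ∫ x in u₀..γ.u s, timeIntegrand (L / (2 * M)) E x) : ℝ) : EReal) := by
  have hsub := ha.subset_outerTimes h hs hr
  rw [TimelikeGeodesic.timeQuantity_eq hu₀ (hsub right_mem_uIcc)
    (hint.trans (h.isClock_time.integral_eq h hsub ha.sign_ne_zero ha.sign_eq).1)]
  exact congrArg _
    (h.isClock_time.quantity_eq h hsub ha.sign_ne_zero ha.sign_eq ha.sq_sign hτ hint)

theorem IsArc.intervalIntegrable (ha : γ.IsArc s τ σ) (h : γ.IsOrbit L E) :
    IntervalIntegrable (angIntegrand (L / (2 * M)) E) volume (γ.u s) (γ.u τ) ∧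
      IntervalIntegrable (properIntegrand (L / (2 * M)) E) volume (γ.u s) (γ.u τ) :=
  ⟨(h.isClock_angle.integral_eq h ha.subset ha.sign_ne_zero ha.sign_eq).1,
    (h.isClock_proper.integral_eq h ha.subset ha.sign_ne_zero ha.sign_eq).1⟩

theorem IsArc.intervalIntegrable_time (ha : γ.IsArc s τ σ) (h : γ.IsOrbit L E)
    (hs : 2 * M < γ.r s) (hr : 2 * M < γ.r τ) :
    IntervalIntegrable (timeIntegrand (L / (2 * M)) E) volume (γ.u s) (γ.u τ) :=
  (h.isClock_time.integral_eq h (ha.subset_outerTimes h hs hr) ha.sign_ne_zero ha.sign_eq).1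

/-- The quadrature along a non-trivial arc does not vanish. -/
theorem IsClock.integral_ne_zero {S : Set ℝ} {G θ θ' : ℝ → ℝ} {κ : ℝ}
    (hc : γ.IsClock S G θ θ' κ) (ha : γ.IsArc s τ σ) (h : γ.IsOrbit L E) (hS : uIcc s τ ⊆ S)
    (hne : s ≠ τ) : κ * ∫ x in γ.u τ..γ.u s, G x ≠ 0 := by
  have h1 := (hc.integral_eq h hS ha.sign_ne_zero ha.sign_eq).2
  rw [intervalIntegral.integral_symm, mul_neg, h1]
  exact neg_ne_zero.2 (mul_ne_zero (neg_ne_zero.2 ha.sign_ne_zero) (hc.apply_ne hS hne))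

/-! ### Orbits with at most one turning instant -/

/-- If the zero point is reached at `s` and every instant is joined to `s` by an arc, then the
integrals of motion are constant. -/
theorem IsOrbit.isGlobal_of_arcs (h : γ.IsOrbit L E) (hs : 2 * M < γ.r s) (hsJ : s ∈ γ.J)
    (harc : ∀ τ ∈ γ.J, ∃ σ, γ.IsArc s τ σ ∧ (Real.sign (deriv γ.r τ) = σ ∨ γ.u τ = γ.u s)) :
    γ.IsGlobal L E (γ.u s) := by
  have hu : γ.u s < 1 := (u_lt_one_iff hsJ).2 hs
  refine ⟨γ.φ s, ((γ.t s / (2 * M) : ℝ) : EReal), s / (2 * M), fun τ hτ => ?_, ?_⟩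
  · obtain ⟨σ, ha, hv⟩ := harc τ hτ
    refine ⟨?_, ?_, fun hr => ?_⟩
    · simpa using ha.angQuantity_eq h hv IntervalIntegrable.refl
    · simpa using ha.properQuantity_eq h hv IntervalIntegrable.refl
    · rw [ha.timeQuantity_eq h hs hr hu.le hv IntervalIntegrable.refl]
      simp
  · constructor
    · rintro (h1 | h1)
      · exact absurd h1 (EReal.coe_ne_top _)
      · exact absurd h1 (EReal.coe_ne_bot _)
    · exact fun h1 => absurd h1 hu.ne

theorem IsOrbit.sign_const (h : γ.IsOrbit L E) (hv : ∀ τ ∈ γ.J, deriv γ.r τ ≠ 0) :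
    ∃ σ : ℝ, σ * σ = 1 ∧ ∀ τ ∈ γ.J, Real.sign (deriv γ.r τ) = σ := by
  rcases h.v_pos_or_neg hv with h1 | h1
  · exact ⟨1, by norm_num, fun τ hτ => Real.sign_of_pos (h1 τ hτ)⟩
  · exact ⟨-1, by norm_num, fun τ hτ => Real.sign_of_neg (h1 τ hτ)⟩

theorem IsOrbit.isGlobal_of_horizon (h : γ.IsOrbit L E) (hs : γ.r s = 2 * M) (hsJ : s ∈ γ.J)
    (hv : ∀ τ ∈ γ.J, deriv γ.r τ ≠ 0) : γ.IsGlobal L E 1 := by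
  obtain ⟨σ, hσ1, hσ⟩ := h.sign_const hv
  have hM := h.M_pos
  have hu : γ.u s = 1 := by
    unfold u
    rw [hs, div_self (by positivity)]
  have hσ0 : σ * E ≠ 0 := mul_ne_zero (by rintro rfl; norm_num at hσ1) h.E_ne
  refine ⟨γ.φ s, ((σ * E : ℝ) : EReal) * ⊥, s / (2 * M), fun τ hτ => ?_, ?_⟩
  · have ha : γ.IsArc s τ σ := ⟨hsJ, hτ, hσ1, fun x hx =>
      hσ x (γ.ordConnected_J.uIcc_subset hsJ hτ (uIoo_subset_uIcc_self hx))⟩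
    rw [← hu]
    refine ⟨?_, ?_, fun hr => ?_⟩
    · simpa using ha.angQuantity_eq h (Or.inl (hσ τ hτ)) IntervalIntegrable.refl
    · simpa using ha.properQuantity_eq h (Or.inl (hσ τ hτ)) IntervalIntegrable.refl
    · rw [hu, timeQuantity_one h ⟨hτ, hr⟩ (hv τ hτ), hσ τ hτ]
  · simp only [iff_true]
    rcases lt_or_gt_of_ne hσ0 with h1 | h1
    · exact Or.inl (EReal.coe_mul_bot_of_neg h1)
    · exact Or.inr (EReal.coe_mul_bot_of_pos h1)

/-- The sign of the radial velocity around the only turning instant. -/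
theorem IsOrbit.sign_turning (h : γ.IsOrbit L E) (hell : ¬ γ.IsEllipticLike) (hs : s ∈ γ.J)
    (hv : deriv γ.r s = 0) : ∃ ε : ℝ, ε * ε = 1 ∧
      (∀ τ ∈ γ.J, s < τ → Real.sign (deriv γ.r τ) = ε) ∧
      (∀ τ ∈ γ.J, τ < s → Real.sign (deriv γ.r τ) = -ε) ∧
      (ε = -1 ∧ radialForce M L (γ.r s) < 0 ∨ ε = 1 ∧ 0 < radialForce M L (γ.r s)) := by
  have hne : ∀ τ ∈ γ.J, s < τ → deriv γ.r τ ≠ 0 := fun τ hτ hlt h0 =>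
    hlt.ne (h.turning_unique hell hs hτ hv h0)
  have hne' : ∀ τ ∈ γ.J, τ < s → deriv γ.r τ ≠ 0 := fun τ hτ hlt h0 =>
    hlt.ne' (h.turning_unique hell hs hτ hv h0)
  rcases lt_or_gt_of_ne (h.force_ne_zero hs hv) with hF | hF
  · refine ⟨-1, by norm_num, fun τ hτ hlt => ?_, fun τ hτ hlt => ?_, Or.inl ⟨rfl, hF⟩⟩
    · exact Real.sign_of_neg (h.v_neg_after hs hv hF hne τ hτ hlt)
    · rw [neg_neg]
      exact Real.sign_of_pos (h.v_pos_before hs hv hF hne' τ hτ hlt)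
  · refine ⟨1, by norm_num, fun τ hτ hlt => ?_, fun τ hτ hlt => ?_, Or.inr ⟨rfl, hF⟩⟩
    · exact Real.sign_of_pos (h.v_pos_after hs hv hF hne τ hτ hlt)
    · exact Real.sign_of_neg (h.v_neg_before hs hv hF hne' τ hτ hlt)

theorem exists_isArc_turning {ε : ℝ} (hs : s ∈ γ.J) (hε : ε * ε = 1)
    (hafter : ∀ τ ∈ γ.J, s < τ → Real.sign (deriv γ.r τ) = ε)
    (hbefore : ∀ τ ∈ γ.J, τ < s → Real.sign (deriv γ.r τ) = -ε) :
    (∀ τ ∈ γ.J, s < τ → γ.IsArc s τ ε) ∧ (∀ τ ∈ γ.J, τ < s → γ.IsArc s τ (-ε)) := by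
  refine ⟨fun τ hτ hlt => ⟨hs, hτ, hε, fun x hx => ?_⟩,
    fun τ hτ hlt => ⟨hs, hτ, by linarith, fun x hx => ?_⟩⟩
  · have hxJ := γ.ordConnected_J.uIcc_subset hs hτ (uIoo_subset_uIcc_self hx)
    rw [uIoo_of_lt hlt] at hx
    exact hafter x hxJ hx.1
  · have hxJ := γ.ordConnected_J.uIcc_subset hs hτ (uIoo_subset_uIcc_self hx)
    rw [uIoo_of_gt hlt] at hx
    exact hbefore x hxJ hx.2

theorem IsArc.refl (hs : s ∈ γ.J) : γ.IsArc s s 1 :=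
  ⟨hs, hs, by norm_num, fun x hx => by simp at hx⟩

/-- The zero point is a radius that the orbit reaches. -/
theorem exists_of_zeroPoint (h : γ.IsOrbit L E) (hu₀ : γ.IsTP u₀ ∨ γ.IsIP u₀ ∨ γ.IsHP u₀) :
    ∃ τ ∈ γ.J, γ.u τ = u₀ ∧ 2 * M ≤ γ.r τ ∧ (u₀ = 1 ↔ γ.r τ = 2 * M) := by
  have hM := h.M_pos
  have key : ∀ τ ∈ γ.J, γ.u τ = 1 ↔ γ.r τ = 2 * M := by
    intro τ hτ
    unfold u
    rw [div_eq_one_iff_eq (γ.r_pos τ hτ).ne', eq_comm]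
  rcases hu₀ with ⟨τ, hτ, rfl, hv⟩ | ⟨τ, hτ, rfl, hF⟩ | ⟨rfl, τ, hτ, hr⟩
  · exact ⟨τ, hτ, rfl, (h.lt_of_turning hτ hv).le, key τ hτ⟩
  · rw [h.deriv_deriv_r hτ] at hF
    have := three_mul_lt_of_radialForce_eq_zero hM h.L_ne (γ.r_pos τ hτ) hF
    exact ⟨τ, hτ, rfl, by linarith, key τ hτ⟩
  · exact ⟨τ, hτ, (key τ hτ).2 hr, hr.ge, by simp [hr]⟩

theorem IsOrbit.quadraturesConverge (h : γ.IsOrbit L E) (hell : ¬ γ.IsEllipticLike)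
    {τ₀ : ℝ} (hτ₀ : τ₀ ∈ γ.J) : γ.QuadraturesConverge L E (γ.u τ₀) := by
  intro τ hτ
  by_cases hno : ∀ x ∈ γ.J, deriv γ.r x ≠ 0
  · obtain ⟨σ, hσ1, hσ⟩ := h.sign_const hno
    have ha : γ.IsArc τ₀ τ σ := ⟨hτ₀, hτ, hσ1, fun x hx =>
      hσ x (γ.ordConnected_J.uIcc_subset hτ₀ hτ (uIoo_subset_uIcc_self hx))⟩
    exact ha.intervalIntegrable h
  · push Not at hno
    obtain ⟨s, hs, hv⟩ := hno
    obtain ⟨ε, hε, haf, hbe, -⟩ := h.sign_turning hell hs hv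
    obtain ⟨h1, h2⟩ := exists_isArc_turning hs hε haf hbe
    have key : ∀ x ∈ γ.J, ∃ σ, γ.IsArc s x σ := by
      intro x hx
      rcases lt_trichotomy s x with hlt | rfl | hlt
      · exact ⟨_, h1 x hx hlt⟩
      · exact ⟨_, IsArc.refl hs⟩
      · exact ⟨_, h2 x hx hlt⟩
    obtain ⟨σ₁, a1⟩ := key τ₀ hτ₀
    obtain ⟨σ₂, a2⟩ := key τ hτ
    have b1 := a1.symm.intervalIntegrable h
    have b2 := a2.intervalIntegrable h
    exact ⟨b1.1.trans b2.1, b1.2.trans b2.2⟩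

theorem IsOrbit.isGlobal_of_globalCase (h : γ.IsOrbit L E)
    (hu₀ : γ.IsTP u₀ ∨ γ.IsIP u₀ ∨ γ.IsHP u₀) (hg : γ.GlobalCase u₀) : γ.IsGlobal L E u₀ := by
  obtain ⟨hell, hcase⟩ := h.globalCase_cases hg
  rcases hcase with ⟨s, hs, rfl, hv⟩ | hno
  · obtain ⟨ε, hε, haf, hbe, -⟩ := h.sign_turning hell hs hv
    obtain ⟨h1, h2⟩ := exists_isArc_turning hs hε haf hbe
    refine h.isGlobal_of_arcs (h.lt_of_turning hs hv) hs fun x hx => ?_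
    rcases lt_trichotomy s x with hlt | rfl | hlt
    · exact ⟨_, h1 x hx hlt, Or.inl (haf x hx hlt)⟩
    · exact ⟨_, IsArc.refl hs, Or.inr rfl⟩
    · exact ⟨_, h2 x hx hlt, Or.inl (hbe x hx hlt)⟩
  · obtain ⟨τ₀, hτ₀, rfl, hr, h1⟩ := exists_of_zeroPoint h hu₀
    rcases hr.eq_or_lt with heq | hlt
    · rw [h1.2 heq.symm]
      exact h.isGlobal_of_horizon heq.symm hτ₀ hno
    · obtain ⟨σ, hσ1, hσ⟩ := h.sign_const hno
      exact h.isGlobal_of_arcs hlt hτ₀ fun τ hτ => ⟨σ, ⟨hτ₀, hτ, hσ1, fun x hx =>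
        hσ x (γ.ordConnected_J.uIcc_subset hτ₀ hτ (uIoo_subset_uIcc_self hx))⟩,
        Or.inl (hσ τ hτ)⟩

theorem IsOrbit.isDoubleValued (h : γ.IsOrbit L E) (hell : ¬ γ.IsEllipticLike)
    (hu₀ : γ.IsTP u₀ ∨ γ.IsIP u₀ ∨ γ.IsHP u₀) (hg : ¬ γ.GlobalCase u₀) :
    γ.IsDoubleValued L E u₀ := by
  obtain ⟨hTP, s, hs, hv⟩ := h.exists_turning hell hu₀ hg
  obtain ⟨τ₀, hτ₀, rfl, hr₀, h1⟩ := exists_of_zeroPoint h hu₀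
  obtain ⟨ε, hε, haf, hbe, hFε⟩ := h.sign_turning hell hs hv
  obtain ⟨hA, hB⟩ := exists_isArc_turning hs hε haf hbe
  have hne : s ≠ τ₀ := by
    rintro rfl
    exact hTP ⟨s, hs, rfl, hv⟩
  obtain ⟨σ₀, ha₀⟩ : ∃ σ, γ.IsArc s τ₀ σ := by
    rcases lt_or_gt_of_ne hne with hlt | hlt
    · exact ⟨_, hA τ₀ hτ₀ hlt⟩
    · exact ⟨_, hB τ₀ hτ₀ hlt⟩
  have hε0 : ε ≠ 0 := by
    rintro rfl
    norm_num at hε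
  have hrs := h.lt_of_turning hs hv
  have hint := ha₀.symm.intervalIntegrable h
  have hΦ := h.isClock_angle.integral_ne_zero ha₀ h ha₀.subset hne
  have hP := h.isClock_proper.integral_ne_zero ha₀ h ha₀.subset hne
  set u₀ := γ.u τ₀ with hu₀'
  set IΦ := Real.sign (L / (2 * M)) * ∫ x in u₀..γ.u s, angIntegrand (L / (2 * M)) E x with hIΦ
  set IP := 1 / |L / (2 * M)| * ∫ x in u₀..γ.u s, properIntegrand (L / (2 * M)) E x with hIP
  -- At an apoapsis (`ε = -1`) the increments are taken from `u_*` to `u₀`, at a periapsis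
  -- (`ε = 1`) from `u₀` to `u_*`.
  obtain ⟨a, b, hab, hdelta⟩ : ∃ a b : ℝ,
      ((γ.IsBounded ∧ γ.IsApoapsis s ∧ a = γ.u s ∧ b = u₀) ∨
        (¬ γ.IsBounded ∧ γ.IsPeriapsis s ∧ a = u₀ ∧ b = γ.u s)) ∧
      ∀ f : ℝ → ℝ, ∫ x in a..b, f x = ε * ∫ x in u₀..γ.u s, f x := by
    have hJ := γ.isOpen_J.mem_nhds hs
    by_cases hb : γ.IsBounded
    · have hF := h.force_neg_of_bounded hell hb hs hv
      have hε1 : ε = -1 := by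
        rcases hFε with h2 | h2
        · exact h2.1
        · exact absurd hF (not_lt.2 h2.2.le)
      refine ⟨γ.u s, u₀, Or.inl ⟨hb, ⟨hs, ?_⟩, rfl, rfl⟩, fun f => ?_⟩
      · filter_upwards [hJ] with x hx using h.le_of_turning hs hv hF hx
      · rw [hε1, intervalIntegral.integral_symm]
        ring
    · have hF := h.force_pos_of_unbounded hb hs hv
      have hε1 : ε = 1 := by
        rcases hFε with h2 | h2
        · exact absurd hF (not_lt.2 h2.2.le)
        · exact h2.1
      refine ⟨u₀, γ.u s, Or.inr ⟨hb, ⟨hs, ?_⟩, rfl, rfl⟩, fun f => ?_⟩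
      · filter_upwards [hJ] with x hx using h.ge_of_turning hs hv hF hx
      · rw [hε1, one_mul]
  have hdΦ : γ.φ s + ε * IΦ - (γ.φ s + -ε * IΦ) = deltaAng (L / (2 * M)) E a b := by
    rw [deltaAng, hdelta, hIΦ]
    ring
  have hdP : s / (2 * M) + ε * IP - (s / (2 * M) + -ε * IP) =
      deltaProper (L / (2 * M)) E a b := by
    rw [deltaProper, hdelta, hIP]
    ring
  have hneΦ : γ.φ s + -ε * IΦ ≠ γ.φ s + ε * IΦ := by
    intro heq
    exact mul_ne_zero hε0 hΦ (by linarith)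
  have hneP : s / (2 * M) + -ε * IP ≠ s / (2 * M) + ε * IP := by
    intro heq
    exact mul_ne_zero hε0 hP (by linarith)
  have hang : γ.AngleSingleValued L E u₀ ↔
      ∃ n : ℤ, deltaAng (L / (2 * M)) E a b = 2 * Real.pi * n := by
    rw [← hdΦ, ← Real.Angle.angle_eq_iff_two_pi_dvd_sub]
    have hval : ∀ τ ∈ γ.J, s < τ → γ.angQuantity L E u₀ τ = γ.φ s + ε * IΦ := fun τ hτ hlt =>
      (hA τ hτ hlt).angQuantity_eq h (Or.inl (haf τ hτ hlt)) hint.1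
    have hval' : ∀ τ ∈ γ.J, τ < s → γ.angQuantity L E u₀ τ = γ.φ s + -ε * IΦ := fun τ hτ hlt =>
      (hB τ hτ hlt).angQuantity_eq h (Or.inl (hbe τ hτ hlt)) hint.1
    have hvne : ∀ τ ∈ γ.J, τ ≠ s → deriv γ.r τ ≠ 0 := fun τ hτ hn h0 =>
      hn (h.turning_unique hell hτ hs h0 hv)
    constructor
    · rintro ⟨ϑ, hϑ⟩
      obtain ⟨x, hx, hsx⟩ := exists_gt_mem_J hs
      obtain ⟨y, hy, hys⟩ := exists_lt_mem_J hs
      rw [← hval x hx hsx, ← hval' y hy hys, hϑ x hx (hvne x hx hsx.ne'),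
        hϑ y hy (hvne y hy hys.ne)]
    · intro heq
      refine ⟨((γ.φ s + ε * IΦ : ℝ) : Real.Angle), fun τ hτ hτv => ?_⟩
      rcases lt_trichotomy s τ with hlt | rfl | hlt
      · rw [hval τ hτ hlt]
      · exact absurd hv hτv
      · rw [hval' τ hτ hlt, heq]
  -- The values of the coordinate-time integral.
  obtain ⟨cT, cT', hcT, hcT', hcne, hc1, hc2⟩ : ∃ cT cT' : EReal,
      (∀ τ ∈ γ.J, τ < s → 2 * M < γ.r τ → γ.timeQuantity L E u₀ τ = cT) ∧
      (∀ τ ∈ γ.J, s < τ → 2 * M < γ.r τ → γ.timeQuantity L E u₀ τ = cT') ∧ cT ≠ cT' ∧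
      (u₀ ≠ 1 → ∃ x x' : ℝ, cT = x ∧ cT' = x' ∧ x' - x = deltaTime (L / (2 * M)) E a b) ∧
      (u₀ = 1 → cT = (E : EReal) * ⊥ ∧ cT' = (E : EReal) * ⊤) := by
    rcases hr₀.eq_or_lt with heq | hlt
    · have hu1 : u₀ = 1 := h1.2 heq.symm
      have hε1 : ε = -1 := by
        rcases hFε with h2 | h2
        · exact h2.1
        · have := h.ge_of_turning hs hv h2.2 hτ₀
          linarith
      have hE := h.E_ne
      refine ⟨(E : EReal) * ⊥, (E : EReal) * ⊤, fun τ hτ hlt hr => ?_, fun τ hτ hlt hr => ?_, ?_,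
        fun h2 => absurd hu1 h2, fun _ => ⟨rfl, rfl⟩⟩
      · have hsg := hbe τ hτ hlt
        rw [hu1, timeQuantity_one h ⟨hτ, hr⟩, hsg, hε1]
        · norm_num
        · rintro h0
          rw [h0, Real.sign_zero] at hsg
          exact hε0 (by linarith)
      · have hsg := haf τ hτ hlt
        rw [hu1, timeQuantity_one h ⟨hτ, hr⟩, hsg, hε1]
        · rcases lt_or_gt_of_ne hE with h2 | h2
          · rw [EReal.coe_mul_top_of_neg h2, EReal.coe_mul_bot_of_pos (by linarith)]
          · rw [EReal.coe_mul_top_of_pos h2, EReal.coe_mul_bot_of_neg (by linarith)]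
        · rintro h0
          rw [h0, Real.sign_zero] at hsg
          exact hε0 hsg.symm
      · rcases lt_or_gt_of_ne hE with h2 | h2
        · rw [EReal.coe_mul_top_of_neg h2, EReal.coe_mul_bot_of_neg h2]
          exact top_ne_bot
        · rw [EReal.coe_mul_top_of_pos h2, EReal.coe_mul_bot_of_pos h2]
          exact bot_ne_top
    · have hu1 : u₀ < 1 := (u_lt_one_iff hτ₀).2 hlt
      have hT := h.isClock_time.integral_ne_zero ha₀ h (ha₀.subset_outerTimes h hrs hlt) hne
      have hintT := ha₀.symm.intervalIntegrable_time h hlt hrs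
      set IT := E / |L / (2 * M)| * ∫ x in u₀..γ.u s, timeIntegrand (L / (2 * M)) E x with hIT
      have hdT : γ.t s / (2 * M) + ε * IT - (γ.t s / (2 * M) + -ε * IT) =
          deltaTime (L / (2 * M)) E a b := by
        rw [deltaTime, hdelta, hIT]
        ring
      refine ⟨((γ.t s / (2 * M) + -ε * IT : ℝ) : EReal),
        ((γ.t s / (2 * M) + ε * IT : ℝ) : EReal), fun τ hτ hlt hr =>
          (hB τ hτ hlt).timeQuantity_eq h hrs hr hu1.le (Or.inl (hbe τ hτ hlt)) hintT,
        fun τ hτ hlt hr =>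
          (hA τ hτ hlt).timeQuantity_eq h hrs hr hu1.le (Or.inl (haf τ hτ hlt)) hintT, ?_,
        fun _ => ⟨_, _, rfl, rfl, hdT⟩, fun h2 => absurd h2 hu1.ne⟩
      intro heq
      have := EReal.coe_injective heq
      exact mul_ne_zero hε0 hT (by linarith)
  refine ⟨s, hs, fun τ hτ => ⟨fun h0 => h.turning_unique hell hτ hs h0 hv, fun h0 => h0 ▸ hv⟩,
    a, b, hab, γ.φ s + -ε * IΦ, γ.φ s + ε * IΦ, cT, cT', s / (2 * M) + -ε * IP,
    s / (2 * M) + ε * IP, fun τ hτ => ?_, fun τ hτ => ?_, hneΦ, hcne, hneP, hdΦ, hdP, hc1, hc2,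
    hang⟩
  · have ha := hB τ hτ.1 hτ.2
    have hsg := hbe τ hτ.1 hτ.2
    exact ⟨ha.angQuantity_eq h (Or.inl hsg) hint.1, ha.properQuantity_eq h (Or.inl hsg) hint.2,
      hcT τ hτ.1 hτ.2⟩
  · have ha := hA τ hτ.1 hτ.2
    have hsg := haf τ hτ.1 hτ.2
    exact ⟨ha.angQuantity_eq h (Or.inl hsg) hint.1, ha.properQuantity_eq h (Or.inl hsg) hint.2,
      hcT' τ hτ.1 hτ.2⟩

theorem IsDoubleValued.not_isGlobal (hd : γ.IsDoubleValued L E u₀) : ¬ γ.IsGlobal L E u₀ := by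
  rintro ⟨c, _, _, hc, -⟩
  obtain ⟨s, hs, -, _, _, -, cΦ, cΦ', _, _, _, _, h1, h2, hne, -⟩ := hd
  obtain ⟨x, hx, hsx⟩ := exists_gt_mem_J hs
  obtain ⟨y, hy, hys⟩ := exists_lt_mem_J hs
  refine hne ?_
  rw [← (h1 y ⟨hy, hys⟩).1, ← (h2 x ⟨hx, hsx⟩).1, (hc y hy).1, (hc x hx).1]

variable {M : ℝ} {γ : TimelikeGeodesic M} {L E : ℝ} {rmin rmax : ℝ}

/-! ### Elliptic-like orbits -/

theorem IsEllipticLikeBetween.mem_Icc (hell : γ.IsEllipticLikeBetween rmin rmax) {τ : ℝ}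
    (hτ : τ ∈ γ.J) : γ.r τ ∈ Icc rmin rmax := hell.2.2 ▸ ⟨τ, hτ, rfl⟩

theorem IsEllipticLikeBetween.J_eq_univ (hell : γ.IsEllipticLikeBetween rmin rmax)
    (h : γ.IsOrbit L E) : γ.J = univ := by
  have hmin : 0 < rmin := by linarith [h.M_pos, hell.1]
  obtain ⟨a, ha⟩ := γ.nonempty_J
  have h1 : ¬ BddAbove γ.J := h.not_bddAbove_of_mem_Icc ha hmin fun τ hτ _ => hell.mem_Icc hτ
  have h2 : ¬ BddBelow γ.J := by
    rw [← bddBelow_J_iff_reverse]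
    exact h.reverse.not_bddAbove_of_mem_Icc (a := -a) (mem_reverse_J.2 (by simpa using ha)) hmin
      fun τ hτ _ => hell.mem_Icc (τ := -τ) hτ
  refine eq_univ_of_forall fun x => ?_
  obtain ⟨y, hy, hxy⟩ := not_bddAbove_iff.1 h1 x
  obtain ⟨z, hz, hzx⟩ := not_bddBelow_iff.1 h2 x
  exact γ.ordConnected_J.out hz hy ⟨hzx.le, hxy.le⟩

/-- An elliptic-like orbit is symmetric about each of its apsides. -/
theorem IsEllipticLikeBetween.reflect (hell : γ.IsEllipticLikeBetween rmin rmax)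
    (h : γ.IsOrbit L E) {s : ℝ} (hv : deriv γ.r s = 0) (τ : ℝ) :
    γ.r (2 * s - τ) = γ.r τ ∧ deriv γ.r (2 * s - τ) = -deriv γ.r τ := by
  have hJ : ∀ x, x ∈ γ.J := fun x => hell.J_eq_univ h ▸ mem_univ x
  have hmin : 0 < rmin := by linarith [h.M_pos, hell.1]
  have hIcc : Icc rmin rmax ⊆ Ioi 0 := fun x hx => hmin.trans_le hx.1
  obtain ⟨C, hC⟩ := isCompact_Icc.bddAbove_image ((continuousOn_radialSq M L E).mono hIcc)
  have hvC : ∀ x, deriv γ.r x ∈ Icc (-√C) √C := by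
    intro x
    refine abs_le.1 (Real.abs_le_sqrt ?_)
    rw [h.sq_velocity x (hJ x)]
    exact hC ⟨_, hell.mem_Icc (hJ x), rfl⟩
  have hneg : ∀ x, HasDerivAt (fun t => 2 * s - t) (-1) x := fun x =>
    (hasDerivAt_id x).const_sub (2 * s)
  have key := radial_solution_unique (M := M) (L := L) (a := s - |τ - s| - 1)
    (b := s + |τ - s| + 1) (t₀ := s) (S := Icc rmin rmax ×ˢ Icc (-√C) √C)
    (r₁ := fun t => γ.r (2 * s - t)) (v₁ := fun t => -deriv γ.r (2 * s - t)) (r₂ := γ.r)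
    (v₂ := deriv γ.r) (isCompact_Icc.prod isCompact_Icc) (fun p hp => hIcc hp.1)
    ⟨by linarith [abs_nonneg (τ - s)], by linarith [abs_nonneg (τ - s)]⟩
    (fun t _ => ⟨((h.radius _ (hJ _)).comp t (hneg t)).congr_deriv (mul_neg_one _),
      ((h.velocity _ (hJ _)).comp t (hneg t)).neg.congr_deriv (by ring),
      hell.mem_Icc (hJ _), neg_le_neg (hvC _).2, neg_le.1 (hvC _).1⟩)
    (fun t _ => ⟨h.radius t (hJ t), h.velocity t (hJ t), hell.mem_Icc (hJ t), hvC t⟩)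
    (by simp [two_mul]) (by simp [two_mul, hv]) τ
    ⟨by linarith [neg_abs_le (τ - s)], by linarith [le_abs_self (τ - s)]⟩
  exact ⟨key.1, by linarith [key.2]⟩

theorem IsEllipticLikeBetween.turning_iff (hell : γ.IsEllipticLikeBetween rmin rmax)
    (h : γ.IsOrbit L E) {τ : ℝ} : deriv γ.r τ = 0 ↔ γ.r τ = rmax ∨ γ.r τ = rmin := by
  have hJ : ∀ x, x ∈ γ.J := fun x => hell.J_eq_univ h ▸ mem_univ x
  have hmm := hell.2.1.le
  obtain ⟨a, ha, hra⟩ : rmax ∈ γ.r '' γ.J := hell.2.2.symm ▸ right_mem_Icc.2 hmm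
  obtain ⟨b, hb, hrb⟩ : rmin ∈ γ.r '' γ.J := hell.2.2.symm ▸ left_mem_Icc.2 hmm
  constructor
  · intro hv
    rcases lt_or_gt_of_ne (h.force_ne_zero (hJ τ) hv) with hF | hF
    · exact Or.inl (le_antisymm (hell.mem_Icc (hJ τ)).2
        (hra ▸ h.le_of_turning (hJ τ) hv hF ha))
    · exact Or.inr (le_antisymm (hrb ▸ h.ge_of_turning (hJ τ) hv hF hb)
        (hell.mem_Icc (hJ τ)).1)
  · rintro (hr | hr)
    · refine IsLocalMax.deriv_eq_zero (Eventually.of_forall fun x => ?_)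
      rw [hr]
      exact (hell.mem_Icc (hJ x)).2
    · refine IsLocalMin.deriv_eq_zero (Eventually.of_forall fun x => ?_)
      rw [hr]
      exact (hell.mem_Icc (hJ x)).1

/-- There are an apoapsis and a later periapsis with no apsis between them. -/
theorem IsEllipticLikeBetween.exists_consecutive (hell : γ.IsEllipticLikeBetween rmin rmax)
    (h : γ.IsOrbit L E) : ∃ a b, a < b ∧ γ.r a = rmax ∧ γ.r b = rmin ∧
      ∀ x ∈ Ioo a b, deriv γ.r x < 0 := by
  have hJ : ∀ x, x ∈ γ.J := fun x => hell.J_eq_univ h ▸ mem_univ x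
  have hcont : Continuous γ.r :=
    continuous_iff_continuousAt.2 fun x => (h.radius x (hJ x)).continuousAt
  have hmm := hell.2.1
  obtain ⟨a₀, ha₀, hra₀⟩ : rmax ∈ γ.r '' γ.J := hell.2.2.symm ▸ right_mem_Icc.2 hmm.le
  obtain ⟨b₀, hb₀, hab₀, hrb₀⟩ : ∃ b₀, b₀ ∈ γ.J ∧ a₀ < b₀ ∧ γ.r b₀ = rmin := by
    obtain ⟨b, hb, hrb⟩ : rmin ∈ γ.r '' γ.J := hell.2.2.symm ▸ left_mem_Icc.2 hmm.le
    rcases lt_trichotomy a₀ b with hlt | rfl | hlt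
    · exact ⟨b, hb, hlt, hrb⟩
    · linarith
    · refine ⟨2 * a₀ - b, hJ _, by linarith, ?_⟩
      rw [(hell.reflect h ((hell.turning_iff h).2 (Or.inl hra₀)) b).1, hrb]
  obtain ⟨a, ⟨⟨haI, hra⟩, hamax⟩⟩ : ∃ a, IsGreatest (Icc a₀ b₀ ∩ {x | γ.r x = rmax}) a :=
    (isCompact_Icc.inter_right (isClosed_eq hcont continuous_const)).exists_isGreatest
      ⟨a₀, left_mem_Icc.2 hab₀.le, hra₀⟩
  obtain ⟨b, ⟨⟨hbI, hrb⟩, hbmin⟩⟩ : ∃ b, IsLeast (Icc a b₀ ∩ {x | γ.r x = rmin}) b :=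
    (isCompact_Icc.inter_right (isClosed_eq hcont continuous_const)).exists_isLeast
      ⟨b₀, right_mem_Icc.2 haI.2, hrb₀⟩
  replace hra : γ.r a = rmax := hra
  replace hrb : γ.r b = rmin := hrb
  have hab : a < b := lt_of_le_of_ne hbI.1 (by rintro rfl; linarith)
  refine ⟨a, b, hab, hra, hrb, ?_⟩
  have hne : ∀ x ∈ Ioo a b, deriv γ.r x ≠ 0 := by
    intro x hx hv
    rcases (hell.turning_iff h).1 hv with hr | hr
    · have := hamax ⟨⟨haI.1.trans hx.1.le, hx.2.le.trans hbI.2⟩, hr⟩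
      linarith [hx.1]
    · have := hbmin ⟨⟨hx.1.le, hx.2.le.trans hbI.2⟩, hr⟩
      linarith [hx.2]
  rcases pos_or_neg_of_ne_zero ordConnected_Ioo
    (h.continuousOn_v.mono fun x _ => hJ x) hne with h1 | h1
  · have := strictMonoOn_of_deriv_pos (convex_Icc a b) hcont.continuousOn
      (by rwa [interior_Icc]) (left_mem_Icc.2 hab.le) (right_mem_Icc.2 hab.le) hab
    linarith
  · exact h1

/-- The sign of the radial velocity between the apsides `k` and `k + 1`, where the apoapsides have
even numbers. -/
noncomputable def apsisSign (k : ℤ) : ℝ := if Even k then -1 else 1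

theorem apsisSign_two_mul (k : ℤ) : apsisSign (2 * k) = -1 := if_pos (even_two_mul k)

theorem apsisSign_add_one (k : ℤ) : apsisSign (k + 1) = -apsisSign k := by
  by_cases hk : Even k <;> simp [apsisSign, hk]

theorem apsisSign_two_mul_add_one (k : ℤ) : apsisSign (2 * k + 1) = 1 := by
  rw [apsisSign_add_one, apsisSign_two_mul, neg_neg]

theorem apsisSign_mul_self (k : ℤ) : apsisSign k * apsisSign k = 1 := by
  unfold apsisSign
  split_ifs <;> norm_num

/-- A doubly infinite sequence of apsides: apoapsides at the even and periapsides at the odd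
numbers, joined by arcs. -/
structure IsApsisSequence (γ : TimelikeGeodesic M) (rmin rmax : ℝ) (s : ℤ → ℝ) : Prop where
  strictMono : StrictMono s
  exists_Ico : ∀ τ, ∃ k, τ ∈ Ico (s k) (s (k + 1))
  sign_eq : ∀ k, ∀ τ ∈ Ioo (s k) (s (k + 1)), Real.sign (deriv γ.r τ) = apsisSign k
  apoapsis : ∀ k, γ.r (s (2 * k)) = rmax
  periapsis : ∀ k, γ.r (s (2 * k + 1)) = rmin

theorem IsEllipticLikeBetween.exists_apsisSequence (hell : γ.IsEllipticLikeBetween rmin rmax)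
    (h : γ.IsOrbit L E) : ∃ s, γ.IsApsisSequence rmin rmax s := by
  obtain ⟨a, b, hab, hra, hrb, hneg⟩ := hell.exists_consecutive h
  have hva := (hell.turning_iff h).2 (Or.inl hra)
  have hvb := (hell.turning_iff h).2 (Or.inr hrb)
  have hD : 0 < b - a := sub_pos.2 hab
  -- The reflections about two consecutive apsides compose to a translation.
  have hper : ∀ τ, γ.r (τ + 2 * (b - a)) = γ.r τ ∧ deriv γ.r (τ + 2 * (b - a)) = deriv γ.r τ := by
    intro τ
    have h1 := hell.reflect h hva τ
    have h2 := hell.reflect h hvb (2 * a - τ)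
    have h3 : 2 * b - (2 * a - τ) = τ + 2 * (b - a) := by ring
    rw [h3] at h2
    exact ⟨h2.1.trans h1.1, by rw [h2.2, h1.2, neg_neg]⟩
  have hperr : Function.Periodic γ.r (2 * (b - a)) := fun τ => (hper τ).1
  have hperv : Function.Periodic (deriv γ.r) (2 * (b - a)) := fun τ => (hper τ).2
  have hneg0 : ∀ τ ∈ Ioo a b, Real.sign (deriv γ.r τ) = -1 :=
    fun τ hτ => Real.sign_of_neg (hneg τ hτ)
  have hpos1 : ∀ τ ∈ Ioo b (b + (b - a)), Real.sign (deriv γ.r τ) = 1 := by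
    intro τ hτ
    have h1 := (hell.reflect h hvb τ).2
    have h2 := hneg (2 * b - τ) ⟨by linarith [hτ.2], by linarith [hτ.1]⟩
    exact Real.sign_of_pos (by linarith)
  refine ⟨fun k => a + k * (b - a), ?_, ?_, ?_, ?_, ?_⟩
  · intro k l hkl
    have : (k : ℝ) < l := Int.cast_lt.2 hkl
    have := mul_lt_mul_of_pos_right this hD
    simpa using this
  · intro τ
    refine ⟨⌊(τ - a) / (b - a)⌋, ?_, ?_⟩
    · have := (le_div_iff₀ hD).1 (Int.floor_le ((τ - a) / (b - a)))
      linarith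
    · have := (div_lt_iff₀ hD).1 (Int.lt_floor_add_one ((τ - a) / (b - a)))
      push_cast
      linarith
  · intro k τ hτ
    push_cast at hτ
    rcases Int.even_or_odd' k with ⟨m, rfl | rfl⟩
    · have h1 := hperv.sub_int_mul_eq (x := τ) m
      rw [apsisSign_two_mul, ← h1]
      push_cast at hτ
      exact hneg0 _ ⟨by linarith [hτ.1], by linarith [hτ.2]⟩
    · have h1 := hperv.sub_int_mul_eq (x := τ) m
      rw [apsisSign_two_mul_add_one, ← h1]
      push_cast at hτ
      exact hpos1 _ ⟨by linarith [hτ.1], by linarith [hτ.2]⟩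
  · intro k
    have h1 := hperr.sub_int_mul_eq (x := a + ((2 * k : ℤ) : ℝ) * (b - a)) k
    rw [← h1, ← hra]
    congr 1
    push_cast
    ring
  · intro k
    have h1 := hperr.sub_int_mul_eq (x := a + ((2 * k + 1 : ℤ) : ℝ) * (b - a)) k
    rw [← h1, ← hrb]
    congr 1
    push_cast
    ring

namespace IsApsisSequence

variable {s : ℤ → ℝ}

theorem lt_succ (hs : γ.IsApsisSequence rmin rmax s) (k : ℤ) : s k < s (k + 1) :=
  hs.strictMono (lt_add_one k)

theorem v_eq_zero (hs : γ.IsApsisSequence rmin rmax s)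
    (hell : γ.IsEllipticLikeBetween rmin rmax) (h : γ.IsOrbit L E) (k : ℤ) :
    deriv γ.r (s k) = 0 := by
  rw [hell.turning_iff h]
  rcases Int.even_or_odd' k with ⟨m, rfl | rfl⟩
  · exact Or.inl (hs.apoapsis m)
  · exact Or.inr (hs.periapsis m)

theorem isArc_left (hs : γ.IsApsisSequence rmin rmax s) (hJ : γ.J = univ) {k : ℤ} {τ : ℝ}
    (hτ : τ ∈ Icc (s k) (s (k + 1))) : γ.IsArc (s k) τ (apsisSign k) :=
  ⟨hJ ▸ mem_univ _, hJ ▸ mem_univ _, apsisSign_mul_self k, fun x hx => by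
    rw [uIoo_of_le hτ.1] at hx
    exact hs.sign_eq k x ⟨hx.1, hx.2.trans_le hτ.2⟩⟩

theorem v_ne_zero (hs : γ.IsApsisSequence rmin rmax s) {k : ℤ} {τ : ℝ}
    (hτ : τ ∈ Ioo (s k) (s (k + 1))) : deriv γ.r τ ≠ 0 := by
  intro h0
  have := hs.sign_eq k τ hτ
  have h1 := apsisSign_mul_self k
  rw [h0, Real.sign_zero] at this
  rw [← this] at h1
  norm_num at h1

theorem sign_eq_or (hs : γ.IsApsisSequence rmin rmax s)
    (hell : γ.IsEllipticLikeBetween rmin rmax) (h : γ.IsOrbit L E) {u₀ : ℝ} {k : ℤ} {τ : ℝ}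
    (hτ : τ ∈ Icc (s k) (s (k + 1))) (hv : deriv γ.r τ ≠ 0 ∨ γ.u τ = u₀) :
    Real.sign (deriv γ.r τ) = apsisSign k ∨ γ.u τ = u₀ := by
  refine hv.imp_left fun hv => hs.sign_eq k τ ⟨lt_of_le_of_ne hτ.1 ?_, lt_of_le_of_ne hτ.2 ?_⟩
  · rintro rfl
    exact hv (hs.v_eq_zero hell h k)
  · rintro rfl
    exact hv (hs.v_eq_zero hell h (k + 1))

variable {G θ θ' : ℝ → ℝ} {κ u₀ : ℝ}

/-- The values of an integral of motion between successive apsides, and their jumps. -/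
theorem exists_values (hs : γ.IsApsisSequence rmin rmax s)
    (hell : γ.IsEllipticLikeBetween rmin rmax) (h : γ.IsOrbit L E)
    (hc : γ.IsClock univ G θ θ' κ) {τ₀ : ℝ} (hu₀ : γ.u τ₀ = u₀) :
    (∀ τ, IntervalIntegrable G volume u₀ (γ.u τ)) ∧
    ∃ c : ℤ → ℝ,
      (∀ k, ∀ τ ∈ Icc (s k) (s (k + 1)), (deriv γ.r τ ≠ 0 ∨ γ.u τ = u₀) →
        θ τ + Real.sign (deriv γ.r τ) * (κ * ∫ x in u₀..γ.u τ, G x) = c k) ∧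
      (∀ k, c (2 * k) - c (2 * k - 1) = 2 * (κ * ∫ x in (2 * M / rmax)..u₀, G x)) ∧
      (∀ k, c (2 * k + 1) - c (2 * k) = 2 * (κ * ∫ x in u₀..(2 * M / rmin), G x)) ∧
      (∀ k, c (k + 2) - c k = 2 * (κ * ∫ x in (2 * M / rmax)..(2 * M / rmin), G x)) ∧
      (range c).Infinite := by
  have hJ := hell.J_eq_univ h
  have hmem : ∀ τ, γ.u τ ∈ uIcc (2 * M / rmax) (2 * M / rmin) := by
    intro τ
    have h1 := hell.mem_Icc (τ := τ) (hJ ▸ mem_univ τ)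
    have h2 : 0 < rmin := by linarith [h.M_pos, hell.1]
    have h3 : 0 < 2 * M := by linarith [h.M_pos]
    exact Icc_subset_uIcc ⟨div_le_div_of_nonneg_left h3.le (h2.trans_le h1.1) h1.2,
      div_le_div_of_nonneg_left h3.le h2 h1.1⟩
  have hap : ∀ k, γ.u (s (2 * k)) = 2 * M / rmax := fun k => by
    unfold u
    rw [hs.apoapsis]
  have hpe : ∀ k, γ.u (s (2 * k + 1)) = 2 * M / rmin := fun k => by
    unfold u
    rw [hs.periapsis]
  have harc := hs.isArc_left hJ (k := 2 * 0) (right_mem_Icc.2 (hs.lt_succ _).le)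
  have hG : IntervalIntegrable G volume (2 * M / rmax) (2 * M / rmin) := by
    have := (hc.integral_eq h (subset_univ _) harc.sign_ne_zero harc.sign_eq).1
    rwa [hap, hpe] at this
  have hint : ∀ {a b : ℝ}, a ∈ uIcc (2 * M / rmax) (2 * M / rmin) →
      b ∈ uIcc (2 * M / rmax) (2 * M / rmin) → IntervalIntegrable G volume a b :=
    fun ha hb => hG.mono_set (uIcc_subset_uIcc ha hb)
  have hu₀m := hu₀ ▸ hmem τ₀
  refine ⟨fun τ => hint hu₀m (hmem τ),
    fun k => θ (s k) + apsisSign k * (κ * ∫ x in u₀..γ.u (s k), G x), ?_⟩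
  have hjump : ∀ k, (θ (s (k + 1)) + apsisSign (k + 1) * (κ * ∫ x in u₀..γ.u (s (k + 1)), G x)) -
      (θ (s k) + apsisSign k * (κ * ∫ x in u₀..γ.u (s k), G x)) =
      2 * apsisSign (k + 1) * (κ * ∫ x in u₀..γ.u (s (k + 1)), G x) := by
    intro k
    have ha := hs.isArc_left hJ (k := k) (right_mem_Icc.2 (hs.lt_succ k).le)
    have h1 := (hc.integral_eq h (subset_univ _) ha.sign_ne_zero ha.sign_eq).2
    have h2 := intervalIntegral.integral_add_adjacent_intervals (hint hu₀m (hmem (s k)))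
      (hint (hmem (s k)) (hmem (s (k + 1))))
    rw [apsisSign_add_one, ← h2, mul_add, h1]
    linear_combination (θ (s (k + 1)) - θ (s k)) * (-ha.sq_sign)
  have hj1 : ∀ k, (θ (s (2 * k)) + apsisSign (2 * k) * (κ * ∫ x in u₀..γ.u (s (2 * k)), G x)) -
      (θ (s (2 * k - 1)) + apsisSign (2 * k - 1) * (κ * ∫ x in u₀..γ.u (s (2 * k - 1)), G x)) =
      2 * (κ * ∫ x in (2 * M / rmax)..u₀, G x) := by
    intro k
    have := hjump (2 * k - 1)
    rw [sub_add_cancel] at this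
    rw [this, hap, apsisSign_two_mul, intervalIntegral.integral_symm]
    ring
  have hj2 : ∀ k, (θ (s (2 * k + 1)) +
        apsisSign (2 * k + 1) * (κ * ∫ x in u₀..γ.u (s (2 * k + 1)), G x)) -
      (θ (s (2 * k)) + apsisSign (2 * k) * (κ * ∫ x in u₀..γ.u (s (2 * k)), G x)) =
      2 * (κ * ∫ x in u₀..(2 * M / rmin), G x) := by
    intro k
    rw [hjump, hpe, apsisSign_two_mul_add_one]
    ring
  have hsum := intervalIntegral.integral_add_adjacent_intervals (hint left_mem_uIcc hu₀m)
    (hint hu₀m right_mem_uIcc)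
  have hj3 : ∀ k, (θ (s (k + 2)) + apsisSign (k + 2) * (κ * ∫ x in u₀..γ.u (s (k + 2)), G x)) -
      (θ (s k) + apsisSign k * (κ * ∫ x in u₀..γ.u (s k), G x)) =
      2 * (κ * ∫ x in (2 * M / rmax)..(2 * M / rmin), G x) := by
    intro k
    rw [← hsum]
    rcases Int.even_or_odd' k with ⟨m, rfl | rfl⟩
    · have h1 := hj1 (m + 1)
      have h2 := hj2 m
      have e1 : 2 * (m + 1) = 2 * m + 2 := by ring
      have e2 : 2 * m + 2 - 1 = 2 * m + 1 := by ring
      rw [e1, e2] at h1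
      linarith
    · have h1 := hj1 (m + 1)
      have h2 := hj2 (m + 1)
      have e1 : 2 * (m + 1) - 1 = 2 * m + 1 := by ring
      have e2 : 2 * (m + 1) + 1 = 2 * m + 1 + 2 := by ring
      rw [e1] at h1
      rw [e2] at h2
      linarith
  refine ⟨?_, hj1, hj2, hj3, ?_⟩
  · intro k τ hτ hv
    have ha := hs.isArc_left hJ hτ
    exact hc.quantity_eq h (subset_univ _) ha.sign_ne_zero ha.sign_eq ha.sq_sign
      (hs.sign_eq_or hell h hτ hv) (hint hu₀m (hmem (s k)))
  · set c : ℤ → ℝ := fun k => θ (s k) + apsisSign k * (κ * ∫ x in u₀..γ.u (s k), G x) with hcdef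
    have hΔ : κ * ∫ x in (2 * M / rmax)..(2 * M / rmin), G x ≠ 0 := by
      have := hc.integral_ne_zero harc.symm h (subset_univ _) (hs.lt_succ _).ne'
      rwa [hap, hpe] at this
    have hstep : ∀ k : ℤ, c (2 * k) = c 0 +
        k * (2 * (κ * ∫ x in (2 * M / rmax)..(2 * M / rmin), G x)) := by
      intro k
      induction k using Int.induction_on with
      | zero => simp
      | succ n ih =>
        have h1 := hj3 (2 * n)
        have e1 : 2 * ((n : ℤ) + 1) = 2 * n + 2 := by ring
        rw [e1]
        push_cast at ih ⊢
        simp only [hcdef] at ih h1 ⊢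
        linarith
      | pred n ih =>
        have h1 := hj3 (2 * (-(n : ℤ) - 1))
        have e1 : 2 * (-(n : ℤ) - 1) + 2 = 2 * -n := by ring
        rw [e1] at h1
        push_cast at ih ⊢
        simp only [hcdef] at ih h1 ⊢
        linarith
    have hinj : Function.Injective fun k : ℤ => c (2 * k) := by
      intro k l hkl
      simp only [hstep] at hkl
      have h1 := mul_right_cancel₀ (mul_ne_zero two_ne_zero hΔ) (add_left_cancel hkl)
      exact_mod_cast h1
    exact (infinite_range_of_injective hinj).mono (range_comp_subset_range (fun k : ℤ => 2 * k) c)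

end IsApsisSequence

theorem IsEllipticLikeBetween.quadraturesConverge (hell : γ.IsEllipticLikeBetween rmin rmax)
    (h : γ.IsOrbit L E) (τ₀ : ℝ) : γ.QuadraturesConverge L E (γ.u τ₀) := by
  obtain ⟨s, hs⟩ := hell.exists_apsisSequence h
  have hJ := hell.J_eq_univ h
  exact fun τ _ => ⟨(hs.exists_values hell h (hJ ▸ h.isClock_angle) rfl).1 τ,
    (hs.exists_values hell h (hJ ▸ h.isClock_proper) rfl).1 τ⟩

theorem angle_eq_of_forall_succ {c : ℤ → ℝ}
    (hc : ∀ k, (c (k + 1) : Real.Angle) = (c k : Real.Angle)) (k : ℤ) :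
    (c k : Real.Angle) = (c 0 : Real.Angle) := by
  induction k using Int.induction_on with
  | zero => rfl
  | succ n ih => rw [hc, ih]
  | pred n ih =>
    rw [← ih, ← hc (-(n : ℤ) - 1), sub_add_cancel]

theorem IsEllipticLikeBetween.isMultiValued (hell : γ.IsEllipticLikeBetween rmin rmax)
    (h : γ.IsOrbit L E) {u₀ τ₀ : ℝ} (hu₀ : γ.u τ₀ = u₀) :
    γ.IsMultiValued L E u₀ (2 * M / rmax) (2 * M / rmin) := by
  obtain ⟨s, hs⟩ := hell.exists_apsisSequence h
  have hJ := hell.J_eq_univ h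
  have hJ' : ∀ x, x ∈ γ.J := fun x => hJ ▸ mem_univ x
  have hout : ∀ x, 2 * M < γ.r x := fun x => hell.1.trans_le (hell.mem_Icc (hJ' x)).1
  have hO : γ.outerTimes = univ := eq_univ_of_forall fun x => ⟨hJ' x, hout x⟩
  have hu1 : u₀ ≤ 1 := hu₀ ▸ ((u_lt_one_iff (hJ' τ₀)).2 (hout τ₀)).le
  obtain ⟨hiΦ, cΦ, hΦ, hΦ1, hΦ2, hΦ3, hΦ4⟩ :=
    hs.exists_values hell h (hJ ▸ h.isClock_angle) hu₀
  obtain ⟨hiP, cP, hP, hP1, hP2, hP3, hP4⟩ :=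
    hs.exists_values hell h (hJ ▸ h.isClock_proper) hu₀
  obtain ⟨hiT, cT, hT, hT1, hT2, hT3, hT4⟩ :=
    hs.exists_values hell h (hO ▸ h.isClock_time) hu₀
  have eΦ : ∀ a b, 2 * (Real.sign (L / (2 * M)) * ∫ x in a..b, angIntegrand (L / (2 * M)) E x) =
      deltaAng (L / (2 * M)) E a b := fun a b => by
    unfold deltaAng
    ring
  have eP : ∀ a b, 2 * (1 / |L / (2 * M)| * ∫ x in a..b, properIntegrand (L / (2 * M)) E x) =
      deltaProper (L / (2 * M)) E a b := fun a b => by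
    unfold deltaProper
    ring
  have eT : ∀ a b, 2 * (E / |L / (2 * M)| * ∫ x in a..b, timeIntegrand (L / (2 * M)) E x) =
      deltaTime (L / (2 * M)) E a b := fun a b => by
    unfold deltaTime
    ring
  simp only [eΦ] at hΦ1 hΦ2 hΦ3
  simp only [eP] at hP1 hP2 hP3
  simp only [eT] at hT1 hT2 hT3
  have hvΦ : ∀ k, ∀ τ ∈ Icc (s k) (s (k + 1)), (deriv γ.r τ ≠ 0 ∨ γ.u τ = u₀) →
      γ.angQuantity L E u₀ τ = cΦ k := fun k τ hτ hv => by
    rw [angQuantity_eq]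
    exact hΦ k τ hτ hv
  refine ⟨s, cΦ, cT, cP, hs.strictMono, ?_, fun τ _ => hs.exists_Ico τ,
    fun k => ⟨⟨hJ' _, Eventually.of_forall fun x => ?_⟩, ?_⟩,
    fun k => ⟨⟨hJ' _, Eventually.of_forall fun x => ?_⟩, ?_⟩,
    fun k τ hτ => ⟨hvΦ k τ hτ.1 hτ.2, ?_, fun hr => ?_⟩,
    fun k => ⟨hΦ1 k, hT1 k, hP1 k⟩, fun k => ⟨hΦ2 k, hT2 k, hP2 k⟩,
    fun k => ⟨hΦ3 k, hT3 k, hP3 k⟩, hΦ4, hT4, hP4, ?_⟩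
  · refine Subset.antisymm ?_ ?_
    · rintro _ ⟨k, rfl⟩
      exact ⟨hJ' _, hs.v_eq_zero hell h k⟩
    · rintro τ ⟨-, hv⟩
      obtain ⟨k, hk⟩ := hs.exists_Ico τ
      refine ⟨k, le_antisymm hk.1 (not_lt.1 fun hlt => ?_)⟩
      exact hs.v_ne_zero ⟨hlt, hk.2⟩ hv
  · rw [hs.apoapsis]
    exact (hell.mem_Icc (hJ' x)).2
  · unfold u
    rw [hs.apoapsis]
  · rw [hs.periapsis]
    exact (hell.mem_Icc (hJ' x)).1
  · unfold u
    rw [hs.periapsis]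
  · rw [properQuantity_eq]
    exact hP k τ hτ.1 hτ.2
  · rw [timeQuantity_eq hu1 ⟨hJ' τ, hr⟩ (hiT τ)]
    exact congrArg _ (hT k τ hτ.1 hτ.2)
  · have hstep : γ.AngleSingleValued L E u₀ ↔
        ∀ k, (cΦ (k + 1) : Real.Angle) = (cΦ k : Real.Angle) := by
      constructor
      · rintro ⟨ϑ, hϑ⟩
        have key : ∀ k, (cΦ k : Real.Angle) = ϑ := by
          intro k
          have hlt := hs.lt_succ k
          have hm : (s k + s (k + 1)) / 2 ∈ Ioo (s k) (s (k + 1)) :=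
            ⟨by linarith, by linarith⟩
          have hv := hs.v_ne_zero hm
          rw [← hvΦ k _ (Ioo_subset_Icc_self hm) (Or.inl hv), hϑ _ (hJ' _) hv]
        exact fun k => (key _).trans (key _).symm
      · intro hk
        refine ⟨(cΦ 0 : Real.Angle), fun τ _ hv => ?_⟩
        obtain ⟨k, hτ⟩ := hs.exists_Ico τ
        rw [hvΦ k τ (Ico_subset_Icc_self hτ) (Or.inl hv), angle_eq_of_forall_succ hk]
    rw [hstep, ← hΦ1 0, ← hΦ2 0, ← Real.Angle.angle_eq_iff_two_pi_dvd_sub,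
      ← Real.Angle.angle_eq_iff_two_pi_dvd_sub]
    constructor
    · intro hk
      exact ⟨by simpa using hk (2 * 0 - 1), hk _⟩
    · rintro ⟨h1, h2⟩ k
      rw [Real.Angle.angle_eq_iff_two_pi_dvd_sub] at h1 h2 ⊢
      rcases Int.even_or_odd' k with ⟨m, rfl | rfl⟩
      · rw [hΦ2, ← hΦ2 0]
        exact h2
      · have e1 := hΦ1 (m + 1)
        have e2 : 2 * (m + 1) - 1 = 2 * m + 1 := by ring
        have e3 : 2 * (m + 1) = 2 * m + 1 + 1 := by ring
        rw [e2, e3] at e1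
        rw [e1, ← hΦ1 0]
        exact h1

theorem IsMultiValued.not_isGlobal {u₀ u₁ u₂ : ℝ} (hm : γ.IsMultiValued L E u₀ u₁ u₂)
    (hJ : γ.J = univ) : ¬ γ.IsGlobal L E u₀ := by
  rintro ⟨c, _, _, hc, -⟩
  obtain ⟨s, cΦ, _, _, hmono, hrange, -, -, -, hval, -, -, -, hinf, -⟩ := hm
  refine hinf ((finite_singleton c).subset ?_)
  rintro _ ⟨k, rfl⟩
  have hlt := hmono (lt_add_one k)
  have hmem : ∀ x, x ∈ γ.J := fun x => hJ ▸ mem_univ x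
  have hv : deriv γ.r ((s k + s (k + 1)) / 2) ≠ 0 := by
    intro h0
    obtain ⟨l, hl⟩ : (s k + s (k + 1)) / 2 ∈ range s := hrange.symm ▸ ⟨hmem _, h0⟩
    have h1 : k < l := hmono.lt_iff_lt.1 (by linarith)
    have h2 : l < k + 1 := hmono.lt_iff_lt.1 (by linarith)
    omega
  rw [mem_singleton_iff, ← (hc _ (hmem ((s k + s (k + 1)) / 2))).1]
  exact (hval k _ ⟨⟨by linarith, by linarith⟩, Or.inl hv⟩).1.symm

end TimelikeGeodesic

end Schwarzschild

theorem theorem3 {M : ℝ} (hM : 0 < M) (γ : Schwarzschild.TimelikeGeodesic M)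
    (hmax : γ.IsMaximal) (hnc : ¬ γ.IsCircular) (L E : ℝ) (hL : L ≠ 0)
    (hLE : ∃ τ ∈ γ.J, 2 * M < γ.r τ ∧ L = γ.r τ ^ 2 * deriv γ.φ τ ∧
      E = (γ.r τ - 2 * M) / γ.r τ * deriv γ.t τ)
    (u₀ : ℝ) (hu₀ : γ.IsTP u₀ ∨ γ.IsIP u₀ ∨ γ.IsHP u₀) :
    γ.QuadraturesConverge L E u₀ ∧
    (γ.IsGlobal L E u₀ ↔ γ.GlobalCase u₀) ∧
    (¬ γ.GlobalCase u₀ → ¬ γ.IsEllipticLike → γ.IsDoubleValued L E u₀) ∧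
    (∀ rmin rmax : ℝ, γ.IsEllipticLikeBetween rmin rmax →
      γ.IsMultiValued L E u₀ (2 * M / rmax) (2 * M / rmin)) := by
  obtain ⟨hc, hE⟩ := γ.hasConstants hM hLE
  have h : γ.IsOrbit L E := ⟨hc, hM, hL, hE, hmax, hnc, hLE.imp fun τ hτ => ⟨hτ.1, hτ.2.1⟩⟩
  obtain ⟨τ₀, hτ₀, hu, -⟩ := Schwarzschild.TimelikeGeodesic.exists_of_zeroPoint h hu₀
  refine ⟨?_, ⟨fun hg => ?_, h.isGlobal_of_globalCase hu₀⟩,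
    fun hg hell => h.isDoubleValued hell hu₀ hg, fun rmin rmax hell => hell.isMultiValued h hu⟩
  · by_cases hell : γ.IsEllipticLike
    · obtain ⟨rmin, rmax, hell⟩ := hell
      exact hu ▸ hell.quadraturesConverge h τ₀
    · exact hu ▸ h.quadraturesConverge hell hτ₀
  · by_contra hng
    by_cases hell : γ.IsEllipticLike
    · obtain ⟨rmin, rmax, hell⟩ := hell
      exact (hell.isMultiValued h hu).not_isGlobal (hell.J_eq_univ h) hg
    · exact (h.isDoubleValued hell hu₀ hng).not_isGlobal hg
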